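/- Let $d\ge 1$, let $0<\beta<1$ and $C_\beta>0$. Let $\gamma:\mathbb R\to[0,\infty)$ be measurable, nonnegative definite in the sense of distributions, with $\gamma(t)\le C_\beta|t|^{-\beta}$ for $t\neq 0$. Let $\Lambda$ be a nonnegative tempered measure on $\mathbb R^d$ (a nonnegative function $\Lambda$ is identified with the measure $\Lambda(x)\,dx$) whose Fourier transform $\mathcal F\Lambda$, taken in the sense of tempered distributions with $\mathcal Fu(\xi)=\int e^{-i\langle\xi,x\rangle}u(x)\,dx$, is a nonnegative measure $\mu$ with $$\int_{\mathbb R^d}\frac{\mu(d\xi)}{1+|\xi|^{2-2\beta}}<\infty .$$ Let $W=\{W(\varphi):\varphi\in\mathcal D([0,\infty)\times\mathbb R^d)\}$ be a centered Gaussian family with covariance $$\mathbf E[W(\varphi)W(\psi)]=\int_{\mathbb R_+^2\times\mathbb R^{2d}}\varphi(s,x)\psi(t,y)\gamma(s-t)\Lambda(x-y)\,dx\,dy\,ds\,dt ,$$ and write $\int_0^\infty\!\int f(r,y)\,W(dr,dy)$ for its extension (Wiener integral), by $L^2$ limits, to functions $f$ with $\int_{\mathbb R_+^2\times\mathbb R^{2d}}|f(s,x)f(t,y)|\gamma(s-t)\Lambda(x-y)\,dx\,dy\,ds\,dt<\infty$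 that are limits of test functions in the corresponding norm. Let $B$ be a standard $d$-dimensional Brownian motion independent of $W$ (the pair is realised on a product space, $\mathbf E_B$ and $\mathbf E_W$ are the expectations in one factor, $\mathbf P,\mathbf E$ refer to the pair), $B^x=x+B$, and let $p_\varepsilon(x)=(2\pi\varepsilon)^{-d/2}e^{-|x|^2/(2\varepsilon)}$. Then: 1. For all $t\ge0$, $x\in\mathbb R^d$, $\varepsilon>0$, the functional $$V^\varepsilon_{t,x}=\int_0^t\int_{\mathbb R^d}p_\varepsilon(B^x_{t-r}-y)\,W(dr,dy),$$ a Wiener integral for a fixed path of $B$, is a well defined (jointly measurable) random variable in $L^2(\mathbf P)$, and as $\varepsilon\downarrow0$ it converges in $L^2(\mathbf P)$ to a random variable $V_{t,x}$, which gives the meaning of $\int_0^t\int\delta_0(B^x_{t-r}-y)W(dr,dy)$. 2. Conditionally on $B$, $V_{t,x}$ is Gaussian with mean $0$ and variance $$\mathbf{Var}_W(V_{t,x})=\int_0^t\int_0^t\gamma(r-s)\Lambda(B_r-B_s)\,dr\,ds .$$ For a general measure $\Lambda$ the right-hand side denotes the limit in $L^1$, as $\varepsilon\downarrow0$, of $\int_0^t\int_0^t\gamma(r-s)(p_\varepsilon*\Lambda)(B_r-B_s)\,dr\,ds$,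 which exists; if $\Lambda$ is a (finite-valued, measurable) function, it equals almost surely the absolutely convergent double integral. 3. For every $\lambda\in\mathbb R$ and $T>0$, $$\sup_{t\in[0,T],\,x\in\mathbb R^d}\mathbf E\big[\exp(\lambda V_{t,x})\big]<\infty .$$ 4. In particular, for every bounded continuous $u_0:\mathbb R^d\to\mathbb R$, every $t\ge0$ and $x\in\mathbb R^d$, the Feynman–Kac functional $u_{t,x}=\mathbf E_B\big[u_0(B^x_t)\exp(V_{t,x})\big]$ is well defined: $u_0(B^x_t)\exp(V_{t,x})$ is $\mathbf P$-integrable, and for almost every realisation of $W$ it is integrable with respect to the law of $B$. -/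

import Mathlib

open MeasureTheory ProbabilityTheory Filter Topology
open scoped NNReal ENNReal Distributions SchwartzMap BoundedContinuousFunction ComplexConjugate

noncomputable section

namespace FeynmanKac

/-- The Euclidean space `ℝ^d`. -/
abbrev Space (d : ℕ) : Type := EuclideanSpace ℝ (Fin d)

/-- The heat kernel `p_ε(x) = (2πε)^{-d/2} exp(-|x|²/(2ε))`. -/
def heatKernel (d : ℕ) (ε : ℝ) (x : Space d) : ℝ :=
  (2 * Real.pi * ε) ^ (-(d : ℝ) / 2) * Real.exp (-‖x‖ ^ 2 / (2 * ε))

/-- The Fourier transform `ℱφ(x) = ∫ e^{-i⟨x,v⟩} φ(v) dv` (no normalising constant). -/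
def spaceFourier {d : ℕ} (φ : Space d → ℂ) (x : Space d) : ℂ :=
  ∫ v, Complex.exp (-Complex.I * ((inner ℝ x v : ℝ) : ℂ)) * φ v

/-- `ℱΛ = μ` in the sense of tempered distributions: `⟨μ, φ⟩ = ⟨Λ, ℱφ⟩` for all Schwartz `φ`. -/
def IsFourierTransform {d : ℕ} (Λ μ : Measure (Space d)) : Prop :=
  ∀ φ : 𝓢(Space d, ℂ), ∫ ξ, φ ξ ∂μ = ∫ x, spaceFourier φ x ∂Λ

/-- Nonnegative definiteness of a (locally integrable) function of time, in the sense of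
distributions: `∫∫ φ(s) conj(φ(t)) γ(s-t) ds dt` is real and nonnegative for test functions `φ`. -/
def IsNonnegDefinite (γ : ℝ → ℝ) : Prop :=
  ∀ φ : 𝓓((⊤ : TopologicalSpace.Opens ℝ), ℂ),
    0 ≤ (∫ s, ∫ t, φ s * conj (φ t) * (γ (s - t) : ℂ)).re ∧
      (∫ s, ∫ t, φ s * conj (φ t) * (γ (s - t) : ℂ)).im = 0

/-- Space-time test functions: smooth compactly supported functions on `ℝ × ℝ^d`. Only their
restrictions to `[0,∞) × ℝ^d` enter below, so that they stand for `𝒟([0,∞) × ℝ^d)`. -/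
abbrev SpaceTimeTest (d : ℕ) : Type :=
  𝓓((⊤ : TopologicalSpace.Opens (ℝ × Space d)), ℝ)

/-- The covariance form
`∫_{ℝ₊²×ℝ^{2d}} φ(s,x) ψ(t,y) γ(s-t) Λ(x-y) dx dy ds dt`,
written for a measure `Λ` (substitute `x = y + z` with `z` distributed according to `Λ`). -/
def covForm {d : ℕ} (γ : ℝ → ℝ) (Λ : Measure (Space d)) (φ ψ : ℝ × Space d → ℝ) : ℝ :=
  ∫ s in Set.Ici (0 : ℝ), ∫ t in Set.Ici (0 : ℝ),
    γ (s - t) * ∫ y, ∫ z, φ (s, y + z) * ψ (t, y) ∂Λ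

/-- The same form for `φ = ψ = |f|`, as an element of `[0,∞]`: the square of the absolute norm
of `f`, finite exactly when
`∫_{ℝ₊²×ℝ^{2d}} |f(s,x) f(t,y)| γ(s-t) Λ(x-y) dx dy ds dt < ∞`. -/
def absEnergy {d : ℕ} (γ : ℝ → ℝ) (Λ : Measure (Space d)) (f : ℝ × Space d → ℝ) : ℝ≥0∞ :=
  ∫⁻ s in Set.Ici (0 : ℝ), ∫⁻ t in Set.Ici (0 : ℝ),
    ENNReal.ofReal (γ (s - t)) * ∫⁻ y, ∫⁻ z, ‖f (s, y + z)‖ₑ * ‖f (t, y)‖ₑ ∂Λ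

/-- The noise `W`: a centered Gaussian family indexed by test functions with covariance
`covForm γ Λ`. -/
structure IsGaussianNoise {d : ℕ} {Ω : Type*} [MeasurableSpace Ω] (P : Measure Ω)
    (γ : ℝ → ℝ) (Λ : Measure (Space d)) (W : SpaceTimeTest d → Ω → ℝ) : Prop where
  gaussian : IsGaussianProcess W P
  centered : ∀ φ, ∫ ω, W φ ω ∂P = 0
  covariance : ∀ φ ψ, ∫ ω, W φ ω * W ψ ω ∂P = covForm γ Λ φ ψ

/-- `X = W(f) = ∫₀^∞ ∫ f(t,x) W(dt,dx)`, the Wiener integral of a function `f`: the `L²` limit of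
`W(φ_n)` along test functions `φ_n` that converge to `f` in the absolute norm. -/
def IsWienerIntegral {d : ℕ} {Ω : Type*} [MeasurableSpace Ω] (P : Measure Ω)
    (γ : ℝ → ℝ) (Λ : Measure (Space d)) (W : SpaceTimeTest d → Ω → ℝ)
    (f : ℝ × Space d → ℝ) (X : Ω → ℝ) : Prop :=
  MemLp X 2 P ∧ ∃ φ : ℕ → SpaceTimeTest d,
    Tendsto (fun n ↦ absEnergy γ Λ (fun p ↦ φ n p - f p)) atTop (𝓝 0) ∧
    Tendsto (fun n ↦ eLpNorm (fun ω ↦ W (φ n) ω - X ω) 2 P) atTop (𝓝 0)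

/-- A `d`-dimensional standard Brownian motion started at `0`: the coordinates are independent
real Brownian motions (with almost surely continuous paths). -/
structure IsBrownianMotion {d : ℕ} {Ω : Type*} [MeasurableSpace Ω] (Q : Measure Ω)
    (B : ℝ≥0 → Ω → Space d) : Prop where
  coord : ∀ i, IsBrownianReal (fun t ω ↦ B t ω i) Q
  indep : iIndepFun (fun (i : Fin d) ω (t : ℝ≥0) ↦ B t ω i) Q

/-- For a path `b`, the function `A(r,y) = p_ε(x + b_{t-r} - y) 1_{[0,t]}(r)`. -/
def kernelA {d : ℕ} (ε t : ℝ) (x : Space d) (b : ℝ≥0 → Space d) (p : ℝ × Space d) : ℝ :=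
  (Set.Icc 0 t).indicator (fun r ↦ heatKernel d ε (x + b (t - r).toNNReal - p.2)) p.1

/-- `V : Ω × Ω' → ℝ` is (a jointly measurable version of) the regularised functional
`V^ε_{t,x} = ∫₀ᵗ ∫ p_ε(B^x_{t-r} - y) W(dr,dy)`, a Wiener integral for a fixed path of `B`.
The noise lives on `(Ω, P)`, the Brownian motion on `(Ω', Q)`. -/
def IsRegularized {d : ℕ} {Ω Ω' : Type*} [MeasurableSpace Ω] [MeasurableSpace Ω']
    (P : Measure Ω) (Q : Measure Ω') (γ : ℝ → ℝ) (Λ : Measure (Space d))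
    (W : SpaceTimeTest d → Ω → ℝ) (B : ℝ≥0 → Ω' → Space d)
    (ε t : ℝ) (x : Space d) (V : Ω × Ω' → ℝ) : Prop :=
  AEStronglyMeasurable V (P.prod Q) ∧
    ∀ᵐ ω' ∂Q, IsWienerIntegral P γ Λ W (kernelA ε t x (fun s ↦ B s ω')) (fun ω ↦ V (ω, ω'))

/-- For a path `b` and a function `g`, the integral
`∫₀ᵗ ∫₀ᵗ γ(r-s) g(b_r - b_s) dr ds`. -/
def selfIntersection {d : ℕ} (γ : ℝ → ℝ) (g : Space d → ℝ) (t : ℝ) (b : ℝ≥0 → Space d) : ℝ :=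
  ∫ p in Set.Icc (0 : ℝ) t ×ˢ Set.Icc (0 : ℝ) t,
    γ (p.1 - p.2) * g (b p.1.toNNReal - b p.2.toNNReal)

/-- `Y = ∫₀ᵗ ∫₀ᵗ γ(r-s) Λ(B_r - B_s) dr ds` for a measure `Λ`: the `L¹` limit, as `ε ↓ 0`, of the
same integrals with `Λ` replaced by the function `p_ε * Λ`. -/
def IsSelfIntersection {d : ℕ} {Ω' : Type*} [MeasurableSpace Ω'] (Q : Measure Ω')
    (γ : ℝ → ℝ) (Λ : Measure (Space d)) (B : ℝ≥0 → Ω' → Space d) (t : ℝ) (Y : Ω' → ℝ) : Prop :=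
  Integrable Y Q ∧
    Tendsto (fun ε : ℝ ↦ eLpNorm (fun ω' ↦
        selfIntersection γ (fun w ↦ ∫ y, heatKernel d ε (w - y) ∂Λ) t (fun s ↦ B s ω') - Y ω') 1 Q)
      (𝓝[>] 0) (𝓝 0)

end FeynmanKac

end

open FeynmanKac

/-!
Everything rests on one function of the spectral measure,
`peak μ u = (2π)^{-d} ∫ e^{-u|ξ|²/2} μ(dξ)`. Testing `ℱΛ = μ` on modulated Gaussians gives
`(p_ε * Λ)(x) = (2π)^{-d} ∫ cos⟨x, ξ⟩ e^{-ε|ξ|²/2} μ(dξ)` (`mollify_eq_integral_cos`). Hence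
`0 ≤ p_ε * Λ ≤ peak μ ε`, and a Brownian increment over a time `u`, whose Fourier multiplier is
`e^{-u|ξ|²/2}`, sends `p_ε * Λ` to `p_{ε+u} * Λ`, also conditionally on the past. In particular
`E[(p_ε * Λ)(B_r - B_s)] = peak μ (ε + |r - s|)`. The condition on `μ` makes `peak` finite
and gives `∫₀ᵀ u^{-β} peak μ u du < ∞` (`integrableOn_rpow_mul_peak`), which makes `peak μ |r - s|`
integrable for `γ(r-s) dr ds` on bounded squares.

*Wiener integrals.* The covariance is regarded as a measure on pairs of space-time points. It is
positive semidefinite on test functions because it is the covariance of the noise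
(`IsGaussianNoise.isPosDefPair`), and this yields Cauchy–Schwarz for the energy
`∫ |f(p)| |f(q)| ν(dp, dq)`, the density of test functions in the functions of finite energy, and
the Itô isometry. Along a fixed path the regularised kernel has finite energy. Its Wiener integral
depends continuously in `L²` on the path, so that it has a jointly measurable version.

*The limit.* By the semigroup property of the heat kernel, the conditional covariance of the
regularised functionals at `ε` and `η` is `∫₀ᵗ∫₀ᵗ γ(r-s) (p_{ε+η} * Λ)(B_r - B_s) dr ds`. Its mean
is `∫₀ᵗ∫₀ᵗ γ(r-s) peak μ (ε + η + |r - s|) dr ds`, which by dominated convergence tends to a finite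
limit as `ε, η → 0`. The functionals are therefore Cauchy in `L²`
(`IsNoiseCovariance.exists_limit`), and their conditional second moments, the regularised
self-intersections, converge in `L¹`. A subsequence converges in `L²` along almost every path,
where Gaussian laws are closed under `L²` limits.

*Exponential moments.* Conditionally on `B`, the exponential moment of `V` is `exp(λ² σ² / 2)` with
`σ²` the self-intersection, so it suffices to bound the exponential moments of the regularised
self-intersections uniformly in `ε` and to apply Fatou's lemma. These are at most `∫₀ᵀ a_u du` for
a rate `a_u` whose conditional expectation given the past up to `r` is at most `g(u - r)`, with `g`
integrable and independent of `ε` (`integral_mul_rate_le`). Khas'minskii's lemma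
(`integral_exp_le_of_conditional_bound`) then applies for every `λ`, because an exponential weight
in time makes the constant `λ ∫ e^{-κv} g(v) dv` small.

*Densities.* If `Λ` has a density `ℓ`, the increments of `B` have heat kernel laws, and
`p_ε * Λ → ℓ` in `L¹(p_u)` for every `u > 0` (`tendsto_lintegral_mollify_sub`). Dominated
convergence in `(r, s)` identifies the self-intersection with the double integral of
`γ(r-s) ℓ(B_r - B_s)`.

Brownian motion is assumed to have continuous paths only almost surely, so the argument is carried
out for a version all of whose paths are continuous (`IsBrownianMotion.exists_regular`), which
agrees with the given process at all times simultaneously, almost surely.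
-/

namespace FeynmanKac

/-! ### Gaussian Schwartz functions and the heat kernel -/

lemma one_add_pow_mul_exp_neg_sq_le (m : ℕ) {b : ℝ} (hb : 0 < b) :
    ∃ C : ℝ, 0 ≤ C ∧ ∀ r : ℝ, 0 ≤ r → (1 + r) ^ m * Real.exp (-b * r ^ 2) ≤ C := by
  refine ⟨m.factorial * Real.exp (1 + 1 / (4 * b)), by positivity, fun r hr ↦ ?_⟩
  have h1 : (1 + r) ^ m ≤ m.factorial * Real.exp (1 + r) := by
    have := Real.pow_div_factorial_le_exp (1 + r) (by positivity) m
    rwa [div_le_iff₀' (by positivity)] at this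
  calc (1 + r) ^ m * Real.exp (-b * r ^ 2)
      ≤ m.factorial * Real.exp (1 + r) * Real.exp (-b * r ^ 2) := by gcongr
    _ = m.factorial * Real.exp (1 + r + -b * r ^ 2) := by rw [mul_assoc, ← Real.exp_add]
    _ ≤ m.factorial * Real.exp (1 + 1 / (4 * b)) := by
      have : 0 ≤ b * (r - 1 / (2 * b)) ^ 2 := by positivity
      refine mul_le_mul_of_nonneg_left (Real.exp_le_exp.2 ?_) (by positivity)
      have h2 : b * (r - 1 / (2 * b)) ^ 2 = b * r ^ 2 - r + 1 / (4 * b) := by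
        field_simp; ring
      linarith

section Gaussian

variable {d : ℕ}

/-- The exponent `-b|y|² + c⟨w, y⟩` of a complex Gaussian. -/
noncomputable def gaussExponent (b : ℝ) (c : ℂ) (w y : Space d) : ℂ :=
  -(b : ℂ) * (‖y‖ ^ 2 : ℝ) + c * (inner ℝ w y : ℝ)

lemma gaussExponent_hasTemperateGrowth (b : ℝ) (c : ℂ) (w : Space d) :
    (gaussExponent b c w).HasTemperateGrowth := by
  have h1 : Function.HasTemperateGrowth (fun y : Space d ↦ ((‖y‖ ^ 2 : ℝ) : ℂ)) :=
    Function.Complex.hasTemperateGrowth_ofReal.comp (Function.hasTemperateGrowth_norm_sq _)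
  have h2 : Function.HasTemperateGrowth (fun y : Space d ↦ ((inner ℝ w y : ℝ) : ℂ)) :=
    Function.Complex.hasTemperateGrowth_ofReal.comp (Function.hasTemperateGrowth_inner_right w)
  exact ((Function.HasTemperateGrowth.const _).mul h1).add
    ((Function.HasTemperateGrowth.const _).mul h2)

lemma gaussExponent_re_le {b : ℝ} (hb : 0 < b) (c : ℂ) (w y : Space d) :
    (gaussExponent b c w y).re ≤ (‖c‖ * ‖w‖) ^ 2 / (2 * b) - b / 2 * ‖y‖ ^ 2 := by
  have h1 : (gaussExponent b c w y).re = -b * ‖y‖ ^ 2 + c.re * inner ℝ w y := by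
    simp [gaussExponent, Complex.mul_re, - Complex.ofReal_pow]
  have h2 : c.re * inner ℝ w y ≤ ‖c‖ * ‖w‖ * ‖y‖ := by
    calc c.re * inner ℝ w y ≤ |c.re * inner ℝ w y| := le_abs_self _
      _ = |c.re| * |inner ℝ w y| := abs_mul _ _
      _ ≤ ‖c‖ * (‖w‖ * ‖y‖) := by
        gcongr
        · exact Complex.abs_re_le_norm c
        · exact abs_real_inner_le_norm w y
      _ = _ := by ring
  set k := ‖c‖ * ‖w‖
  have : 0 ≤ (b * ‖y‖ - k) ^ 2 / (2 * b) := by positivity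
  have h3 : (b * ‖y‖ - k) ^ 2 / (2 * b) = b / 2 * ‖y‖ ^ 2 - k * ‖y‖ + k ^ 2 / (2 * b) := by
    field_simp; ring
  rw [h1]; linarith

/-- Every derivative of `exp` at `z` has norm `|e^z|`: the bound on the outer function in the
Faà di Bruno estimate for a Gaussian. -/
lemma norm_iteratedFDeriv_cexp (i : ℕ) (z : ℂ) :
    ‖iteratedFDeriv ℝ i Complex.exp z‖ = Real.exp z.re := by
  have h := (Complex.contDiff_exp (𝕜 := ℂ) (n := i)).contDiffAt (x := z)
  rw [← h.restrictScalars_iteratedFDeriv (𝕜 := ℝ)]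
  simp only [Function.comp_apply, ContinuousMultilinearMap.norm_restrictScalars]
  rw [norm_iteratedFDeriv_eq_norm_iteratedDeriv, iteratedDeriv_eq_iterate]
  simp [Complex.norm_exp]

/-- The Gaussian `y ↦ exp(-b|y|² + c⟨w, y⟩)`, with `b > 0` and `c` complex, as a Schwartz
function. Its decay follows from the Faà di Bruno bound: the exponent has temperate growth and
every derivative of the exponential is bounded by the exponential itself. -/
noncomputable def gaussSchwartz {b : ℝ} (hb : 0 < b) (c : ℂ) (w : Space d) : 𝓢(Space d, ℂ) where
  toFun y := Complex.exp (gaussExponent b c w y)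
  smooth' := Complex.contDiff_exp.comp (gaussExponent_hasTemperateGrowth b c w).1
  decay' := by
    intro k n
    obtain ⟨m, A, hA, h⟩ :=
      (gaussExponent_hasTemperateGrowth b c w).norm_iteratedFDeriv_le_uniform n
    obtain ⟨D, hD0, hD⟩ := one_add_pow_mul_exp_neg_sq_le (k + m * n) (half_pos hb)
    set K := (‖c‖ * ‖w‖) ^ 2 / (2 * b)
    refine ⟨n.factorial * Real.exp K * (max A 1) ^ n * D, fun y ↦ ?_⟩
    have hq : ContDiff ℝ n (gaussExponent b c w) :=
      (gaussExponent_hasTemperateGrowth b c w).1.of_le (by exact_mod_cast le_top)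
    have key : ‖iteratedFDeriv ℝ n (Complex.exp ∘ gaussExponent b c w) y‖ ≤
        n.factorial * Real.exp (gaussExponent b c w y).re * (max A 1 * (1 + ‖y‖) ^ m) ^ n := by
      refine norm_iteratedFDeriv_comp_le (N := n) Complex.contDiff_exp hq le_rfl y
        (fun i _ ↦ (norm_iteratedFDeriv_cexp i _).le) (fun i hi1 hin ↦ ?_)
      have hbase : (1 : ℝ) ≤ max A 1 * (1 + ‖y‖) ^ m := by
        have : (1 : ℝ) ≤ (1 + ‖y‖) ^ m := one_le_pow₀ (by linarith [norm_nonneg y])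
        calc (1 : ℝ) = 1 * 1 := by ring
          _ ≤ _ := mul_le_mul (le_max_right _ _) this zero_le_one (by positivity)
      calc ‖iteratedFDeriv ℝ i (gaussExponent b c w) y‖ ≤ A * (1 + ‖y‖) ^ m := h i hin y
        _ ≤ max A 1 * (1 + ‖y‖) ^ m := by gcongr; exact le_max_left _ _
        _ ≤ _ := le_self_pow₀ hbase (by omega)
    calc ‖y‖ ^ k * ‖iteratedFDeriv ℝ n (Complex.exp ∘ gaussExponent b c w) y‖
        ≤ (1 + ‖y‖) ^ k * (n.factorial * Real.exp (K - b / 2 * ‖y‖ ^ 2) *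
            (max A 1 * (1 + ‖y‖) ^ m) ^ n) := by
          gcongr
          · linarith
          · refine key.trans ?_
            gcongr
            exact gaussExponent_re_le hb c w y
      _ = n.factorial * Real.exp K * (max A 1) ^ n *
            ((1 + ‖y‖) ^ (k + m * n) * Real.exp (-(b / 2) * ‖y‖ ^ 2)) := by
          rw [show K - b / 2 * ‖y‖ ^ 2 = K + -(b / 2) * ‖y‖ ^ 2 by ring, Real.exp_add]
          ring
      _ ≤ _ := by gcongr; exact hD _ (norm_nonneg y)

lemma gaussSchwartz_apply {b : ℝ} (hb : 0 < b) (c : ℂ) (w y : Space d) :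
    gaussSchwartz hb c w y = Complex.exp (gaussExponent b c w y) := rfl

lemma heatKernel_pos {ε : ℝ} (hε : 0 < ε) (x : Space d) : 0 < heatKernel d ε x := by
  unfold heatKernel; positivity

lemma heatKernel_nonneg {ε : ℝ} (hε : 0 < ε) (x : Space d) : 0 ≤ heatKernel d ε x :=
  (heatKernel_pos hε x).le

lemma heatKernel_neg (ε : ℝ) (x : Space d) : heatKernel d ε (-x) = heatKernel d ε x := by
  simp [heatKernel]

lemma continuous_heatKernel (ε : ℝ) : Continuous (heatKernel d ε) := by
  unfold heatKernel; fun_prop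

@[fun_prop]
lemma measurable_heatKernel (ε : ℝ) : Measurable (heatKernel d ε) :=
  (continuous_heatKernel ε).measurable

lemma heatKernel_sub_eq_norm_gaussSchwartz {ε : ℝ} (hε : 0 < ε) (x y : Space d) :
    heatKernel d ε (x - y) = (2 * Real.pi * ε) ^ (-(d : ℝ) / 2) * Real.exp (-‖x‖ ^ 2 / (2 * ε)) *
      ‖gaussSchwartz (b := 1 / (2 * ε)) (by positivity) ((1 / ε : ℝ) : ℂ) x y‖ := by
  rw [gaussSchwartz_apply, Complex.norm_exp, heatKernel, mul_assoc _ (Real.exp _), ← Real.exp_add]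
  congr 2
  have : (gaussExponent (1 / (2 * ε)) ((1 / ε : ℝ) : ℂ) x y).re =
      -(1 / (2 * ε)) * ‖y‖ ^ 2 + 1 / ε * inner ℝ x y := by
    rw [gaussExponent]
    rw [← Complex.ofReal_mul, ← Complex.ofReal_neg, ← Complex.ofReal_mul, ← Complex.ofReal_add,
      Complex.ofReal_re]
  rw [this, norm_sub_sq_real]
  field_simp; ring

lemma integrable_heatKernel_sub (Λ : Measure (Space d)) [Λ.HasTemperateGrowth] {ε : ℝ}
    (hε : 0 < ε) (x : Space d) : Integrable (fun y ↦ heatKernel d ε (x - y)) Λ := by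
  simp_rw [heatKernel_sub_eq_norm_gaussSchwartz hε x]
  exact ((gaussSchwartz _ _ _).integrable).norm.const_mul _

/-- The Fourier transform of a modulated Gaussian is a shifted heat kernel. -/
lemma spaceFourier_gaussSchwartz {ε : ℝ} (hε : 0 < ε) (x y : Space d) :
    spaceFourier (gaussSchwartz (half_pos hε) Complex.I x) y =
      (((2 * Real.pi) ^ d * heatKernel d ε (x - y) : ℝ) : ℂ) := by
  have h := GaussianFourier.integral_cexp_neg_mul_sq_norm_add (V := Space d)
    (b := ((ε / 2 : ℝ) : ℂ)) (by simpa using hε) Complex.I (x - y)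
  have e : spaceFourier (gaussSchwartz (half_pos hε) Complex.I x) y =
      ∫ v : Space d, Complex.exp (-((ε / 2 : ℝ) : ℂ) * ‖v‖ ^ 2 +
        Complex.I * (inner ℝ (x - y) v : ℝ)) := by
    unfold spaceFourier
    congr with v
    rw [gaussSchwartz_apply, ← Complex.exp_add, gaussExponent, inner_sub_left]
    push_cast; ring_nf
  rw [e, h, heatKernel]
  have hp : 0 < Real.pi := Real.pi_pos
  rw [finrank_euclideanSpace_fin, ← Complex.ofReal_div, Complex.I_sq]
  have e1 : ((d : ℂ) / 2) = ((d / 2 : ℝ) : ℂ) := by push_cast; rfl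
  rw [e1, ← Complex.ofReal_cpow (by positivity)]
  have e2 : Complex.exp (-1 * (‖x - y‖ : ℂ) ^ 2 / (4 * ((ε / 2 : ℝ) : ℂ))) =
      ((Real.exp (-‖x - y‖ ^ 2 / (2 * ε)) : ℝ) : ℂ) := by
    push_cast; congr 1; field_simp; ring
  rw [e2, ← Complex.ofReal_mul, ← mul_assoc]
  congr 2
  rw [show Real.pi / (ε / 2) = (2 * Real.pi) / ε by field_simp, neg_div,
    Real.rpow_neg (by positivity),
    Real.div_rpow (by positivity) hε.le, Real.mul_rpow (by positivity) hε.le]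
  have : (2 * Real.pi) ^ d = (2 * Real.pi) ^ ((d : ℝ) / 2) * (2 * Real.pi) ^ ((d : ℝ) / 2) := by
    rw [← Real.rpow_add (by positivity), add_halves, Real.rpow_natCast]
  rw [this]
  field_simp

/-- The semigroup property of the heat kernel, in the form `∫ p_ε(a-y) p_η(b-y) dy = p_{ε+η}(a-b)`.
Proved by completing the square. -/
lemma integral_heatKernel_mul_heatKernel {ε η : ℝ} (hε : 0 < ε) (hη : 0 < η) (a b : Space d) :
    ∫ y, heatKernel d ε (a - y) * heatKernel d η (b - y) = heatKernel d (ε + η) (a - b) := by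
  set k : ℝ := (ε + η) / (2 * ε * η) with hk
  have hk0 : 0 < k := by positivity
  set m : Space d := (η / (ε + η)) • a + (ε / (ε + η)) • b with hm
  have e : ∀ y, heatKernel d ε (a - y) * heatKernel d η (b - y) =
      (2 * Real.pi * ε) ^ (-(d : ℝ) / 2) * (2 * Real.pi * η) ^ (-(d : ℝ) / 2) *
        Real.exp (-‖a - b‖ ^ 2 / (2 * (ε + η))) * Real.exp (-k * ‖y - m‖ ^ 2) := by
    intro y
    have h : -‖a - y‖ ^ 2 / (2 * ε) + -‖b - y‖ ^ 2 / (2 * η) =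
        -‖a - b‖ ^ 2 / (2 * (ε + η)) + -k * ‖y - m‖ ^ 2 := by
      have h1 : ‖y - m‖ ^ 2 = ‖y‖ ^ 2 - 2 * (η / (ε + η) * inner ℝ a y + ε / (ε + η) * inner ℝ b y)
          + ((η / (ε + η)) ^ 2 * ‖a‖ ^ 2 + 2 * (η / (ε + η)) * (ε / (ε + η)) * inner ℝ a b
            + (ε / (ε + η)) ^ 2 * ‖b‖ ^ 2) := by
        rw [norm_sub_sq_real, hm, norm_add_sq_real, inner_add_right, inner_smul_right,
          inner_smul_right, norm_smul, norm_smul, inner_smul_left, inner_smul_right, mul_pow,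
          mul_pow, Real.norm_eq_abs, Real.norm_eq_abs, sq_abs, sq_abs, real_inner_comm a y,
          real_inner_comm b y]
        simp only [conj_trivial]
        ring
      rw [h1, norm_sub_sq_real, norm_sub_sq_real, norm_sub_sq_real, hk]
      field_simp
      ring
    unfold heatKernel
    calc _ = (2 * Real.pi * ε) ^ (-(d : ℝ) / 2) * (2 * Real.pi * η) ^ (-(d : ℝ) / 2) *
          Real.exp (-‖a - y‖ ^ 2 / (2 * ε) + -‖b - y‖ ^ 2 / (2 * η)) := by
            rw [Real.exp_add]; ring
      _ = _ := by rw [h, Real.exp_add]; ring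
  simp_rw [e]
  rw [integral_const_mul, integral_sub_right_eq_self (fun y ↦ Real.exp (-k * ‖y‖ ^ 2)) m,
    GaussianFourier.integral_rexp_neg_mul_sq_norm hk0, finrank_euclideanSpace_fin, heatKernel]
  have hp : 0 < Real.pi := Real.pi_pos
  have h2 : (2 * Real.pi * ε) ^ (-(d : ℝ) / 2) * (2 * Real.pi * η) ^ (-(d : ℝ) / 2) *
      (Real.pi / k) ^ ((d : ℝ) / 2) = (2 * Real.pi * (ε + η)) ^ (-(d : ℝ) / 2) := by
    rw [neg_div, Real.rpow_neg (by positivity), Real.rpow_neg (by positivity),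
      Real.rpow_neg (by positivity), ← Real.inv_rpow (by positivity),
      ← Real.inv_rpow (by positivity),
      ← Real.inv_rpow (by positivity), ← Real.mul_rpow (by positivity) (by positivity),
      ← Real.mul_rpow (by positivity) (by positivity)]
    congr 1
    rw [hk]; field_simp
  rw [← h2]; ring

end Gaussian

/-! ### Mollification and the spectral measure -/

section SigmaFinite

/-- The sets where a positive integrable function exceeds `1 / n` have finite measure and cover. -/
lemma sigmaFinite_of_integrable_pos {α : Type*} [MeasurableSpace α] {μ : Measure α} {f : α → ℝ}
    (hf : Integrable f μ) (hpos : ∀ x, 0 < f x) : SigmaFinite μ := by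
  refine Measure.sigmaFinite_of_countable
    (S := Set.range fun n : ℕ ↦ {x | 1 / ((n : ℝ) + 1) ≤ ‖f x‖}) (Set.countable_range _) ?_ ?_
  · rintro _ ⟨n, rfl⟩
    exact hf.measure_norm_ge_lt_top (by positivity)
  · refine Set.eq_univ_of_forall fun x ↦ ?_
    obtain ⟨n, hn⟩ := exists_nat_one_div_lt (hpos x)
    exact Set.mem_sUnion.2 ⟨_, ⟨n, rfl⟩, (hn.le.trans (le_abs_self _) : _)⟩

variable {d : ℕ} (Λ : Measure (Space d)) [hΛ : Λ.HasTemperateGrowth]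

lemma sigmaFinite_of_hasTemperateGrowth : SigmaFinite Λ :=
  sigmaFinite_of_integrable_pos Λ.integrable_pow_neg_integrablePower fun x ↦ by positivity

lemma isFiniteMeasureOnCompacts_of_hasTemperateGrowth : IsFiniteMeasureOnCompacts Λ := by
  refine ⟨fun K hK ↦ ?_⟩
  obtain ⟨R, hR⟩ := hK.isBounded.exists_norm_le
  refine (measure_mono fun x hx ↦ ?_).trans_lt
    (Λ.integrable_pow_neg_integrablePower.measure_norm_ge_lt_top
      (ε := (1 + max R 0) ^ (-(Λ.integrablePower : ℝ))) (by positivity))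
  have h0 := norm_nonneg x
  have h1 := hR x hx
  rw [Set.mem_ofPred_eq, Real.norm_eq_abs, abs_of_pos (by positivity)]
  exact Real.rpow_le_rpow_of_nonpos (by positivity)
    (by gcongr; exact h1.trans (le_max_left _ _)) (by simp)

end SigmaFinite

section Spectral

variable {d : ℕ}

/-- The mollification `p_ε * Λ` of a measure by the heat kernel. -/
noncomputable def mollify (Λ : Measure (Space d)) (ε : ℝ) (x : Space d) : ℝ :=
  ∫ y, heatKernel d ε (x - y) ∂Λ

/-- The Gaussian mass `(2π)^{-d} ∫ e^{-u|ξ|²/2} μ(dξ)` of the spectral measure: it is the value of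
`p_u * Λ` at the origin, which is also its maximum. -/
noncomputable def peak (μ : Measure (Space d)) (u : ℝ) : ℝ :=
  ((2 * Real.pi) ^ d)⁻¹ * ∫ ξ, Real.exp (-(u / 2) * ‖ξ‖ ^ 2) ∂μ

/-- Dalang's condition with exponent `a`, in the form used for the spectral measure. -/
def SpectralBound (μ : Measure (Space d)) (a : ℝ) : Prop :=
  ∫⁻ ξ, ENNReal.ofReal (1 / (1 + ‖ξ‖ ^ a)) ∂μ < ∞

lemma SpectralBound.integrable {μ : Measure (Space d)} {a : ℝ} (ha : 0 ≤ a)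
    (h : SpectralBound μ a) : Integrable (fun ξ ↦ 1 / (1 + ‖ξ‖ ^ a)) μ := by
  have hc : Continuous fun ξ : Space d ↦ 1 / (1 + ‖ξ‖ ^ a) := by
    refine continuous_const.div (continuous_const.add (continuous_norm.rpow_const fun _ ↦ .inr ha))
      fun ξ ↦ ?_
    positivity
  refine (lintegral_ofReal_ne_top_iff_integrable hc.aestronglyMeasurable
    (ae_of_all _ fun ξ ↦ by positivity)).1 h.ne

/-- A Gaussian is dominated by the weight of the spectral condition. -/
lemma exp_neg_mul_sq_le {a u : ℝ} (ha : 0 ≤ a) (ha2 : a ≤ 2) (hu : 0 < u) (r : ℝ) (hr : 0 ≤ r) :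
    Real.exp (-u * r ^ 2) ≤ (2 + 1 / u) * (1 / (1 + r ^ a)) := by
  have h1 : 1 + r ^ a ≤ 2 + r ^ 2 := by
    rcases le_total r 1 with h | h
    · have : r ^ a ≤ 1 := Real.rpow_le_one hr h ha
      nlinarith [sq_nonneg r]
    · have : r ^ a ≤ r ^ (2 : ℝ) := Real.rpow_le_rpow_of_exponent_le h ha2
      rw [Real.rpow_two] at this
      linarith
  have h2 : Real.exp (-u * r ^ 2) * (1 + u * r ^ 2) ≤ 1 := by
    have := Real.add_one_le_exp (u * r ^ 2)
    calc Real.exp (-u * r ^ 2) * (1 + u * r ^ 2)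
        ≤ Real.exp (-u * r ^ 2) * Real.exp (u * r ^ 2) := by gcongr; linarith
      _ = 1 := by rw [← Real.exp_add]; simp
  have h3 : 0 < 1 + r ^ a := by positivity
  rw [mul_one_div, le_div_iff₀ h3]
  have h4 : 2 + r ^ 2 ≤ (2 + 1 / u) * (1 + u * r ^ 2) := by
    have : (2 + 1 / u) * (1 + u * r ^ 2) = 2 + r ^ 2 + 1 / u + 2 * u * r ^ 2 := by
      field_simp; ring
    rw [this]
    have : 0 < 1 / u := by positivity
    have : 0 ≤ 2 * u * r ^ 2 := by positivity
    linarith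
  calc Real.exp (-u * r ^ 2) * (1 + r ^ a)
      ≤ Real.exp (-u * r ^ 2) * ((2 + 1 / u) * (1 + u * r ^ 2)) := by
        gcongr; exact h1.trans h4
    _ = (2 + 1 / u) * (Real.exp (-u * r ^ 2) * (1 + u * r ^ 2)) := by ring
    _ ≤ (2 + 1 / u) * 1 := by gcongr
    _ = _ := mul_one _

lemma SpectralBound.integrable_exp {μ : Measure (Space d)} {a u : ℝ} (ha : 0 ≤ a) (ha2 : a ≤ 2)
    (h : SpectralBound μ a) (hu : 0 < u) :
    Integrable (fun ξ ↦ Real.exp (-(u / 2) * ‖ξ‖ ^ 2)) μ := by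
  refine ((h.integrable ha).const_mul (2 + 1 / (u / 2))).mono'
    (by fun_prop) (ae_of_all _ fun ξ ↦ ?_)
  rw [Real.norm_eq_abs, Real.abs_exp]
  exact exp_neg_mul_sq_le ha ha2 (half_pos hu) _ (norm_nonneg _)

lemma SpectralBound.sigmaFinite {μ : Measure (Space d)} {a : ℝ} (ha : 0 ≤ a)
    (h : SpectralBound μ a) : SigmaFinite μ :=
  sigmaFinite_of_integrable_pos (h.integrable ha) fun ξ ↦ by positivity

lemma peak_nonneg (μ : Measure (Space d)) (u : ℝ) : 0 ≤ peak μ u :=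
  mul_nonneg (by positivity) (integral_nonneg fun _ ↦ (Real.exp_pos _).le)

lemma peak_antitone {μ : Measure (Space d)} {a : ℝ} (ha : 0 ≤ a) (ha2 : a ≤ 2)
    (h : SpectralBound μ a) {u v : ℝ} (hu : 0 < u) (huv : u ≤ v) : peak μ v ≤ peak μ u := by
  unfold peak
  refine mul_le_mul_of_nonneg_left ?_ (by positivity)
  refine integral_mono (h.integrable_exp ha ha2 (hu.trans_le huv)) (h.integrable_exp ha ha2 hu)
    fun ξ ↦ ?_
  dsimp only
  gcongr

lemma mollify_nonneg (Λ : Measure (Space d)) {ε : ℝ} (hε : 0 < ε) (x : Space d) :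
    0 ≤ mollify Λ ε x := integral_nonneg fun _ ↦ heatKernel_nonneg hε _

/-- The spectral representation of `p_ε * Λ`. Since `μ` is a nonnegative measure and `p_ε * Λ` is
real, only the cosine survives. -/
lemma mollify_eq_integral_cos {Λ μ : Measure (Space d)} (hΛμ : IsFourierTransform Λ μ)
    {ε : ℝ} (hε : 0 < ε) (hint : Integrable (fun ξ ↦ Real.exp (-(ε / 2) * ‖ξ‖ ^ 2)) μ)
    (x : Space d) :
    mollify Λ ε x = ((2 * Real.pi) ^ d)⁻¹ *
      ∫ ξ, Real.cos (inner ℝ x ξ) * Real.exp (-(ε / 2) * ‖ξ‖ ^ 2) ∂μ := by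
  have h := hΛμ (gaussSchwartz (half_pos hε) Complex.I x)
  simp_rw [spaceFourier_gaussSchwartz hε] at h
  rw [integral_complex_ofReal, integral_const_mul] at h
  have hre : ∀ ξ : Space d, (gaussSchwartz (half_pos hε) Complex.I x ξ).re =
      Real.cos (inner ℝ x ξ) * Real.exp (-(ε / 2) * ‖ξ‖ ^ 2) := by
    intro ξ
    rw [gaussSchwartz_apply, gaussExponent, Complex.exp_add, ← Complex.ofReal_neg,
      ← Complex.ofReal_mul, ← Complex.ofReal_exp, Complex.re_ofReal_mul, mul_comm Complex.I,
      Complex.exp_ofReal_mul_I_re, mul_comm]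
  have hint' : Integrable (gaussSchwartz (half_pos hε) Complex.I x) μ := by
    refine hint.mono' (SchwartzMap.continuous _).aestronglyMeasurable
      (ae_of_all _ fun ξ ↦ ?_)
    rw [gaussSchwartz_apply, Complex.norm_exp, gaussExponent]
    apply le_of_eq
    simp [- Complex.ofReal_pow]
  have h2 := congrArg Complex.re h
  rw [Complex.ofReal_re, ← RCLike.re_eq_complex_re, ← integral_re hint'] at h2
  simp only [RCLike.re_eq_complex_re, hre] at h2
  rw [h2, mollify, inv_mul_cancel_left₀ (by positivity)]

variable {Λ μ : Measure (Space d)}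

lemma mollify_le_peak (hΛμ : IsFourierTransform Λ μ)
    {ε : ℝ} (hε : 0 < ε) (hint : Integrable (fun ξ ↦ Real.exp (-(ε / 2) * ‖ξ‖ ^ 2)) μ)
    (x : Space d) : mollify Λ ε x ≤ peak μ ε := by
  rw [mollify_eq_integral_cos hΛμ hε hint, peak]
  refine mul_le_mul_of_nonneg_left ?_ (by positivity)
  refine integral_mono ?_ hint fun ξ ↦ ?_
  · refine hint.mono' (by fun_prop) (ae_of_all _ fun ξ ↦ ?_)
    rw [norm_mul, Real.norm_eq_abs, Real.norm_eq_abs, Real.abs_exp]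
    exact mul_le_of_le_one_left (Real.exp_pos _).le (Real.abs_cos_le_one _)
  · exact mul_le_of_le_one_left (Real.exp_pos _).le (Real.cos_le_one _)

lemma mollify_zero (hΛμ : IsFourierTransform Λ μ)
    {ε : ℝ} (hε : 0 < ε) (hint : Integrable (fun ξ ↦ Real.exp (-(ε / 2) * ‖ξ‖ ^ 2)) μ) :
    mollify Λ ε 0 = peak μ ε := by
  rw [mollify_eq_integral_cos hΛμ hε hint, peak]
  simp

lemma mollify_neg (hΛμ : IsFourierTransform Λ μ)
    {ε : ℝ} (hε : 0 < ε) (hint : Integrable (fun ξ ↦ Real.exp (-(ε / 2) * ‖ξ‖ ^ 2)) μ)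
    (x : Space d) : mollify Λ ε (-x) = mollify Λ ε x := by
  rw [mollify_eq_integral_cos hΛμ hε hint, mollify_eq_integral_cos hΛμ hε hint]
  simp

lemma continuous_mollify (hΛμ : IsFourierTransform Λ μ)
    {ε : ℝ} (hε : 0 < ε) (hint : Integrable (fun ξ ↦ Real.exp (-(ε / 2) * ‖ξ‖ ^ 2)) μ) :
    Continuous (mollify Λ ε) := by
  have : mollify Λ ε = fun x ↦ ((2 * Real.pi) ^ d)⁻¹ *
      ∫ ξ, Real.cos (inner ℝ x ξ) * Real.exp (-(ε / 2) * ‖ξ‖ ^ 2) ∂μ :=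
    funext fun x ↦ mollify_eq_integral_cos hΛμ hε hint x
  rw [this]
  refine continuous_const.mul (continuous_of_dominated (fun x ↦ by fun_prop)
    (fun x ↦ ae_of_all _ fun ξ ↦ ?_) hint (ae_of_all _ fun ξ ↦ by fun_prop))
  rw [norm_mul, Real.norm_eq_abs, Real.norm_eq_abs, Real.abs_exp]
  exact mul_le_of_le_one_left (Real.exp_pos _).le (Real.abs_cos_le_one _)

lemma continuousOn_peak {a : ℝ} (ha : 0 ≤ a) (ha2 : a ≤ 2) (h : SpectralBound μ a) :
    ContinuousOn (peak μ) (Set.Ioi 0) := by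
  intro u hu
  have hu' : (0 : ℝ) < u := hu
  refine (ContinuousAt.const_mul ?_ _).continuousWithinAt
  refine continuousAt_of_dominated (bound := fun ξ ↦ Real.exp (-((u / 2) / 2) * ‖ξ‖ ^ 2))
    (Eventually.of_forall fun x ↦ by fun_prop) ?_ (h.integrable_exp ha ha2 (half_pos hu'))
    (ae_of_all _ fun ξ ↦ by fun_prop)
  filter_upwards [lt_mem_nhds (half_lt_self hu')] with v hv
  refine ae_of_all _ fun ξ ↦ ?_
  rw [Real.norm_eq_abs, Real.abs_exp]
  gcongr

end Spectral

/-! ### The time singularity and the spectral condition -/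

section PeakIntegral

/-- For `r ≥ 1` scaling turns the integral into `r^{2β-2}` times a Gamma integral; for `r ≤ 1` the
exponential is bounded by `1`. -/
lemma lintegral_rpow_mul_exp_le {β T : ℝ} (hβ1 : β < 1) (hT : 0 < T) :
    ∃ K : ℝ, 0 ≤ K ∧ ∀ r : ℝ, 0 ≤ r →
      ∫⁻ u in Set.Ioc 0 T, ENNReal.ofReal (u ^ (-β) * Real.exp (-(u / 2) * r ^ 2)) ≤
        ENNReal.ofReal (K * (1 / (1 + r ^ (2 - 2 * β)))) := by
  have hb : 0 < 1 - β := by linarith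
  set K1 : ℝ := T ^ (1 - β) / (1 - β) with hK1
  set K2 : ℝ := 2 ^ (1 - β) * Real.Gamma (1 - β) with hK2
  have hK1' : 0 < K1 := by positivity
  have hK2' : 0 < K2 := mul_pos (by positivity) (Real.Gamma_pos_of_pos hb)
  refine ⟨2 * K1 + 2 * K2, by positivity, fun r hr ↦ ?_⟩
  rcases le_total r 1 with h | h
  · have h1 : r ^ (2 - 2 * β) ≤ 1 := Real.rpow_le_one hr h (by linarith)
    have hint : IntervalIntegrable (fun u : ℝ ↦ u ^ (-β)) volume 0 T :=
      intervalIntegral.intervalIntegrable_rpow' (by linarith)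
    calc ∫⁻ u in Set.Ioc 0 T, ENNReal.ofReal (u ^ (-β) * Real.exp (-(u / 2) * r ^ 2))
        ≤ ∫⁻ u in Set.Ioc 0 T, ENNReal.ofReal (u ^ (-β)) := by
          refine setLIntegral_mono' measurableSet_Ioc fun u hu ↦ ENNReal.ofReal_le_ofReal ?_
          refine mul_le_of_le_one_right (Real.rpow_nonneg hu.1.le _) (Real.exp_le_one_iff.2 ?_)
          have := hu.1
          have : 0 ≤ u / 2 * r ^ 2 := by positivity
          linarith
      _ = ENNReal.ofReal (∫ u in Set.Ioc 0 T, u ^ (-β)) := by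
          rw [ofReal_integral_eq_lintegral_ofReal
            ((intervalIntegrable_iff_integrableOn_Ioc_of_le hT.le).1 hint)]
          exact (ae_restrict_iff' measurableSet_Ioc).2
            (ae_of_all _ fun u hu ↦ Real.rpow_nonneg hu.1.le _)
      _ = ENNReal.ofReal K1 := by
          rw [← intervalIntegral.integral_of_le hT.le, integral_rpow (.inl (by linarith)),
            Real.zero_rpow (by linarith), hK1]
          congr 1
          rw [show -β + 1 = 1 - β by ring, sub_zero]
      _ ≤ _ := by
          refine ENNReal.ofReal_le_ofReal ?_
          rw [mul_one_div, le_div_iff₀ (by positivity)]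
          nlinarith
  · have hr0 : 0 < r := by linarith
    have h1 : 1 ≤ r ^ (2 - 2 * β) := Real.one_le_rpow h (by linarith)
    have hq : 0 < r ^ 2 / 2 := by positivity
    have hval := Real.integral_rpow_mul_exp_neg_mul_Ioi hb hq
    have hpos : ∀ u ∈ Set.Ioi (0 : ℝ), 0 ≤ u ^ (1 - β - 1) * Real.exp (-(r ^ 2 / 2 * u)) :=
      fun u hu ↦ mul_nonneg (Real.rpow_nonneg (le_of_lt hu) _) (Real.exp_pos _).le
    have hne : (1 / (r ^ 2 / 2)) ^ (1 - β) * Real.Gamma (1 - β) ≠ 0 :=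
      (mul_pos (by positivity) (Real.Gamma_pos_of_pos hb)).ne'
    have hint : IntegrableOn (fun u : ℝ ↦ u ^ (1 - β - 1) * Real.exp (-(r ^ 2 / 2 * u)))
        (Set.Ioi 0) := by
      by_contra hcon
      exact hne (hval.symm.trans (integral_undef hcon))
    calc ∫⁻ u in Set.Ioc 0 T, ENNReal.ofReal (u ^ (-β) * Real.exp (-(u / 2) * r ^ 2))
        ≤ ∫⁻ u in Set.Ioi 0, ENNReal.ofReal (u ^ (-β) * Real.exp (-(u / 2) * r ^ 2)) :=
          lintegral_mono_set Set.Ioc_subset_Ioi_self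
      _ = ∫⁻ u in Set.Ioi 0,
            ENNReal.ofReal (u ^ (1 - β - 1) * Real.exp (-(r ^ 2 / 2 * u))) := by
          congr with u
          congr 3 <;> ring
      _ = ENNReal.ofReal ((1 / (r ^ 2 / 2)) ^ (1 - β) * Real.Gamma (1 - β)) := by
          rw [← hval, ofReal_integral_eq_lintegral_ofReal hint]
          exact (ae_restrict_iff' measurableSet_Ioi).2 (ae_of_all _ hpos)
      _ = ENNReal.ofReal (K2 / r ^ (2 - 2 * β)) := by
          congr 1
          rw [hK2, one_div_div, Real.div_rpow (by norm_num) (by positivity), ← Real.rpow_natCast,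
            ← Real.rpow_mul hr]
          rw [show ((2 : ℕ) : ℝ) * (1 - β) = 2 - 2 * β by push_cast; ring]
          ring
      _ ≤ _ := by
          refine ENNReal.ofReal_le_ofReal ?_
          rw [mul_one_div, div_le_div_iff₀ (by positivity) (by positivity)]
          nlinarith

variable {d : ℕ} {μ : Measure (Space d)}

/-- The integrability `∫₀ᵀ u^{-β} (p_u * Λ)(0) du < ∞`, which is what the spectral condition
`∫ μ(dξ) / (1 + |ξ|^{2-2β}) < ∞` amounts to. -/
lemma integrableOn_rpow_mul_peak {β T : ℝ} (hβ0 : 0 < β) (hβ1 : β < 1) (hT : 0 < T)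
    (h : SpectralBound μ (2 - 2 * β)) :
    IntegrableOn (fun u ↦ u ^ (-β) * peak μ u) (Set.Ioc 0 T) := by
  have ha : 0 ≤ 2 - 2 * β := by linarith
  have ha2 : 2 - 2 * β ≤ 2 := by linarith
  have := h.sigmaFinite ha
  obtain ⟨K, hK0, hK⟩ := lintegral_rpow_mul_exp_le hβ1 hT
  have hcont : ContinuousOn (fun u ↦ u ^ (-β) * peak μ u) (Set.Ioc 0 T) :=
    (continuousOn_id.rpow_const fun u hu ↦ .inl hu.1.ne').mul
      ((continuousOn_peak ha ha2 h).mono Set.Ioc_subset_Ioi_self)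
  refine (lintegral_ofReal_ne_top_iff_integrable (hcont.aestronglyMeasurable measurableSet_Ioc)
    ((ae_restrict_iff' measurableSet_Ioc).2 (ae_of_all _ fun u hu ↦
      mul_nonneg (Real.rpow_nonneg hu.1.le _) (peak_nonneg _ _)))).1 ?_
  have e : ∀ u ∈ Set.Ioc 0 T, ENNReal.ofReal (u ^ (-β) * peak μ u) =
      ENNReal.ofReal ((2 * Real.pi) ^ d)⁻¹ *
        ∫⁻ ξ, ENNReal.ofReal (u ^ (-β) * Real.exp (-(u / 2) * ‖ξ‖ ^ 2)) ∂μ := by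
    intro u hu
    have hu' := Real.rpow_nonneg hu.1.le (-β)
    rw [peak, mul_left_comm, ENNReal.ofReal_mul (by positivity), ← integral_const_mul,
      ofReal_integral_eq_lintegral_ofReal ((h.integrable_exp ha ha2 hu.1).const_mul _)
        (ae_of_all _ fun ξ ↦ by positivity)]
  rw [setLIntegral_congr_fun measurableSet_Ioc e, lintegral_const_mul' _ _ ENNReal.ofReal_ne_top]
  refine ENNReal.mul_ne_top ENNReal.ofReal_ne_top (ne_of_lt ?_)
  rw [lintegral_lintegral_swap (by fun_prop)]
  calc _ ≤ ∫⁻ ξ, ENNReal.ofReal (K * (1 / (1 + ‖ξ‖ ^ (2 - 2 * β)))) ∂μ :=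
        lintegral_mono fun ξ ↦ hK _ (norm_nonneg ξ)
    _ = ENNReal.ofReal K * ∫⁻ ξ, ENNReal.ofReal (1 / (1 + ‖ξ‖ ^ (2 - 2 * β))) ∂μ := by
        simp_rw [ENNReal.ofReal_mul hK0]
        rw [lintegral_const_mul' _ _ ENNReal.ofReal_ne_top]
    _ < ∞ := ENNReal.mul_lt_top ENNReal.ofReal_lt_top h

end PeakIntegral

/-! ### Pair interactions and their positivity -/

section LTwo

variable {α : Type*} [MeasurableSpace α] {κ : Measure α}

lemma integral_mul_eq_inner_toLp {f g : α → ℝ} (hf : MemLp f 2 κ) (hg : MemLp g 2 κ) :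
    ∫ x, f x * g x ∂κ = inner ℝ hf.toLp hg.toLp := by
  rw [L2.inner_def]
  refine integral_congr_ae ?_
  filter_upwards [hf.coeFn_toLp, hg.coeFn_toLp] with x h1 h2
  simp [h1, h2, mul_comm]

lemma tendsto_integral_mul_of_tendsto_eLpNorm {ι : Type*} {l : Filter ι} {f g : ι → α → ℝ}
    {f₀ g₀ : α → ℝ} (hf : ∀ i, MemLp (f i) 2 κ) (hg : ∀ i, MemLp (g i) 2 κ)
    (hf₀ : MemLp f₀ 2 κ) (hg₀ : MemLp g₀ 2 κ)
    (hff : Tendsto (fun i ↦ eLpNorm (fun x ↦ f i x - f₀ x) 2 κ) l (𝓝 0))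
    (hgg : Tendsto (fun i ↦ eLpNorm (fun x ↦ g i x - g₀ x) 2 κ) l (𝓝 0)) :
    Tendsto (fun i ↦ ∫ x, f i x * g i x ∂κ) l (𝓝 (∫ x, f₀ x * g₀ x ∂κ)) := by
  simp_rw [integral_mul_eq_inner_toLp (hf _) (hg _), integral_mul_eq_inner_toLp hf₀ hg₀]
  exact ((Lp.tendsto_Lp_iff_tendsto_eLpNorm'' _ hf _ hf₀).2 hff).inner
    ((Lp.tendsto_Lp_iff_tendsto_eLpNorm'' _ hg _ hg₀).2 hgg)

/-- The centred Gaussian laws are closed under `L²` limits. -/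
lemma map_eq_gaussianReal_of_tendsto_eLpNorm [IsProbabilityMeasure κ] {X : ℕ → α → ℝ}
    {Y : α → ℝ} (hX : ∀ n, MemLp (X n) 2 κ) (hY : MemLp Y 2 κ)
    (hlaw : ∀ n, κ.map (X n) = gaussianReal 0 (∫ x, X n x * X n x ∂κ).toNNReal)
    (h : Tendsto (fun n ↦ eLpNorm (fun x ↦ X n x - Y x) 2 κ) atTop (𝓝 0)) :
    κ.map Y = gaussianReal 0 (∫ x, Y x * Y x ∂κ).toNNReal := by
  have hvar := tendsto_integral_mul_of_tendsto_eLpNorm hX hX hY hY h h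
  obtain ⟨ns, hns, hae⟩ := (tendstoInMeasure_of_tendsto_eLpNorm (by norm_num)
    (fun n ↦ (hX n).aestronglyMeasurable) hY.aestronglyMeasurable h).exists_seq_tendsto_ae
  have : IsProbabilityMeasure (κ.map Y) :=
    Measure.isProbabilityMeasure_map hY.aestronglyMeasurable.aemeasurable
  refine Measure.ext_of_charFun (funext fun θ ↦ ?_)
  have hchar : ∀ Z : α → ℝ, MemLp Z 2 κ →
      charFun (κ.map Z) θ = ∫ x, Complex.exp (θ * Z x * Complex.I) ∂κ := by
    intro Z hZ
    rw [charFun_apply_real, integral_map hZ.aestronglyMeasurable.aemeasurable (by fun_prop)]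
  have h1 : Tendsto (fun n ↦ charFun (κ.map (X (ns n))) θ) atTop (𝓝 (charFun (κ.map Y) θ)) := by
    simp_rw [hchar _ (hX _)]
    rw [hchar _ hY]
    refine tendsto_integral_of_dominated_convergence (fun _ ↦ 1) (fun n ↦ ?_)
      (integrable_const _) (fun n ↦ ae_of_all _ fun x ↦ ?_) ?_
    · have := (hX (ns n)).aestronglyMeasurable
      exact (by fun_prop : Continuous fun r : ℝ ↦
        Complex.exp (θ * r * Complex.I)).comp_aestronglyMeasurable this
    · rw [← Complex.ofReal_mul, Complex.norm_exp_ofReal_mul_I]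
    · filter_upwards [hae] with x hx
      exact ((by fun_prop : Continuous fun r : ℝ ↦
        Complex.exp (θ * r * Complex.I)).tendsto _).comp hx
  have h2 : Tendsto (fun n ↦ charFun (κ.map (X (ns n))) θ) atTop
      (𝓝 (charFun (gaussianReal 0 (∫ x, Y x * Y x ∂κ).toNNReal) θ)) := by
    simp_rw [hlaw, charFun_gaussianReal]
    have := (continuous_real_toNNReal.tendsto _).comp (hvar.comp hns.tendsto_atTop)
    have hc : Continuous fun v : ℝ≥0 ↦
      Complex.exp (θ * ((0 : ℝ) : ℂ) * Complex.I - ((v : ℝ) : ℂ) * θ ^ 2 / 2) := by fun_prop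
    exact (hc.tendsto _).comp this
  exact tendsto_nhds_unique h1 h2

end LTwo

/-- The energy `∫ |f(p)| |f(q)| ν(dp, dq)` of a function with respect to a measure `ν` of pair
interactions. -/
noncomputable def energy {X : Type*} [MeasurableSpace X] (ν : Measure (X × X)) (f : X → ℝ) : ℝ≥0∞ :=
  ∫⁻ p, ‖f p.1‖ₑ * ‖f p.2‖ₑ ∂ν

section BallMarginal

variable {X : Type*} [NormedAddCommGroup X] [MeasurableSpace X]

/-- The sum of the two marginals of `ν` restricted to the square of a ball. By the inequality
`2ab ≤ a² + b²` the `L²` norm for this finite measure dominates the energy of functions supported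
in the ball. -/
noncomputable def ballMarginal (ν : Measure (X × X)) (R : ℝ) : Measure X :=
  (ν.restrict (Metric.closedBall 0 R ×ˢ Metric.closedBall 0 R)).map Prod.fst +
    (ν.restrict (Metric.closedBall 0 R ×ˢ Metric.closedBall 0 R)).map Prod.snd

variable {ν : Measure (X × X)}

lemma setIntegral_ball_eq {R : ℝ} {f g : X → ℝ}
    (hf : ∀ x, R < ‖x‖ → f x = 0) (hg : ∀ x, R < ‖x‖ → g x = 0) :
    ∫ p in Metric.closedBall 0 R ×ˢ Metric.closedBall 0 R, f p.1 * g p.2 ∂ν =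
      ∫ p, f p.1 * g p.2 ∂ν := by
  refine setIntegral_eq_integral_of_forall_compl_eq_zero fun p hp ↦ ?_
  by_cases h1 : ‖p.1‖ ≤ R
  · have h2 : R < ‖p.2‖ := by
      by_contra h2
      exact hp ⟨by simpa using h1, by simpa using h2⟩
    rw [hg _ h2, mul_zero]
  · rw [hf _ (not_le.1 h1), zero_mul]

lemma eLpNorm_comp_fst_le (f : X → ℝ) (hf : Measurable f) (R : ℝ) :
    eLpNorm (fun p : X × X ↦ f p.1) 2
      (ν.restrict (Metric.closedBall 0 R ×ˢ Metric.closedBall 0 R)) ≤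
      eLpNorm f 2 (ballMarginal ν R) := by
  rw [show (fun p : X × X ↦ f p.1) = f ∘ Prod.fst from rfl,
    ← eLpNorm_map_measure hf.aestronglyMeasurable measurable_fst.aemeasurable]
  exact eLpNorm_mono_measure _ (Measure.le_add_right le_rfl)

lemma eLpNorm_comp_snd_le (f : X → ℝ) (hf : Measurable f) (R : ℝ) :
    eLpNorm (fun p : X × X ↦ f p.2) 2
      (ν.restrict (Metric.closedBall 0 R ×ˢ Metric.closedBall 0 R)) ≤
      eLpNorm f 2 (ballMarginal ν R) := by
  rw [show (fun p : X × X ↦ f p.2) = f ∘ Prod.snd from rfl,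
    ← eLpNorm_map_measure hf.aestronglyMeasurable measurable_snd.aemeasurable]
  exact eLpNorm_mono_measure _ (Measure.le_add_left le_rfl)

end BallMarginal

section Energy

variable {X : Type*} [NormedAddCommGroup X] [NormedSpace ℝ X] [MeasurableSpace X]

/-- Test functions on the whole of `X`. -/
abbrev Test (X : Type*) [NormedAddCommGroup X] [NormedSpace ℝ X] : Type _ :=
  𝓓((⊤ : TopologicalSpace.Opens X), ℝ)

/-- A measure of pair interactions that is finite on products of bounded sets and positive
semidefinite on test functions. -/
structure IsPosDefPair (ν : Measure (X × X)) : Prop where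
  finite : ∀ R : ℝ, ν (Metric.closedBall 0 R ×ˢ Metric.closedBall 0 R) < ∞
  posDef : ∀ φ ψ : Test X, 2 * ∫ p, φ p.1 * ψ p.2 ∂ν ≤
    ∫ p, φ p.1 * φ p.2 ∂ν + ∫ p, ψ p.1 * ψ p.2 ∂ν

variable {ν : Measure (X × X)}

lemma IsPosDefPair.isFiniteMeasure_ballMarginal (hν : IsPosDefPair ν) (R : ℝ) :
    IsFiniteMeasure (ballMarginal ν R) := by
  have : IsFiniteMeasure (ν.restrict (Metric.closedBall 0 R ×ˢ Metric.closedBall (0 : X) R)) :=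
    isFiniteMeasure_restrict.2 (hν.finite R).ne
  unfold ballMarginal
  infer_instance

variable [BorelSpace X] [FiniteDimensional ℝ X]

/-- Bounded measurable functions with bounded support are `L²` limits of test functions supported
in a slightly larger ball. -/
lemma IsPosDefPair.exists_test_eLpNorm_le (hν : IsPosDefPair ν) {R M : ℝ} (hR : 0 < R)
    {f : X → ℝ} (hf : Measurable f) (hM : ∀ x, ‖f x‖ ≤ M) (hsupp : ∀ x, R < ‖x‖ → f x = 0)
    {δ : ℝ} (hδ : 0 < δ) :
    ∃ φ : Test X, (∀ x, R + 1 < ‖x‖ → φ x = 0) ∧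
      eLpNorm (fun x ↦ φ x - f x) 2 (ballMarginal ν (R + 1)) ≤ ENNReal.ofReal δ := by
  have := hν.isFiniteMeasure_ballMarginal (R + 1)
  have hmem : MemLp f 2 (ballMarginal ν (R + 1)) :=
    MemLp.of_bound hf.aestronglyMeasurable M (ae_of_all _ hM)
  obtain ⟨g, hg1, hg2, hg3⟩ := hmem.exist_eLpNorm_sub_le (by norm_num) (by norm_num) hδ
  let χ : ContDiffBump (0 : X) := ⟨R, R + 1, hR, by linarith⟩
  have hχs : ∀ x, R + 1 < ‖x‖ → χ x = 0 := fun x hx ↦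
    χ.zero_of_le_dist (by simpa [dist_zero_right] using hx.le)
  refine ⟨⟨fun x ↦ χ x * g x, χ.contDiff.mul hg2, hg1.mul_left, by simp⟩,
    fun x hx ↦ by simp [hχs x hx], ?_⟩
  refine (eLpNorm_mono fun x ↦ ?_).trans hg3
  have hfx : f x = χ x * f x := by
    by_cases hx : ‖x‖ ≤ R
    · rw [χ.one_of_mem_closedBall (by simpa using hx), one_mul]
    · rw [hsupp x (not_le.1 hx), mul_zero]
  calc ‖χ x * g x - f x‖ = ‖χ x * (g x - f x)‖ := by rw [mul_sub, ← hfx]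
    _ = |χ x| * ‖g x - f x‖ := by rw [norm_mul, Real.norm_eq_abs]
    _ ≤ 1 * ‖g x - f x‖ := by
        gcongr; rw [abs_of_nonneg χ.nonneg]; exact χ.le_one
    _ = ‖(f - g) x‖ := by rw [one_mul, norm_sub_rev]; rfl

/-- Positivity passes from test functions to bounded functions with bounded support, in the form
`2⟨f, g⟩ ≤ ⟨f, f⟩ + ⟨g, g⟩`. -/
lemma IsPosDefPair.integral_mul_le_of_bounded (hν : IsPosDefPair ν) {R M : ℝ} (hR : 0 < R)
    {f g : X → ℝ} (hf : Measurable f) (hg : Measurable g) (hfM : ∀ x, ‖f x‖ ≤ M)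
    (hgM : ∀ x, ‖g x‖ ≤ M) (hfs : ∀ x, R < ‖x‖ → f x = 0) (hgs : ∀ x, R < ‖x‖ → g x = 0) :
    2 * ∫ p, f p.1 * g p.2 ∂ν ≤ ∫ p, f p.1 * f p.2 ∂ν + ∫ p, g p.1 * g p.2 ∂ν := by
  choose φ hφs hφ using fun n : ℕ ↦ hν.exists_test_eLpNorm_le hR hf hfM hfs
    (δ := 1 / ((n : ℝ) + 1)) (by positivity)
  choose ψ hψs hψ using fun n : ℕ ↦ hν.exists_test_eLpNorm_le hR hg hgM hgs
    (δ := 1 / ((n : ℝ) + 1)) (by positivity)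
  set κ := ν.restrict (Metric.closedBall 0 (R + 1) ×ˢ Metric.closedBall (0 : X) (R + 1))
  have hκ : IsFiniteMeasure κ := isFiniteMeasure_restrict.2 (hν.finite _).ne
  have hδ : Tendsto (fun n : ℕ ↦ ENNReal.ofReal (1 / ((n : ℝ) + 1))) atTop (𝓝 0) := by
    rw [← ENNReal.ofReal_zero]
    exact ENNReal.tendsto_ofReal tendsto_one_div_add_atTop_nhds_zero_nat
  have lim : ∀ (u v : X → ℝ) (a b : ℕ → Test X), Measurable u → Measurable v →
      (∀ x, ‖u x‖ ≤ M) → (∀ x, ‖v x‖ ≤ M) → (∀ x, R < ‖x‖ → u x = 0) →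
      (∀ x, R < ‖x‖ → v x = 0) → (∀ n x, R + 1 < ‖x‖ → a n x = 0) →
      (∀ n x, R + 1 < ‖x‖ → b n x = 0) →
      (∀ n : ℕ, eLpNorm (fun x ↦ a n x - u x) 2 (ballMarginal ν (R + 1)) ≤
        ENNReal.ofReal (1 / ((n : ℝ) + 1))) →
      (∀ n : ℕ, eLpNorm (fun x ↦ b n x - v x) 2 (ballMarginal ν (R + 1)) ≤
        ENNReal.ofReal (1 / ((n : ℝ) + 1))) →
      Tendsto (fun n ↦ ∫ p, a n p.1 * b n p.2 ∂ν) atTop (𝓝 (∫ p, u p.1 * v p.2 ∂ν)) := by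
    intro u v a b hu hv huM hvM hus hvs has hbs ha hb
    have hc (c : Test X) : ∃ K, ∀ x, ‖c x‖ ≤ K :=
      c.continuous.bounded_above_of_compact_support c.hasCompactSupport
    have hcm (c : Test X) : Measurable c := c.continuous.measurable
    rw [← setIntegral_ball_eq (R := R + 1) (fun x hx ↦ hus x (by linarith))
      (fun x hx ↦ hvs x (by linarith))]
    simp_rw [← setIntegral_ball_eq (ν := ν) (R := R + 1) (has _) (hbs _)]
    refine tendsto_integral_mul_of_tendsto_eLpNorm (κ := κ) (f := fun n p ↦ a n p.1)
      (g := fun n p ↦ b n p.2) (f₀ := fun p ↦ u p.1) (g₀ := fun p ↦ v p.2)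
      (fun n ↦ ?_) (fun n ↦ ?_) ?_ ?_ ?_ ?_
    · obtain ⟨K, hK⟩ := hc (a n)
      exact MemLp.of_bound ((hcm _).comp measurable_fst).aestronglyMeasurable K
        (ae_of_all _ fun p ↦ hK _)
    · obtain ⟨K, hK⟩ := hc (b n)
      exact MemLp.of_bound ((hcm _).comp measurable_snd).aestronglyMeasurable K
        (ae_of_all _ fun p ↦ hK _)
    · exact MemLp.of_bound (hu.comp measurable_fst).aestronglyMeasurable M
        (ae_of_all _ fun p ↦ huM _)
    · exact MemLp.of_bound (hv.comp measurable_snd).aestronglyMeasurable M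
        (ae_of_all _ fun p ↦ hvM _)
    · exact tendsto_of_tendsto_of_tendsto_of_le_of_le tendsto_const_nhds hδ
        (fun _ ↦ zero_le) fun n ↦
        (eLpNorm_comp_fst_le (fun x ↦ a n x - u x) ((hcm _).sub hu) _).trans (ha n)
    · exact tendsto_of_tendsto_of_tendsto_of_le_of_le tendsto_const_nhds hδ
        (fun _ ↦ zero_le) fun n ↦
        (eLpNorm_comp_snd_le (fun x ↦ b n x - v x) ((hcm _).sub hv) _).trans (hb n)
  refine le_of_tendsto_of_tendsto' ((lim f g φ ψ hf hg hfM hgM hfs hgs hφs hψs hφ hψ).const_mul 2)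
    ((lim f f φ φ hf hf hfM hfM hfs hfs hφs hφs hφ hφ).add
      (lim g g ψ ψ hg hg hgM hgM hgs hgs hψs hψs hψ hψ)) fun n ↦ hν.posDef _ _

/-- Cauchy–Schwarz for the pair interaction, on arbitrary nonnegative measurable functions. It
follows from the case of bounded functions with bounded support by monotone convergence. -/
lemma IsPosDefPair.two_mul_lintegral_le (hν : IsPosDefPair ν) {u v : X → ℝ≥0∞}
    (hu : Measurable u) (hv : Measurable v) :
    2 * ∫⁻ p, u p.1 * v p.2 ∂ν ≤ ∫⁻ p, u p.1 * u p.2 ∂ν + ∫⁻ p, v p.1 * v p.2 ∂ν := by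
  -- truncations of `w`
  let tr : (X → ℝ≥0∞) → ℕ → X → ℝ≥0∞ := fun w n ↦
    (Metric.closedBall 0 (n : ℝ)).indicator fun x ↦ min (w x) n
  have trm : ∀ w, Measurable w → ∀ n, Measurable (tr w n) := fun w hw n ↦
    (hw.min measurable_const).indicator Metric.isClosed_closedBall.measurableSet
  have trmono : ∀ w x, Monotone fun n ↦ tr w n x := by
    intro w x m n hmn
    have hmn' : (m : ℝ) ≤ n := by exact_mod_cast hmn
    refine (Set.indicator_le_indicator_of_subset (Metric.closedBall_subset_closedBall hmn')
      (fun _ ↦ zero_le) x).trans (Set.indicator_le_indicator ?_)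
    gcongr
  have trlim : ∀ w x, Tendsto (fun n ↦ tr w n x) atTop (𝓝 (w x)) := by
    intro w x
    have h1 : Tendsto (fun n : ℕ ↦ min (w x) n) atTop (𝓝 (min (w x) ⊤)) :=
      tendsto_const_nhds.min ENNReal.tendsto_nat_nhds_top
    rw [min_top_right] at h1
    refine h1.congr' ?_
    filter_upwards [eventually_ge_atTop ⌈‖x‖⌉₊] with n hn
    have : x ∈ Metric.closedBall (0 : X) n := by simpa using Nat.ceil_le.1 hn
    simp only [tr, Set.indicator_of_mem this]
  have trle : ∀ w n x, tr w n x ≤ n := by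
    intro w n x
    by_cases hx : x ∈ Metric.closedBall (0 : X) n
    · simp only [tr, Set.indicator_of_mem hx]; exact min_le_right _ _
    · simp [tr, Set.indicator_of_notMem hx]
  have lim : ∀ w z, Measurable w → Measurable z →
      Tendsto (fun n ↦ ∫⁻ p, tr w n p.1 * tr z n p.2 ∂ν) atTop
        (𝓝 (∫⁻ p, w p.1 * z p.2 ∂ν)) := by
    intro w z hw hz
    refine lintegral_tendsto_of_tendsto_of_monotone (fun n ↦ ?_) (ae_of_all _ fun p ↦ ?_)
      (ae_of_all _ fun p ↦ ?_)
    · exact (((trm w hw n).comp measurable_fst).mul ((trm z hz n).comp measurable_snd)).aemeasurable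
    · exact fun m n hmn ↦ mul_le_mul' (trmono w _ hmn) (trmono z _ hmn)
    · by_cases h0 : w p.1 = 0
      · have : ∀ n, tr w n p.1 = 0 := fun n ↦ by simp [tr, h0]
        simp [this, h0]
      by_cases h0' : z p.2 = 0
      · have : ∀ n, tr z n p.2 = 0 := fun n ↦ by simp [tr, h0']
        simp [this, h0']
      exact ENNReal.Tendsto.mul (trlim w _) (.inl h0) (trlim z _) (.inl h0')
  have real : ∀ w z, Measurable w → Measurable z → ∀ n : ℕ,
      ∫⁻ p, tr w n p.1 * tr z n p.2 ∂ν =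
        ENNReal.ofReal (∫ p, (tr w n p.1).toReal * (tr z n p.2).toReal ∂ν) := by
    intro w z hw hz n
    have hfin : ∀ w x, tr w n x ≠ ∞ := fun w x ↦
      ((trle w n x).trans_lt (ENNReal.natCast_lt_top n)).ne
    have hm : Measurable fun p : X × X ↦ (tr w n p.1).toReal * (tr z n p.2).toReal :=
      ((trm w hw n).comp measurable_fst).ennreal_toReal.mul
        ((trm z hz n).comp measurable_snd).ennreal_toReal
    have hE : ∀ p : X × X, tr w n p.1 * tr z n p.2 =
        ENNReal.ofReal ((tr w n p.1).toReal * (tr z n p.2).toReal) := fun p ↦ by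
      rw [ENNReal.ofReal_mul ENNReal.toReal_nonneg, ENNReal.ofReal_toReal (hfin _ _),
        ENNReal.ofReal_toReal (hfin _ _)]
    simp_rw [hE]
    rw [ofReal_integral_eq_lintegral_ofReal _ (ae_of_all _ fun p ↦ by positivity)]
    refine (lintegral_ofReal_ne_top_iff_integrable hm.aestronglyMeasurable
      (ae_of_all _ fun p ↦ by positivity)).1 (ne_of_lt ?_)
    simp_rw [← hE]
    calc ∫⁻ p, tr w n p.1 * tr z n p.2 ∂ν
        ≤ ∫⁻ p, (Metric.closedBall 0 (n : ℝ) ×ˢ Metric.closedBall (0 : X) n).indicator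
            (fun _ ↦ (n : ℝ≥0∞) * n) p ∂ν := by
          refine lintegral_mono fun p ↦ ?_
          by_cases h1 : p.1 ∈ Metric.closedBall (0 : X) n
          · by_cases h2 : p.2 ∈ Metric.closedBall (0 : X) n
            · rw [Set.indicator_of_mem (show p ∈ _ ×ˢ _ from ⟨h1, h2⟩)]
              exact mul_le_mul' (trle _ _ _) (trle _ _ _)
            · have : tr z n p.2 = 0 := Set.indicator_of_notMem h2 _
              simp [this]
          · have : tr w n p.1 = 0 := Set.indicator_of_notMem h1 _
            simp [this]
      _ = (n : ℝ≥0∞) * n * ν (Metric.closedBall 0 (n : ℝ) ×ˢ Metric.closedBall (0 : X) n) :=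
          lintegral_indicator_const (Metric.isClosed_closedBall.measurableSet.prod
            Metric.isClosed_closedBall.measurableSet) _
      _ < ∞ := ENNReal.mul_lt_top (ENNReal.mul_lt_top (ENNReal.natCast_lt_top n)
          (ENNReal.natCast_lt_top n)) (hν.finite _)
  refine le_of_tendsto_of_tendsto (ENNReal.Tendsto.const_mul (lim u v hu hv) (.inr (by simp)))
    ((lim u u hu hu).add (lim v v hv hv)) ?_
  filter_upwards [eventually_ge_atTop 1] with n hn
  have hn0 : (0 : ℝ) < n := by exact_mod_cast hn
  rw [real u v hu hv, real u u hu hu, real v v hv hv, ← ENNReal.ofReal_add,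
    show (2 : ℝ≥0∞) = ENNReal.ofReal 2 by simp, ← ENNReal.ofReal_mul (by norm_num)]
  · have hb : ∀ w x, ‖(tr w n x).toReal‖ ≤ n := fun w x ↦ by
      rw [Real.norm_eq_abs, abs_of_nonneg ENNReal.toReal_nonneg]
      exact ENNReal.toReal_le_of_le_ofReal hn0.le (by simpa using trle w n x)
    have hs : ∀ w (x : X), (n : ℝ) < ‖x‖ → (tr w n x).toReal = 0 := fun w x hx ↦ by
      have : x ∉ Metric.closedBall (0 : X) n := by simpa using hx
      simp [tr, Set.indicator_of_notMem this]
    exact ENNReal.ofReal_le_ofReal (hν.integral_mul_le_of_bounded hn0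
      (trm u hu n).ennreal_toReal (trm v hv n).ennreal_toReal (hb u) (hb v) (hs u) (hs v))
  · exact integral_nonneg fun p ↦ by positivity
  · exact integral_nonneg fun p ↦ by positivity

end Energy

/-! ### Density of test functions in energy -/

lemma energy_sub_comm {X : Type*} [MeasurableSpace X] {ν : Measure (X × X)} (f g : X → ℝ) :
    energy ν (fun x ↦ f x - g x) = energy ν (fun x ↦ g x - f x) := by
  simp only [energy, enorm_sub_rev]

/-- For functions supported in a ball, convergence in `L²` of the marginals implies convergence in
energy. -/
lemma energy_le_sq_eLpNorm {X : Type*} [NormedAddCommGroup X] [MeasurableSpace X]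
    {ν : Measure (X × X)} {R : ℝ} {h : X → ℝ} (hm : Measurable h)
    (hs : ∀ x, R < ‖x‖ → h x = 0) :
    energy ν h ≤ eLpNorm h 2 (ballMarginal ν R) ^ 2 := by
  set κ := ν.restrict (Metric.closedBall 0 R ×ˢ Metric.closedBall (0 : X) R)
  have hE : energy ν h = ∫⁻ p, ‖h p.1‖ₑ * ‖h p.2‖ₑ ∂κ := by
    refine (setLIntegral_eq_of_support_subset ?_).symm
    intro p hp
    refine ⟨?_, ?_⟩
    · by_contra h1
      exact hp (by simp [hs p.1 (by simpa using h1)])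
    · by_contra h1
      exact hp (by simp [hs p.2 (by simpa using h1)])
  have hsq : eLpNorm h 2 (ballMarginal ν R) ^ 2 =
      ∫⁻ p, ‖h p.1‖ₑ ^ 2 ∂κ + ∫⁻ p, ‖h p.2‖ₑ ^ 2 ∂κ := by
    have : eLpNorm h 2 (ballMarginal ν R) ^ 2 = ∫⁻ x, ‖h x‖ₑ ^ 2 ∂(ballMarginal ν R) := by
      have := eLpNorm_nnreal_pow_eq_lintegral (f := h) (μ := ballMarginal ν R) (p := 2) (by simp)
      simpa using this
    rw [this, ballMarginal, lintegral_add_measure,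
      lintegral_map (hm.enorm.pow_const 2) measurable_fst,
      lintegral_map (hm.enorm.pow_const 2) measurable_snd]
  have m1 : Measurable fun p : X × X ↦ ‖h p.1‖ₑ ^ 2 :=
    (hm.comp measurable_fst).enorm.pow_const 2
  rw [hE, hsq, ← lintegral_add_left m1]
  refine lintegral_mono fun p ↦ ?_
  rcases le_total ‖h p.1‖ₑ ‖h p.2‖ₑ with h1 | h1
  · calc ‖h p.1‖ₑ * ‖h p.2‖ₑ ≤ ‖h p.2‖ₑ * ‖h p.2‖ₑ := by gcongr
      _ = ‖h p.2‖ₑ ^ 2 := (sq _).symm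
      _ ≤ _ := le_add_self
  · calc ‖h p.1‖ₑ * ‖h p.2‖ₑ ≤ ‖h p.1‖ₑ * ‖h p.1‖ₑ := by gcongr
      _ = ‖h p.1‖ₑ ^ 2 := (sq _).symm
      _ ≤ _ := le_self_add

section WienerExtension

variable {X : Type*} [NormedAddCommGroup X] [NormedSpace ℝ X] [MeasurableSpace X]
  [BorelSpace X] [FiniteDimensional ℝ X] {ν : Measure (X × X)}

/-- Cauchy–Schwarz for the pair interaction bounds the cross terms, so finiteness of the energy is
stable under addition. -/
lemma IsPosDefPair.energy_add_le (hν : IsPosDefPair ν) {f g : X → ℝ} (hf : Measurable f)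
    (hg : Measurable g) : energy ν (fun x ↦ f x + g x) ≤ 2 * energy ν f + 2 * energy ν g := by
  set u : X → ℝ≥0∞ := fun x ↦ ‖f x‖ₑ with hu'
  set v : X → ℝ≥0∞ := fun x ↦ ‖g x‖ₑ with hv'
  have hu : Measurable u := hf.enorm
  have hv : Measurable v := hg.enorm
  have m1 : ∀ w z : X → ℝ≥0∞, Measurable w → Measurable z →
      Measurable fun p : X × X ↦ w p.1 * z p.2 := fun w z hw hz ↦
    (hw.comp measurable_fst).mul (hz.comp measurable_snd)
  have huv := hν.two_mul_lintegral_le hu hv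
  have hvu := hν.two_mul_lintegral_le hv hu
  have hvu' : 2 * ∫⁻ p, v p.1 * u p.2 ∂ν ≤ energy ν f + energy ν g :=
    hvu.trans_eq (add_comm _ _)
  have hsum : energy ν (fun x ↦ f x + g x) ≤ energy ν f + ∫⁻ p, u p.1 * v p.2 ∂ν +
      (∫⁻ p, v p.1 * u p.2 ∂ν + energy ν g) := by
    have e : ∫⁻ p, (u p.1 * u p.2 + u p.1 * v p.2) + (v p.1 * u p.2 + v p.1 * v p.2) ∂ν =
        energy ν f + ∫⁻ p, u p.1 * v p.2 ∂ν + (∫⁻ p, v p.1 * u p.2 ∂ν + energy ν g) := by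
      have m2 : Measurable fun p : X × X ↦ u p.1 * u p.2 + u p.1 * v p.2 :=
        (m1 u u hu hu).add (m1 u v hu hv)
      rw [lintegral_add_left m2, lintegral_add_left (m1 u u hu hu),
        lintegral_add_left (m1 v u hv hu)]
      rfl
    rw [← e]
    refine lintegral_mono fun p ↦ ?_
    calc ‖f p.1 + g p.1‖ₑ * ‖f p.2 + g p.2‖ₑ ≤ (u p.1 + v p.1) * (u p.2 + v p.2) :=
          mul_le_mul' (enorm_add_le _ _) (enorm_add_le _ _)
      _ = _ := by ring
  have h2 : (2 : ℝ≥0∞) * energy ν (fun x ↦ f x + g x) ≤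
      2 * (2 * energy ν f + 2 * energy ν g) := by
    calc (2 : ℝ≥0∞) * energy ν (fun x ↦ f x + g x)
        ≤ 2 * (energy ν f + ∫⁻ p, u p.1 * v p.2 ∂ν + (∫⁻ p, v p.1 * u p.2 ∂ν + energy ν g)) := by
          gcongr
      _ = 2 * energy ν f + 2 * ∫⁻ p, u p.1 * v p.2 ∂ν +
            (2 * ∫⁻ p, v p.1 * u p.2 ∂ν + 2 * energy ν g) := by ring
      _ ≤ 2 * energy ν f + (energy ν f + energy ν g) +
            ((energy ν f + energy ν g) + 2 * energy ν g) := by gcongr; exact huv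
      _ = _ := by ring
  exact (ENNReal.mul_le_mul_iff_right (by simp) (by simp)).1 h2

/-- Test functions are dense, for the energy, in the measurable functions of finite energy. -/
lemma IsPosDefPair.exists_test_energy_tendsto (hν : IsPosDefPair ν) {f : X → ℝ}
    (hf : Measurable f) (hfin : energy ν f < ∞) :
    ∃ φ : ℕ → Test X, Tendsto (fun n ↦ energy ν (fun x ↦ φ n x - f x)) atTop (𝓝 0) := by
  -- truncation of values and support
  let S : ℕ → Set X := fun n ↦ {x | ‖f x‖ ≤ n ∧ ‖x‖ ≤ n + 1}
  have hS : ∀ n, MeasurableSet (S n) := fun n ↦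
    (measurableSet_le hf.norm measurable_const).inter
      (measurableSet_le measurable_norm measurable_const)
  let tr : ℕ → X → ℝ := fun n ↦ (S n).indicator f
  have trm : ∀ n, Measurable (tr n) := fun n ↦ hf.indicator (hS n)
  have h1 : Tendsto (fun n ↦ energy ν (fun x ↦ tr n x - f x)) atTop (𝓝 0) := by
    have hlim : ∀ x, Tendsto (fun n ↦ ‖tr n x - f x‖ₑ) atTop (𝓝 0) := by
      intro x
      refine tendsto_const_nhds.congr' ?_
      filter_upwards [eventually_ge_atTop ⌈max ‖f x‖ ‖x‖⌉₊] with n hn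
      have hn' := Nat.ceil_le.1 hn
      have : x ∈ S n := ⟨(le_max_left _ _).trans hn',
        ((le_max_right _ _).trans hn').trans (by linarith)⟩
      simp [tr, Set.indicator_of_mem this]
    have hle : ∀ n x, ‖tr n x - f x‖ₑ ≤ ‖f x‖ₑ := by
      intro n x
      by_cases hx : x ∈ S n
      · simp [tr, Set.indicator_of_mem hx]
      · simp [tr, Set.indicator_of_notMem hx]
    have := tendsto_lintegral_of_dominated_convergence (μ := ν)
      (F := fun n p ↦ ‖tr n p.1 - f p.1‖ₑ * ‖tr n p.2 - f p.2‖ₑ) (f := fun _ ↦ 0)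
      (fun p ↦ ‖f p.1‖ₑ * ‖f p.2‖ₑ) (fun n ↦ ?_)
      (fun n ↦ ae_of_all _ fun p ↦ mul_le_mul' (hle n _) (hle n _)) hfin.ne
      (ae_of_all _ fun p ↦ ?_)
    · simpa [energy] using this
    · have := (trm n).sub hf
      exact (this.comp measurable_fst).enorm.mul (this.comp measurable_snd).enorm
    · have := ENNReal.Tendsto.mul (hlim p.1) (.inr (by simp)) (hlim p.2) (.inr (by simp))
      simpa using this
  choose φ hφs hφ using fun n : ℕ ↦ hν.exists_test_eLpNorm_le (R := n + 1) (M := n)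
    (by positivity) (trm n)
    (fun x ↦ by
      by_cases hx : x ∈ S n
      · simpa [tr, Set.indicator_of_mem hx] using hx.1
      · simp [tr, Set.indicator_of_notMem hx])
    (fun x hx ↦ Set.indicator_of_notMem (fun h ↦ (not_le.2 hx) h.2) _)
    (δ := 1 / ((n : ℝ) + 1)) (by positivity)
  have hcm (c : Test X) : Measurable c := c.continuous.measurable
  have h2 : Tendsto (fun n ↦ energy ν (fun x ↦ φ n x - tr n x)) atTop (𝓝 0) := by
    have hδ : Tendsto (fun n : ℕ ↦ ENNReal.ofReal (1 / ((n : ℝ) + 1)) ^ 2) atTop (𝓝 0) := by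
      have := ENNReal.Tendsto.pow (n := 2)
        (ENNReal.tendsto_ofReal tendsto_one_div_add_atTop_nhds_zero_nat)
      simpa using this
    refine tendsto_of_tendsto_of_tendsto_of_le_of_le tendsto_const_nhds hδ
      (fun _ ↦ zero_le) fun n ↦ ?_
    refine (energy_le_sq_eLpNorm (R := n + 1 + 1) ((hcm _).sub (trm n)) fun x hx ↦ ?_).trans
      (pow_le_pow_left' (hφ n) 2)
    have h3 : x ∉ S n := fun h ↦ by have := h.2; linarith
    simp [hφs n x hx, tr, Set.indicator_of_notMem h3]
  refine ⟨φ, ?_⟩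
  have h3 := (ENNReal.Tendsto.const_mul h2 (a := 2) (.inr (by simp))).add
    (ENNReal.Tendsto.const_mul h1 (a := 2) (.inr (by simp)))
  simp only [mul_zero, add_zero] at h3
  refine tendsto_of_tendsto_of_tendsto_of_le_of_le tendsto_const_nhds h3
    (fun _ ↦ zero_le) fun n ↦ ?_
  have := hν.energy_add_le ((hcm (φ n)).sub (trm n)) ((trm n).sub hf)
  simp only [Pi.sub_apply, sub_add_sub_cancel] at this
  exact this

/-- Continuity of the bilinear form in the energy. -/
lemma IsPosDefPair.tendsto_integral_mul (hν : IsPosDefPair ν) {f g : X → ℝ}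
    {a b : ℕ → X → ℝ} (hf : Measurable f) (hg : Measurable g) (ha : ∀ n, Measurable (a n))
    (hb : ∀ n, Measurable (b n)) (hfin : energy ν f < ∞) (hgin : energy ν g < ∞)
    (haf : Tendsto (fun n ↦ energy ν (fun x ↦ a n x - f x)) atTop (𝓝 0))
    (hbg : Tendsto (fun n ↦ energy ν (fun x ↦ b n x - g x)) atTop (𝓝 0)) :
    Integrable (fun p : X × X ↦ f p.1 * g p.2) ν ∧
    Tendsto (fun n ↦ ∫ p, a n p.1 * b n p.2 ∂ν) atTop (𝓝 (∫ p, f p.1 * g p.2 ∂ν)) := by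
  -- weighted Cauchy–Schwarz
  have cs : ∀ (k : ℕ), k ≠ 0 → ∀ u v : X → ℝ, Measurable u → Measurable v →
      ∫⁻ p, ‖u p.1‖ₑ * ‖v p.2‖ₑ ∂ν ≤ (k : ℝ≥0∞) ^ 2 * energy ν u + ((k : ℝ≥0∞)⁻¹) ^ 2 * energy ν v ∧
      ∫⁻ p, ‖u p.1‖ₑ * ‖v p.2‖ₑ ∂ν ≤
        ((k : ℝ≥0∞)⁻¹) ^ 2 * energy ν u + (k : ℝ≥0∞) ^ 2 * energy ν v := by
    intro k hk u v hu hv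
    have hk1 : (k : ℝ≥0∞) * (k : ℝ≥0∞)⁻¹ = 1 :=
      ENNReal.mul_inv_cancel (by exact_mod_cast hk) (by simp)
    have gen : ∀ c e : ℝ≥0∞, c * e = 1 → ∫⁻ p, ‖u p.1‖ₑ * ‖v p.2‖ₑ ∂ν ≤
        c ^ 2 * energy ν u + e ^ 2 * energy ν v := by
      intro c e hce
      have h := hν.two_mul_lintegral_le (u := fun x ↦ c * ‖u x‖ₑ) (v := fun x ↦ e * ‖v x‖ₑ)
        (hu.enorm.const_mul _) (hv.enorm.const_mul _)
      have m1 : ∀ w z : X → ℝ, Measurable w → Measurable z →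
          Measurable fun p : X × X ↦ ‖w p.1‖ₑ * ‖z p.2‖ₑ := fun w z hw hz ↦
        (hw.enorm.comp measurable_fst).mul (hz.enorm.comp measurable_snd)
      have e1 : ∀ (c₁ c₂ : ℝ≥0∞) (w z : X → ℝ), Measurable w → Measurable z →
          ∫⁻ p : X × X, c₁ * ‖w p.1‖ₑ * (c₂ * ‖z p.2‖ₑ) ∂ν =
            c₁ * c₂ * ∫⁻ p : X × X, ‖w p.1‖ₑ * ‖z p.2‖ₑ ∂ν := by
        intro c₁ c₂ w z hw hz
        rw [← lintegral_const_mul _ (m1 w z hw hz)]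
        congr with p
        ring
      rw [e1 _ _ _ _ hu hv, e1 _ _ _ _ hu hu, e1 _ _ _ _ hv hv, hce, one_mul] at h
      rw [sq, sq]
      refine le_trans ?_ h
      rw [two_mul]
      exact le_self_add
    exact ⟨gen _ _ hk1, gen _ _ (by rw [mul_comm]; exact hk1)⟩
  have hint : Integrable (fun p : X × X ↦ f p.1 * g p.2) ν := by
    refine ⟨((hf.comp measurable_fst).mul (hg.comp measurable_snd)).aestronglyMeasurable, ?_⟩
    unfold HasFiniteIntegral
    simp_rw [enorm_mul]
    refine ((cs 1 one_ne_zero f g hf hg).1).trans_lt ?_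
    simp [hfin, hgin]
  refine ⟨hint, tendsto_integral_of_L1 _ hint.aestronglyMeasurable ?_ ?_⟩
  · -- the products are eventually integrable, since the energies are eventually finite
    have ev : ∀ᶠ n in atTop, energy ν (fun x ↦ a n x - f x) < 1 ∧
        energy ν (fun x ↦ b n x - g x) < 1 :=
      (haf.eventually_lt_const (by simp)).and (hbg.eventually_lt_const (by simp))
    filter_upwards [ev] with n hn
    have ha' : energy ν (a n) < ∞ := by
      have h := hν.energy_add_le ((ha n).sub hf) hf
      simp only [Pi.sub_apply, sub_add_cancel] at h
      exact h.trans_lt (ENNReal.add_lt_top.2 ⟨ENNReal.mul_lt_top (by simp) (hn.1.trans (by simp)),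
        ENNReal.mul_lt_top (by simp) hfin⟩)
    have hb' : energy ν (b n) < ∞ := by
      have h := hν.energy_add_le ((hb n).sub hg) hg
      simp only [Pi.sub_apply, sub_add_cancel] at h
      exact h.trans_lt (ENNReal.add_lt_top.2 ⟨ENNReal.mul_lt_top (by simp) (hn.2.trans (by simp)),
        ENNReal.mul_lt_top (by simp) hgin⟩)
    refine ⟨(((ha n).comp measurable_fst).mul
      ((hb n).comp measurable_snd)).aestronglyMeasurable, ?_⟩
    unfold HasFiniteIntegral
    simp_rw [enorm_mul]
    refine ((cs 1 one_ne_zero _ _ (ha n) (hb n)).1).trans_lt ?_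
    simp [ha', hb']
  · have hbd : ∀ n, ∫⁻ p, ‖a n p.1 * b n p.2 - f p.1 * g p.2‖ₑ ∂ν ≤
        ∫⁻ p, ‖a n p.1 - f p.1‖ₑ * ‖b n p.2 - g p.2‖ₑ ∂ν +
        (∫⁻ p, ‖a n p.1 - f p.1‖ₑ * ‖g p.2‖ₑ ∂ν + ∫⁻ p, ‖f p.1‖ₑ * ‖b n p.2 - g p.2‖ₑ ∂ν) := by
      intro n
      have m1 : ∀ w z : X → ℝ, Measurable w → Measurable z →
          Measurable fun p : X × X ↦ ‖w p.1‖ₑ * ‖z p.2‖ₑ := fun w z hw hz ↦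
        (hw.enorm.comp measurable_fst).mul (hz.enorm.comp measurable_snd)
      rw [← lintegral_add_left (m1 (fun x ↦ a n x - f x) g ((ha n).sub hf) hg),
        ← lintegral_add_left (m1 (fun x ↦ a n x - f x) (fun x ↦ b n x - g x)
          ((ha n).sub hf) ((hb n).sub hg))]
      refine lintegral_mono fun p ↦ ?_
      have : a n p.1 * b n p.2 - f p.1 * g p.2 = (a n p.1 - f p.1) * (b n p.2 - g p.2) +
          ((a n p.1 - f p.1) * g p.2 + f p.1 * (b n p.2 - g p.2)) := by ring
      dsimp only
      rw [this]
      refine (enorm_add_le _ _).trans (add_le_add (enorm_mul _ _).le ((enorm_add_le _ _).trans ?_))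
      rw [enorm_mul, enorm_mul]
    rw [ENNReal.tendsto_nhds_zero]
    intro δ hδ
    -- choose the weight so that the fixed factor contributes at most `δ / 2`
    obtain ⟨k, hk0, hk⟩ : ∃ k : ℕ, k ≠ 0 ∧
        ((k : ℝ≥0∞)⁻¹) ^ 2 * energy ν g + ((k : ℝ≥0∞)⁻¹) ^ 2 * energy ν f < δ := by
      have ht : Tendsto (fun k : ℕ ↦ ((k : ℝ≥0∞)⁻¹) ^ 2 * energy ν g +
          ((k : ℝ≥0∞)⁻¹) ^ 2 * energy ν f) atTop (𝓝 0) := by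
        have h0 : Tendsto (fun k : ℕ ↦ ((k : ℝ≥0∞)⁻¹) ^ 2) atTop (𝓝 0) := by
          have := ENNReal.Tendsto.pow (n := 2) ENNReal.tendsto_inv_nat_nhds_zero
          simpa using this
        have := (ENNReal.Tendsto.mul_const h0 (b := energy ν g) (.inr hgin.ne)).add
          (ENNReal.Tendsto.mul_const h0 (b := energy ν f) (.inr hfin.ne))
        simpa using this
      obtain ⟨k, hk⟩ := ((eventually_ge_atTop 1).and (ht.eventually_lt_const hδ)).exists
      exact ⟨k, by omega, hk.2⟩
    have ht : Tendsto (fun n ↦ (1 : ℝ≥0∞) * energy ν (fun x ↦ a n x - f x) +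
        1 * energy ν (fun x ↦ b n x - g x) +
        ((k : ℝ≥0∞) ^ 2 * energy ν (fun x ↦ a n x - f x) + ((k : ℝ≥0∞)⁻¹) ^ 2 * energy ν g +
        (((k : ℝ≥0∞)⁻¹) ^ 2 * energy ν f + (k : ℝ≥0∞) ^ 2 * energy ν (fun x ↦ b n x - g x))))
        atTop (𝓝 (1 * 0 + 1 * 0 + ((k : ℝ≥0∞) ^ 2 * 0 + ((k : ℝ≥0∞)⁻¹) ^ 2 * energy ν g +
        (((k : ℝ≥0∞)⁻¹) ^ 2 * energy ν f + (k : ℝ≥0∞) ^ 2 * 0)))) := by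
      refine ((ENNReal.Tendsto.const_mul haf (.inr (by simp))).add
        (ENNReal.Tendsto.const_mul hbg (.inr (by simp)))).add
        (((ENNReal.Tendsto.const_mul haf (.inr (by simp))).add tendsto_const_nhds).add
        (tendsto_const_nhds.add (ENNReal.Tendsto.const_mul hbg (.inr (by simp)))))
    simp only [mul_zero, zero_add, add_zero] at ht
    filter_upwards [ht.eventually_lt_const hk] with n hn
    refine (hbd n).trans (le_trans ?_ hn.le)
    refine add_le_add ?_ (add_le_add ?_ ?_)
    · have := (cs 1 one_ne_zero (fun x ↦ a n x - f x) (fun x ↦ b n x - g x) ((ha n).sub hf)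
        ((hb n).sub hg)).1
      simpa using this
    · exact (cs k hk0 (fun x ↦ a n x - f x) g ((ha n).sub hf) hg).1
    · exact (cs k hk0 f (fun x ↦ b n x - g x) hf ((hb n).sub hg)).2

end WienerExtension

/-! ### Wiener integrals -/

section WienerIntegral

variable {X : Type*} [NormedAddCommGroup X] [NormedSpace ℝ X] [MeasurableSpace X]

/-- `Y` is an `L²` limit of `W(φ_n)` along test functions converging to `f` in energy. -/
def IsEnergyLimit {Ω : Type*} [MeasurableSpace Ω] (P : Measure Ω) (ν : Measure (X × X))
    (W : Test X → Ω → ℝ) (f : X → ℝ) (Y : Ω → ℝ) : Prop :=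
  MemLp Y 2 P ∧ ∃ φ : ℕ → Test X,
    Tendsto (fun n ↦ energy ν (fun p ↦ φ n p - f p)) atTop (𝓝 0) ∧
    Tendsto (fun n ↦ eLpNorm (fun ω ↦ W (φ n) ω - Y ω) 2 P) atTop (𝓝 0)

/-- An isonormal family: centred Gaussian variables whose covariance is the pair interaction. -/
structure IsIsonormal {Ω : Type*} [MeasurableSpace Ω] (P : Measure Ω) (ν : Measure (X × X))
    (W : Test X → Ω → ℝ) : Prop where
  memLp : ∀ φ, MemLp (W φ) 2 P
  cov : ∀ φ ψ, ∫ ω, W φ ω * W ψ ω ∂P = ∫ p, φ p.1 * ψ p.2 ∂ν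
  law : ∀ φ, P.map (W φ) = gaussianReal 0 (∫ ω, W φ ω * W φ ω ∂P).toNNReal

lemma IsIsonormal.map_eq_gaussianReal {ν : Measure (X × X)}
    {Ω : Type*} [MeasurableSpace Ω] {P : Measure Ω} {W : Test X → Ω → ℝ} [IsProbabilityMeasure P]
    (hW : IsIsonormal P ν W)
    {f : X → ℝ} {Y : Ω → ℝ} (hY : IsEnergyLimit P ν W f Y) :
    P.map Y = gaussianReal 0 (∫ ω, Y ω * Y ω ∂P).toNNReal := by
  obtain ⟨hY2, φ, -, hφY⟩ := hY
  exact map_eq_gaussianReal_of_tendsto_eLpNorm (fun n ↦ hW.memLp (φ n)) hY2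
    (fun n ↦ hW.law (φ n)) hφY

variable [BorelSpace X] [FiniteDimensional ℝ X] {ν : Measure (X × X)}
  {Ω : Type*} [MeasurableSpace Ω] {P : Measure Ω} {W : Test X → Ω → ℝ}

/-- The Itô isometry. -/
lemma IsIsonormal.integral_mul (hW : IsIsonormal P ν W) (hν : IsPosDefPair ν) {f g : X → ℝ}
    {Y Z : Ω → ℝ} (hf : Measurable f) (hg : Measurable g) (hfin : energy ν f < ∞)
    (hgin : energy ν g < ∞) (hY : IsEnergyLimit P ν W f Y) (hZ : IsEnergyLimit P ν W g Z) :
    ∫ ω, Y ω * Z ω ∂P = ∫ p, f p.1 * g p.2 ∂ν := by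
  obtain ⟨hY2, φ, hφ, hφY⟩ := hY
  obtain ⟨hZ2, ψ, hψ, hψZ⟩ := hZ
  have h1 := tendsto_integral_mul_of_tendsto_eLpNorm (fun n ↦ hW.memLp (φ n))
    (fun n ↦ hW.memLp (ψ n)) hY2 hZ2 hφY hψZ
  have h2 := (hν.tendsto_integral_mul hf hg (fun n ↦ (φ n).continuous.measurable)
    (fun n ↦ (ψ n).continuous.measurable) hfin hgin hφ hψ).2
  simp_rw [hW.cov] at h1
  exact tendsto_nhds_unique h1 h2

/-- Two energy limits for the same `f` agree: by the isometry `E[(Y - Z)²] = 0`. -/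
lemma IsIsonormal.ae_eq (hW : IsIsonormal P ν W) (hν : IsPosDefPair ν) {f : X → ℝ}
    {Y Z : Ω → ℝ} (hf : Measurable f) (hfin : energy ν f < ∞)
    (hY : IsEnergyLimit P ν W f Y) (hZ : IsEnergyLimit P ν W f Z) : Y =ᵐ[P] Z := by
  have e : ∀ {A B : Ω → ℝ} (hA : IsEnergyLimit P ν W f A) (hB : IsEnergyLimit P ν W f B),
      inner ℝ hA.1.toLp hB.1.toLp = ∫ p, f p.1 * f p.2 ∂ν := fun hA hB ↦ by
    rw [← integral_mul_eq_inner_toLp, hW.integral_mul hν hf hf hfin hfin hA hB]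
  have h : ‖hY.1.toLp - hZ.1.toLp‖ ^ 2 = 0 := by
    rw [norm_sub_sq_real, ← real_inner_self_eq_norm_sq, ← real_inner_self_eq_norm_sq, e hY hY,
      e hY hZ, e hZ hZ]
    ring
  have h2 : hY.1.toLp = hZ.1.toLp :=
    sub_eq_zero.1 (norm_eq_zero.1 (pow_eq_zero_iff two_ne_zero |>.1 h))
  exact (MemLp.toLp_eq_toLp_iff _ _).1 h2

/-- Every measurable function of finite energy has a Wiener integral. -/
lemma IsIsonormal.exists_energyLimit (hW : IsIsonormal P ν W) (hν : IsPosDefPair ν) {f : X → ℝ}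
    (hf : Measurable f) (hfin : energy ν f < ∞) : ∃ Y, IsEnergyLimit P ν W f Y := by
  obtain ⟨φ, hφ⟩ := hν.exists_test_energy_tendsto hf hfin
  have hcm (c : Test X) : Measurable c := c.continuous.measurable
  set w : ℕ → Lp ℝ 2 P := fun n ↦ (hW.memLp (φ n)).toLp with hw
  set b : ℕ → ℝ≥0∞ := fun n ↦ energy ν (fun p ↦ φ n p - f p) with hb
  have hint : ∀ c e : Test X, Integrable (fun p : X × X ↦ c p.1 * e p.2) ν := by
    -- finite energy of test functions
    have hen : ∀ c : Test X, energy ν c < ∞ := by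
      intro c
      obtain ⟨K, hK⟩ := c.continuous.bounded_above_of_compact_support c.hasCompactSupport
      obtain ⟨R, hR⟩ := c.hasCompactSupport.isCompact.isBounded.exists_norm_le
      have hs : ∀ x, R < ‖x‖ → c x = 0 := fun x hx ↦ by
        by_contra h
        exact absurd (hR x (subset_tsupport _ h)) (not_le.2 hx)
      have := hν.isFiniteMeasure_ballMarginal R
      refine (energy_le_sq_eLpNorm (hcm c) hs).trans_lt (ENNReal.pow_lt_top ?_)
      exact (MemLp.of_bound (hcm c).aestronglyMeasurable K (ae_of_all _ hK)).2
    intro c e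
    exact (hν.tendsto_integral_mul (a := fun _ ↦ c) (b := fun _ ↦ e) (hcm c) (hcm e)
      (fun _ ↦ hcm c) (fun _ ↦ hcm e) (hen c) (hen e) (by simp [energy]) (by simp [energy])).1
  have hdist : ∀ n m, ENNReal.ofReal (‖w n - w m‖ ^ 2) ≤ 2 * b n + 2 * b m := by
    intro n m
    have e1 : ‖w n - w m‖ ^ 2 = ∫ p, (φ n p.1 - φ m p.1) * (φ n p.2 - φ m p.2) ∂ν := by
      have i (k l : ℕ) : inner ℝ (w k) (w l) = ∫ p, φ k p.1 * φ l p.2 ∂ν := by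
        rw [← hW.cov, hw, integral_mul_eq_inner_toLp (hW.memLp _) (hW.memLp _)]
      have hsub : ∀ p : X × X, (φ n p.1 - φ m p.1) * (φ n p.2 - φ m p.2) =
          (φ n p.1 * φ n p.2 - φ n p.1 * φ m p.2) - (φ m p.1 * φ n p.2 - φ m p.1 * φ m p.2) :=
        fun p ↦ by ring
      have hint2 : ∀ c e c' e' : Test X,
          Integrable (fun p : X × X ↦ c p.1 * e p.2 - c' p.1 * e' p.2) ν :=
        fun c e c' e' ↦ (hint c e).sub (hint c' e')
      rw [integral_congr_ae (ae_of_all _ hsub), integral_sub (hint2 _ _ _ _) (hint2 _ _ _ _),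
        integral_sub (hint _ _) (hint _ _), integral_sub (hint _ _) (hint _ _), ← i, ← i, ← i, ← i,
        ← real_inner_self_eq_norm_sq, inner_sub_left, inner_sub_right, inner_sub_right]
    have h2 := hν.energy_add_le (f := fun x ↦ φ n x - f x) (g := fun x ↦ f x - φ m x)
      ((hcm _).sub hf) (hf.sub (hcm _))
    simp only [sub_add_sub_cancel] at h2
    rw [energy_sub_comm f] at h2
    refine le_trans ?_ h2
    rw [e1, energy]
    refine (ENNReal.ofReal_le_ofReal (le_abs_self _)).trans ?_
    rw [← Real.norm_eq_abs, ofReal_norm]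
    refine (enorm_integral_le_lintegral_enorm _).trans_eq ?_
    simp_rw [enorm_mul]
  have hcau : CauchySeq w := by
    rw [Metric.cauchySeq_iff]
    intro δ hδ
    have hδ' : 0 < ENNReal.ofReal (δ ^ 2) / 4 :=
      ENNReal.div_pos (ENNReal.ofReal_pos.2 (pow_pos hδ 2)).ne' (by simp)
    obtain ⟨N, hN⟩ := (hφ.eventually_lt_const hδ').exists_forall_of_atTop
    refine ⟨N, fun n hn m hm ↦ ?_⟩
    rw [dist_eq_norm]
    have h4 : 2 * b n + 2 * b m < ENNReal.ofReal (δ ^ 2) := by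
      calc 2 * b n + 2 * b m < 2 * (ENNReal.ofReal (δ ^ 2) / 4) + 2 * (ENNReal.ofReal (δ ^ 2) / 4) :=
            ENNReal.add_lt_add ((ENNReal.mul_lt_mul_iff_right (by simp) (by simp)).2 (hN n hn))
              ((ENNReal.mul_lt_mul_iff_right (by simp) (by simp)).2 (hN m hm))
        _ = 4 * (ENNReal.ofReal (δ ^ 2) / 4) := by ring
        _ = _ := ENNReal.mul_div_cancel (by simp) (by simp)
    have h5 := (hdist n m).trans_lt h4
    rw [ENNReal.ofReal_lt_ofReal_iff (by positivity)] at h5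
    exact lt_of_pow_lt_pow_left₀ 2 hδ.le h5
  obtain ⟨Y, hY⟩ := cauchySeq_tendsto_of_complete hcau
  refine ⟨Y, Lp.memLp Y, φ, hφ, ?_⟩
  have : Y = (Lp.memLp Y).toLp := (Lp.toLp_coeFn Y _).symm
  rw [this] at hY
  exact (Lp.tendsto_Lp_iff_tendsto_eLpNorm'' _ _ _ _).1 hY

end WienerIntegral

/-! ### The interaction measure of the noise -/

section TimeIntegral

/-- Young's inequality for the time kernel on a square. -/
lemma lintegral_square_sub_le (k : ℝ → ℝ≥0∞) (T : ℝ) :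
    ∫⁻ s in Set.Icc 0 T, ∫⁻ t in Set.Icc 0 T, k (s - t) ≤
      ENNReal.ofReal T * ∫⁻ u in Set.Icc (-T) T, k u := by
  calc ∫⁻ s in Set.Icc 0 T, ∫⁻ t in Set.Icc 0 T, k (s - t)
      ≤ ∫⁻ _ in Set.Icc 0 T, ∫⁻ u in Set.Icc (-T) T, k u := by
        refine setLIntegral_mono' measurableSet_Icc fun s hs ↦ ?_
        rw [← lintegral_indicator measurableSet_Icc, ← lintegral_indicator measurableSet_Icc,
          ← lintegral_sub_left_eq_self (fun u ↦ (Set.Icc (-T) T).indicator k u) s]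
        refine lintegral_mono fun t ↦ ?_
        refine Set.indicator_apply_le' (fun ht ↦ ?_) fun _ ↦ zero_le
        have : s - t ∈ Set.Icc (-T) T := ⟨by linarith [hs.1, ht.2], by linarith [hs.2, ht.1]⟩
        rw [Set.indicator_of_mem this]
    _ = _ := by
        rw [setLIntegral_const, Real.volume_Icc, sub_zero, mul_comm]

lemma lintegral_Icc_symm_le (k : ℝ → ℝ≥0∞) (T : ℝ) :
    ∫⁻ u in Set.Icc (-T) T, k |u| ≤ 2 * ∫⁻ u in Set.Ioc 0 T, k u := by
  have h1 : ∫⁻ u in Set.Ico (-T) 0, k |u| ≤ ∫⁻ u in Set.Ioc 0 T, k u := by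
    rw [← lintegral_indicator measurableSet_Ioc, ← lintegral_indicator measurableSet_Ico,
      ← lintegral_neg_eq_self (fun u ↦ (Set.Ioc 0 T).indicator k u)]
    refine lintegral_mono fun t ↦ Set.indicator_apply_le' (fun ht ↦ ?_) fun _ ↦ zero_le
    have : -t ∈ Set.Ioc 0 T := ⟨by linarith [ht.2], by linarith [ht.1]⟩
    rw [Set.indicator_of_mem this, abs_of_neg ht.2]
  have h2 : ∫⁻ u in Set.Ioc 0 T, k |u| = ∫⁻ u in Set.Ioc 0 T, k u :=
    setLIntegral_congr_fun measurableSet_Ioc fun u hu ↦ by simp only [abs_of_pos hu.1]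
  calc ∫⁻ u in Set.Icc (-T) T, k |u|
      ≤ ∫⁻ u in (Set.Ico (-T) 0 ∪ {0}) ∪ Set.Ioc 0 T, k |u| := by
        refine lintegral_mono_set fun u hu ↦ ?_
        rcases lt_trichotomy u 0 with h | h | h
        · exact .inl (.inl ⟨hu.1, h⟩)
        · exact .inl (.inr h)
        · exact .inr ⟨h, hu.2⟩
    _ ≤ (∫⁻ u in Set.Ico (-T) 0 ∪ {0}, k |u|) + (∫⁻ u in Set.Ioc 0 T, k |u|) :=
        lintegral_union_le _ _ _
    _ ≤ ((∫⁻ u in Set.Ico (-T) 0, k |u|) + (∫⁻ u in ({0} : Set ℝ), k |u|)) +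
          (∫⁻ u in Set.Ioc 0 T, k |u|) := by
        gcongr; exact lintegral_union_le _ _ _
    _ = (∫⁻ u in Set.Ico (-T) 0, k |u|) + (∫⁻ u in Set.Ioc 0 T, k u) := by
        rw [setLIntegral_measure_zero _ _ Real.volume_singleton, add_zero, h2]
    _ ≤ _ := by rw [two_mul]; gcongr

/-- A time covariance with the singularity `|t|^{-β}` at the origin. -/
structure IsTimeKernel (γ : ℝ → ℝ) (β C : ℝ) : Prop where
  meas : Measurable γ
  nonneg : ∀ t, 0 ≤ γ t
  le : ∀ t, t ≠ 0 → γ t ≤ C * |t| ^ (-β)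
  pos : 0 < β
  lt_one : β < 1
  const_pos : 0 < C

variable {γ : ℝ → ℝ} {β C : ℝ}

/-- Integrability over the square of `γ(s-t) g|s-t|` reduces to that of `u^{-β} g(u)` on `(0, T]`. -/
lemma IsTimeKernel.lintegral_square_lt_top (hγ : IsTimeKernel γ β C) {g : ℝ → ℝ} {T : ℝ}
    (hg0 : ∀ u, 0 ≤ g u)
    (hg : IntegrableOn (fun u ↦ u ^ (-β) * g u) (Set.Ioc 0 T)) :
    ∫⁻ s in Set.Icc 0 T, ∫⁻ t in Set.Icc 0 T, ENNReal.ofReal (γ (s - t) * g |s - t|) < ∞ := by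
  refine (lintegral_square_sub_le (fun u ↦ ENNReal.ofReal (γ u * g |u|)) T).trans_lt
    (ENNReal.mul_lt_top ENNReal.ofReal_lt_top ?_)
  have hle : ∫⁻ u in Set.Icc (-T) T, ENNReal.ofReal (γ u * g |u|) ≤
      ∫⁻ u in Set.Icc (-T) T, ENNReal.ofReal (C * (|u| ^ (-β) * g |u|)) := by
    refine lintegral_mono_ae (ae_restrict_of_ae ?_)
    have : ∀ᵐ u : ℝ, u ≠ 0 := by
      simp [ae_iff]
    filter_upwards [this] with u hu
    refine ENNReal.ofReal_le_ofReal ?_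
    rw [← mul_assoc]
    exact mul_le_mul_of_nonneg_right (hγ.le u hu) (hg0 _)
  refine hle.trans_lt ((lintegral_Icc_symm_le
    (fun u ↦ ENNReal.ofReal (C * (u ^ (-β) * g u))) T).trans_lt ?_)
  refine ENNReal.mul_lt_top (by simp) ?_
  simp_rw [ENNReal.ofReal_mul hγ.const_pos.le]
  rw [lintegral_const_mul' _ _ ENNReal.ofReal_ne_top]
  refine ENNReal.mul_lt_top ENNReal.ofReal_lt_top ?_
  refine lt_of_le_of_lt (lintegral_mono fun u ↦ ?_) hg.2
  rw [Real.enorm_eq_ofReal_abs]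
  exact ENNReal.ofReal_le_ofReal (le_abs_self _)

lemma integrableOn_rpow_neg (hβ1 : β < 1) (T : ℝ) :
    IntegrableOn (fun u : ℝ ↦ u ^ (-β)) (Set.Ioc 0 T) := by
  rcases le_total 0 T with h | h
  · exact (intervalIntegrable_iff_integrableOn_Ioc_of_le h).1
      (intervalIntegral.intervalIntegrable_rpow' (by linarith))
  · simp [Set.Ioc_eq_empty (not_lt.2 h)]

lemma IsTimeKernel.lintegral_square_lt_top' (hγ : IsTimeKernel γ β C) (T : ℝ) :
    ∫⁻ s in Set.Icc 0 T, ∫⁻ t in Set.Icc 0 T, ENNReal.ofReal (γ (s - t)) < ∞ := by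
  have := hγ.lintegral_square_lt_top (g := fun _ ↦ 1) (T := T) (by simp)
    (by simpa using integrableOn_rpow_neg hγ.lt_one T)
  simpa using this

end TimeIntegral

section CovarianceMeasure

variable {d : ℕ}

/-- The parameters `((s,t),(y,z))` of the pair interaction, with law `γ(s-t) ds dt dy Λ(dz)`. -/
noncomputable def covBase (γ : ℝ → ℝ) (Λ : Measure (Space d)) :
    Measure ((ℝ × ℝ) × (Space d × Space d)) :=
  (((volume.restrict (Set.Ici 0)).prod (volume.restrict (Set.Ici 0))).withDensity
    fun p ↦ ENNReal.ofReal (γ (p.1 - p.2))).prod (volume.prod Λ)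

/-- The pair of space-time points `(s, y + z)`, `(t, y)`. -/
def covPoints (q : (ℝ × ℝ) × (Space d × Space d)) : (ℝ × Space d) × (ℝ × Space d) :=
  ((q.1.1, q.2.1 + q.2.2), (q.1.2, q.2.1))

lemma measurable_covPoints : Measurable (covPoints (d := d)) := by
  unfold covPoints; fun_prop

/-- The pair interaction `γ(s-t) Λ(x-y) dx dy ds dt` of the noise, as a measure on pairs of
space-time points. -/
noncomputable def covMeasure (γ : ℝ → ℝ) (Λ : Measure (Space d)) :
    Measure ((ℝ × Space d) × (ℝ × Space d)) := (covBase γ Λ).map covPoints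

variable {γ : ℝ → ℝ} {Λ : Measure (Space d)}

lemma lintegral_covMeasure [SFinite Λ] (hγ : Measurable γ)
    {h : (ℝ × Space d) × (ℝ × Space d) → ℝ≥0∞} (hh : Measurable h) :
    ∫⁻ p, h p ∂(covMeasure γ Λ) = ∫⁻ s in Set.Ici (0 : ℝ), ∫⁻ t in Set.Ici (0 : ℝ),
      ENNReal.ofReal (γ (s - t)) * ∫⁻ y, ∫⁻ z, h ((s, y + z), (t, y)) ∂Λ := by
  have hm : Measurable fun q : (ℝ × ℝ) × (Space d × Space d) ↦ h (covPoints q) :=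
    hh.comp measurable_covPoints
  rw [covMeasure, lintegral_map hh measurable_covPoints, covBase,
    lintegral_prod _ hm.aemeasurable,
    lintegral_withDensity_eq_lintegral_mul _ (by fun_prop) hm.lintegral_prod_right',
    lintegral_prod _ (by
      exact ((by fun_prop : Measurable fun p : ℝ × ℝ ↦ ENNReal.ofReal (γ (p.1 - p.2))).mul
        hm.lintegral_prod_right').aemeasurable)]
  refine lintegral_congr fun s ↦ lintegral_congr fun t ↦ ?_
  simp only [Pi.mul_apply]
  congr 1
  have hm' : Measurable fun q : Space d × Space d ↦ h (covPoints ((s, t), q)) :=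
    hm.comp measurable_prodMk_left
  rw [lintegral_prod _ hm'.aemeasurable]
  rfl

lemma absEnergy_eq_energy [SFinite Λ] (hγ : Measurable γ) {f : ℝ × Space d → ℝ}
    (hf : Measurable f) : absEnergy γ Λ f = energy (covMeasure γ Λ) f := by
  rw [energy, lintegral_covMeasure hγ (by fun_prop)]
  rfl

lemma covForm_eq_integral [SFinite Λ] (hγ : Measurable γ) (hγ0 : ∀ t, 0 ≤ γ t)
    {f g : ℝ × Space d → ℝ} (hf : Measurable f) (hg : Measurable g)
    (hint : Integrable (fun p : (ℝ × Space d) × (ℝ × Space d) ↦ f p.1 * g p.2) (covMeasure γ Λ))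
    (hsec : ∀ s t, Integrable (fun q : Space d × Space d ↦ f (s, q.1 + q.2) * g (t, q.1))
      (volume.prod Λ)) :
    covForm γ Λ f g = ∫ p, f p.1 * g p.2 ∂(covMeasure γ Λ) := by
  have hm : Measurable fun p : (ℝ × Space d) × (ℝ × Space d) ↦ f p.1 * g p.2 :=
    (hf.comp measurable_fst).mul (hg.comp measurable_snd)
  have hint' : Integrable (fun q ↦ f (covPoints q).1 * g (covPoints q).2) (covBase γ Λ) :=
    (integrable_map_measure hm.aestronglyMeasurable measurable_covPoints.aemeasurable).1 hint
  have hd : Measurable fun p : ℝ × ℝ ↦ ENNReal.ofReal (γ (p.1 - p.2)) := by fun_prop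
  rw [covMeasure, integral_map measurable_covPoints.aemeasurable hm.aestronglyMeasurable]
  unfold covBase at hint' ⊢
  rw [integral_prod _ hint']
  have h2 := hint'.integral_prod_left
  have e := integral_withDensity_eq_integral_toReal_smul₀
    (μ := (volume.restrict (Set.Ici (0 : ℝ))).prod
    (volume.restrict (Set.Ici (0 : ℝ)))) hd.aemeasurable (ae_of_all _ fun _ ↦ ENNReal.ofReal_lt_top)
    (fun p : ℝ × ℝ ↦ ∫ q, f (covPoints (p, q)).1 * g (covPoints (p, q)).2 ∂(volume.prod Λ))
  refine Eq.trans ?_ e.symm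
  rw [integrable_withDensity_iff_integrable_smul₀' hd.aemeasurable
    (ae_of_all _ fun _ ↦ ENNReal.ofReal_lt_top)] at h2
  rw [integral_prod _ h2]
  unfold covForm
  congr with s
  congr with t
  simp only [smul_eq_mul, ENNReal.toReal_ofReal (hγ0 _)]
  congr 1
  exact (integral_prod _ (hsec s t)).symm

lemma covMeasure_ball_lt_top [SFinite Λ] [IsFiniteMeasureOnCompacts Λ] {β C : ℝ}
    (hγ : IsTimeKernel γ β C) (R : ℝ) :
    covMeasure γ Λ (Metric.closedBall 0 R ×ˢ Metric.closedBall 0 R) < ∞ := by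
  set K : Set ((ℝ × Space d) × (ℝ × Space d)) :=
    Metric.closedBall 0 R ×ˢ Metric.closedBall 0 R with hK
  have hms : MeasurableSet K :=
    Metric.isClosed_closedBall.measurableSet.prod Metric.isClosed_closedBall.measurableSet
  have hmem : ∀ s y t y', ((s, y), (t, y')) ∈ K → s ≤ R ∧ t ≤ R ∧ ‖y‖ ≤ R ∧ ‖y'‖ ≤ R := by
    intro s y t y' h
    have h1 := h.1
    have h2 := h.2
    rw [mem_closedBall_zero_iff, Prod.norm_def] at h1 h2
    exact ⟨(le_abs_self _).trans ((le_max_left _ _).trans h1),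
      (le_abs_self _).trans ((le_max_left _ _).trans h2), (le_max_right _ _).trans h1,
      (le_max_right _ _).trans h2⟩
  rw [← lintegral_indicator_one hms, lintegral_covMeasure hγ.meas (measurable_one.indicator hms)]
  set A : ℝ≥0∞ := volume (Metric.closedBall (0 : Space d) R) *
    Λ (Metric.closedBall (0 : Space d) (2 * R)) with hA
  have hAfin : A < ∞ := ENNReal.mul_lt_top measure_closedBall_lt_top
    (isCompact_closedBall _ _).measure_lt_top
  have hle : ∀ s ∈ Set.Ici (0 : ℝ), ∀ t ∈ Set.Ici (0 : ℝ),
      ENNReal.ofReal (γ (s - t)) * ∫⁻ y, ∫⁻ z, K.indicator 1 ((s, y + z), (t, y)) ∂Λ ≤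
      (Set.Icc 0 R).indicator (fun s ↦ (Set.Icc 0 R).indicator
        (fun t ↦ ENNReal.ofReal (γ (s - t)) * A) t) s := by
    intro s hs t ht
    by_cases h : s ≤ R ∧ t ≤ R
    · rw [Set.indicator_of_mem (show s ∈ Set.Icc 0 R from ⟨hs, h.1⟩),
        Set.indicator_of_mem (show t ∈ Set.Icc 0 R from ⟨ht, h.2⟩)]
      refine mul_le_mul' le_rfl ?_
      calc _ ≤ ∫⁻ y, (Metric.closedBall (0 : Space d) R).indicator
            (fun _ ↦ Λ (Metric.closedBall (0 : Space d) (2 * R))) y := by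
            refine lintegral_mono fun y ↦ ?_
            by_cases hy : ‖y‖ ≤ R
            · rw [Set.indicator_of_mem (by simpa using hy),
                ← lintegral_indicator_one Metric.isClosed_closedBall.measurableSet]
              refine lintegral_mono fun z ↦ Set.indicator_apply_le' (fun hz ↦ ?_) fun _ ↦ zero_le
              have h1 := (hmem _ _ _ _ hz).2.2.1
              have : z ∈ Metric.closedBall (0 : Space d) (2 * R) := by
                rw [mem_closedBall_zero_iff]
                calc ‖z‖ = ‖(y + z) - y‖ := by simp
                  _ ≤ ‖y + z‖ + ‖y‖ := norm_sub_le _ _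
                  _ ≤ _ := by linarith
              rw [Set.indicator_of_mem this]
              exact le_rfl
            · have : ∀ z, K.indicator (1 : (ℝ × Space d) × (ℝ × Space d) → ℝ≥0∞)
                  ((s, y + z), (t, y)) = 0 := fun z ↦
                Set.indicator_of_notMem (fun hz ↦ hy (hmem _ _ _ _ hz).2.2.2) _
              simp [this]
        _ = _ := by
            rw [lintegral_indicator_const Metric.isClosed_closedBall.measurableSet, mul_comm]
    · have : ∀ y z, K.indicator (1 : (ℝ × Space d) × (ℝ × Space d) → ℝ≥0∞)
          ((s, y + z), (t, y)) = 0 := fun y z ↦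
        Set.indicator_of_notMem
          (fun hz ↦ h ⟨(hmem _ _ _ _ hz).1, (hmem _ _ _ _ hz).2.1⟩) _
      simp [this]
  calc _ ≤ ∫⁻ s in Set.Ici (0 : ℝ), ∫⁻ t in Set.Ici (0 : ℝ), (Set.Icc 0 R).indicator
        (fun s ↦ (Set.Icc 0 R).indicator (fun t ↦ ENNReal.ofReal (γ (s - t)) * A) t) s :=
        setLIntegral_mono' measurableSet_Ici fun s hs ↦
          setLIntegral_mono' measurableSet_Ici fun t ht ↦ hle s hs t ht
    _ ≤ ∫⁻ s, ∫⁻ t, (Set.Icc 0 R).indicator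
        (fun s ↦ (Set.Icc 0 R).indicator (fun t ↦ ENNReal.ofReal (γ (s - t)) * A) t) s :=
        (setLIntegral_le_lintegral _ _).trans (lintegral_mono fun s ↦ setLIntegral_le_lintegral _ _)
    _ = ∫⁻ s in Set.Icc 0 R, ∫⁻ t in Set.Icc 0 R, ENNReal.ofReal (γ (s - t)) * A := by
        rw [← lintegral_indicator measurableSet_Icc]
        refine lintegral_congr fun s ↦ ?_
        by_cases hs : s ∈ Set.Icc 0 R
        · simp only [Set.indicator_of_mem hs]
          rw [lintegral_indicator measurableSet_Icc]
        · simp only [Set.indicator_of_notMem hs, lintegral_zero]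
    _ = (∫⁻ s in Set.Icc 0 R, ∫⁻ t in Set.Icc 0 R, ENNReal.ofReal (γ (s - t))) * A := by
        simp_rw [lintegral_mul_const' _ _ hAfin.ne]
    _ < ∞ := ENNReal.mul_lt_top (hγ.lintegral_square_lt_top' R) hAfin

end CovarianceMeasure

/-! ### The noise and the regularised kernels -/

section Noise

lemma Test.exists_bound {X : Type*} [NormedAddCommGroup X] [NormedSpace ℝ X] (c : Test X) :
    ∃ K R : ℝ, (∀ x, ‖c x‖ ≤ K) ∧ ∀ x, R < ‖x‖ → c x = 0 := by
  obtain ⟨K, hK⟩ := c.continuous.bounded_above_of_compact_support c.hasCompactSupport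
  obtain ⟨R, hR⟩ := c.hasCompactSupport.isCompact.isBounded.exists_norm_le
  refine ⟨K, R, hK, fun x hx ↦ ?_⟩
  by_contra h
  exact absurd (hR x (subset_tsupport _ h)) (not_le.2 hx)

variable {d : ℕ} {γ : ℝ → ℝ} {β C : ℝ} {Λ : Measure (Space d)} {Ω : Type*} [MeasurableSpace Ω]
  {P : Measure Ω} {W : SpaceTimeTest d → Ω → ℝ}

lemma covForm_test_eq_integral [SFinite Λ] [IsFiniteMeasureOnCompacts Λ]
    (hγ : IsTimeKernel γ β C) (φ ψ : SpaceTimeTest d) :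
    covForm γ Λ φ ψ = ∫ p, φ p.1 * ψ p.2 ∂(covMeasure γ Λ) := by
  obtain ⟨K₁, R₁, hK₁, hR₁⟩ := Test.exists_bound φ
  obtain ⟨K₂, R₂, hK₂, hR₂⟩ := Test.exists_bound ψ
  set R := max R₁ R₂
  have hφ : Measurable φ := φ.continuous.measurable
  have hψ : Measurable ψ := ψ.continuous.measurable
  have hφR : ∀ x, R < ‖x‖ → φ x = 0 := fun x hx ↦ hR₁ x ((le_max_left _ _).trans_lt hx)
  have hψR : ∀ x, R < ‖x‖ → ψ x = 0 := fun x hx ↦ hR₂ x ((le_max_right _ _).trans_lt hx)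
  refine covForm_eq_integral hγ.meas hγ.nonneg hφ hψ ?_ fun s t ↦ ?_
  · have hsub : Function.support (fun p : (ℝ × Space d) × (ℝ × Space d) ↦ φ p.1 * ψ p.2) ⊆
        Metric.closedBall 0 R ×ˢ Metric.closedBall 0 R := by
      intro p hp
      refine ⟨?_, ?_⟩
      · by_contra h
        exact hp (by simp [hφR p.1 (by simpa using h)])
      · by_contra h
        exact hp (by simp [hψR p.2 (by simpa using h)])
    rw [← integrableOn_iff_integrable_of_support_subset hsub]
    refine IntegrableOn.of_bound (covMeasure_ball_lt_top hγ R)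
      ((hφ.comp measurable_fst).mul (hψ.comp measurable_snd)).aestronglyMeasurable (K₁ * K₂)
      (ae_of_all _ fun p ↦ ?_)
    rw [norm_mul]
    exact mul_le_mul (hK₁ _) (hK₂ _) (norm_nonneg _) ((norm_nonneg _).trans (hK₁ 0))
  · refine Continuous.integrable_of_hasCompactSupport (by fun_prop)
      (HasCompactSupport.intro (isCompact_closedBall (0 : Space d × Space d) (2 * R))
        fun q hq ↦ ?_)
    rw [mem_closedBall_zero_iff, Prod.norm_def, max_le_iff, not_and_or] at hq
    by_cases h1 : ‖q.1‖ ≤ R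
    · by_cases h2 : ‖q.1 + q.2‖ ≤ R
      · exfalso
        have h0 : 0 ≤ R := (norm_nonneg _).trans h1
        have h3 : ‖q.2‖ ≤ 2 * R := by
          calc ‖q.2‖ = ‖(q.1 + q.2) - q.1‖ := by simp
            _ ≤ ‖q.1 + q.2‖ + ‖q.1‖ := norm_sub_le _ _
            _ ≤ _ := by linarith
        rcases hq with h | h
        · exact h (by linarith)
        · exact h h3
      · rw [hφR (s, q.1 + q.2) ((not_le.1 h2).trans_le (le_max_right _ _)), zero_mul]
    · rw [hψR (t, q.1) ((not_le.1 h1).trans_le (le_max_right _ _)), mul_zero]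

lemma IsGaussianNoise.memLp_two (hW : IsGaussianNoise P γ Λ W) (φ : SpaceTimeTest d) :
    MemLp (W φ) 2 P :=
  (hW.gaussian.hasGaussianLaw_eval φ).memLp_two

/-- The interaction measure is positive semidefinite because it is the covariance of the noise. -/
lemma IsGaussianNoise.isPosDefPair [SFinite Λ] [IsFiniteMeasureOnCompacts Λ]
    (hγ : IsTimeKernel γ β C) (hW : IsGaussianNoise P γ Λ W) :
    IsPosDefPair (covMeasure γ Λ) where
  finite := covMeasure_ball_lt_top hγ
  posDef φ ψ := by
    simp_rw [← covForm_test_eq_integral hγ, ← hW.covariance]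
    have i := fun φ ψ : SpaceTimeTest d ↦ (hW.memLp_two φ).integrable_mul (hW.memLp_two ψ)
    have h1 : ∫ ω, W φ ω * W φ ω + W ψ ω * W ψ ω ∂P =
        ∫ ω, W φ ω * W φ ω ∂P + ∫ ω, W ψ ω * W ψ ω ∂P := integral_add (i φ φ) (i ψ ψ)
    rw [← integral_const_mul, ← h1]
    refine integral_mono ((i φ ψ).const_mul 2) ((i φ φ).add (i ψ ψ)) fun ω ↦ ?_
    nlinarith [sq_nonneg (W φ ω - W ψ ω)]

lemma IsGaussianNoise.isIsonormal [SFinite Λ] [IsFiniteMeasureOnCompacts Λ]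
    (hγ : IsTimeKernel γ β C) (hW : IsGaussianNoise P γ Λ W) :
    IsIsonormal P (covMeasure γ Λ) W where
  memLp := hW.memLp_two
  cov φ ψ := by rw [hW.covariance, covForm_test_eq_integral hγ]
  law φ := by
    have h := hW.gaussian.hasGaussianLaw_eval φ
    rw [h.map_eq_gaussianReal, hW.centered, variance_of_integral_eq_zero h.aemeasurable
      (hW.centered φ)]
    simp [sq]

lemma isWienerIntegral_iff [SFinite Λ] (hγ : Measurable γ) {f : ℝ × Space d → ℝ}
    (hf : Measurable f) (Y : Ω → ℝ) :
    IsWienerIntegral P γ Λ W f Y ↔ IsEnergyLimit P (covMeasure γ Λ) W f Y := by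
  have h : ∀ c : SpaceTimeTest d, absEnergy γ Λ (fun p ↦ c p - f p) =
      energy (covMeasure γ Λ) (fun p ↦ c p - f p) := fun c ↦
    absEnergy_eq_energy hγ (c.continuous.measurable.sub hf)
  simp only [IsWienerIntegral, IsEnergyLimit, h]

end Noise

section Kernel

variable {d : ℕ} {γ : ℝ → ℝ} {β C : ℝ} {Λ μ : Measure (Space d)}

lemma measurable_kernelA (ε t : ℝ) (x : Space d) {b : ℝ≥0 → Space d} (hb : Measurable b) :
    Measurable (kernelA ε t x b) := by
  have h1 : Measurable fun p : ℝ × Space d ↦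
      heatKernel d ε (x + b (t - p.1).toNNReal - p.2) := by
    fun_prop
  have : kernelA ε t x b = (Prod.fst ⁻¹' Set.Icc (0 : ℝ) t).indicator fun p : ℝ × Space d ↦
      heatKernel d ε (x + b (t - p.1).toNNReal - p.2) := by
    ext p
    by_cases hp : p.1 ∈ Set.Icc (0 : ℝ) t
    · rw [kernelA, Set.indicator_of_mem hp, Set.indicator_of_mem (by exact hp)]
    · rw [kernelA, Set.indicator_of_notMem hp, Set.indicator_of_notMem (by exact hp)]
  rw [this]
  exact h1.indicator (measurable_fst measurableSet_Icc)

lemma kernelA_nonneg {ε : ℝ} (hε : 0 < ε) (t : ℝ) (x : Space d) (b : ℝ≥0 → Space d)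
    (p : ℝ × Space d) : 0 ≤ kernelA ε t x b p :=
  Set.indicator_nonneg (fun _ _ ↦ heatKernel_nonneg hε _) _

/-- The interaction of two kernels. The starting point `x` drops out by translation invariance. -/
lemma lintegral_kernelA_mul_kernelA [Λ.HasTemperateGrowth] (hγ : Measurable γ)
    {ε η : ℝ} (hε : 0 < ε) (hη : 0 < η) (t : ℝ) (x : Space d) {b b' : ℝ≥0 → Space d}
    (hb : Measurable b) (hb' : Measurable b') :
    ∫⁻ p, ENNReal.ofReal (kernelA ε t x b p.1) * ENNReal.ofReal (kernelA η t x b' p.2)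
      ∂(covMeasure γ Λ) =
    ∫⁻ r in Set.Icc 0 t, ∫⁻ s in Set.Icc 0 t, ENNReal.ofReal (γ (r - s)) *
      ENNReal.ofReal (mollify Λ (ε + η) (b (t - r).toNNReal - b' (t - s).toNNReal)) := by
  have := sigmaFinite_of_hasTemperateGrowth Λ
  have hm1 := measurable_kernelA ε t x hb
  have hm2 := measurable_kernelA η t x hb'
  rw [lintegral_covMeasure hγ (by fun_prop)]
  -- the spatial integral
  have key : ∀ r s : ℝ, r ∈ Set.Icc 0 t → s ∈ Set.Icc 0 t →
      ∫⁻ y, ∫⁻ z, ENNReal.ofReal (kernelA ε t x b (r, y + z)) *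
        ENNReal.ofReal (kernelA η t x b' (s, y)) ∂Λ =
      ENNReal.ofReal (mollify Λ (ε + η) (b (t - r).toNNReal - b' (t - s).toNNReal)) := by
    intro r s hr hs
    simp only [kernelA, Set.indicator_of_mem hr, Set.indicator_of_mem hs]
    rw [lintegral_lintegral_swap (by fun_prop), mollify,
      ofReal_integral_eq_lintegral_ofReal (integrable_heatKernel_sub Λ (by positivity) _)
        (ae_of_all _ fun _ ↦ heatKernel_nonneg (by positivity) _)]
    refine lintegral_congr fun z ↦ ?_
    set A := x + b (t - r).toNNReal - z with hA
    set A' := x + b' (t - s).toNNReal with hA'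
    have e : ∀ y, x + b (t - r).toNNReal - (y + z) = A - y := fun y ↦ by rw [hA]; abel
    have e2 : b (t - r).toNNReal - b' (t - s).toNNReal - z = A - A' := by rw [hA, hA']; abel
    simp_rw [e, e2]
    have hint : Integrable fun y ↦ heatKernel d ε (A - y) * heatKernel d η (A' - y) := by
      by_contra hcon
      have h1 := integral_heatKernel_mul_heatKernel hε hη A A'
      rw [integral_undef hcon] at h1
      exact (heatKernel_pos (d := d) (add_pos hε hη) (A - A')).ne h1
    rw [← integral_heatKernel_mul_heatKernel hε hη, ofReal_integral_eq_lintegral_ofReal hint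
      (ae_of_all _ fun y ↦ mul_nonneg (heatKernel_nonneg hε _) (heatKernel_nonneg hη _))]
    refine lintegral_congr fun y ↦ ?_
    rw [ENNReal.ofReal_mul (heatKernel_nonneg hε _)]
  have hout : ∀ (η : ℝ) (b : ℝ≥0 → Space d) (s : ℝ) (y : Space d), s ∉ Set.Icc 0 t →
      kernelA η t x b (s, y) = 0 := fun η b s y hs ↦ Set.indicator_of_notMem hs _
  have hIci : ∀ f : ℝ → ℝ≥0∞, (∀ r ∉ Set.Icc 0 t, f r = 0) →
      ∫⁻ r in Set.Ici 0, f r = ∫⁻ r in Set.Icc 0 t, f r := by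
    intro f hf
    have hsub : Function.support f ⊆ Set.Icc 0 t := fun r hr ↦ by
      by_contra h
      exact hr (hf r h)
    rw [setLIntegral_eq_of_support_subset hsub,
      setLIntegral_eq_of_support_subset (hsub.trans Set.Icc_subset_Ici_self)]
  rw [hIci _ fun r hr ↦ by simp [hout ε b r _ hr]]
  refine setLIntegral_congr_fun measurableSet_Icc fun r hr ↦ ?_
  dsimp only
  rw [hIci _ fun s hs ↦ by simp [hout η b' s _ hs]]
  refine setLIntegral_congr_fun measurableSet_Icc fun s hs ↦ ?_
  rw [key r s hr hs]

end Kernel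

/-! ### Noise covariances and time integrals -/

section Data

variable {d : ℕ}

/-- The standing assumptions on the covariance `γ(t) Λ(x)` of the noise and on the spectral
measure `μ` of `Λ`. -/
structure IsNoiseCovariance (γ : ℝ → ℝ) (Λ μ : Measure (Space d)) (β C : ℝ) : Prop where
  time : IsTimeKernel γ β C
  temperate : Λ.HasTemperateGrowth
  fourier : IsFourierTransform Λ μ
  spectral : SpectralBound μ (2 - 2 * β)

variable {γ : ℝ → ℝ} {Λ μ : Measure (Space d)} {β C : ℝ}

namespace IsNoiseCovariance

variable (h : IsNoiseCovariance γ Λ μ β C)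
include h

lemma exponent_nonneg : 0 ≤ 2 - 2 * β := by linarith [h.time.lt_one]

lemma exponent_le_two : 2 - 2 * β ≤ 2 := by linarith [h.time.pos]

lemma integrable_exp {u : ℝ} (hu : 0 < u) :
    Integrable (fun ξ ↦ Real.exp (-(u / 2) * ‖ξ‖ ^ 2)) μ :=
  h.spectral.integrable_exp h.exponent_nonneg h.exponent_le_two hu

lemma sigmaFinite_spectral : SigmaFinite μ := h.spectral.sigmaFinite h.exponent_nonneg

lemma mollify_le {ε : ℝ} (hε : 0 < ε) (x : Space d) : mollify Λ ε x ≤ peak μ ε :=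
  mollify_le_peak h.fourier hε (h.integrable_exp hε) x

lemma mollify_even {ε : ℝ} (hε : 0 < ε) (x : Space d) : mollify Λ ε (-x) = mollify Λ ε x :=
  mollify_neg h.fourier hε (h.integrable_exp hε) x

lemma continuous_mollify {ε : ℝ} (hε : 0 < ε) : Continuous (mollify Λ ε) :=
  FeynmanKac.continuous_mollify h.fourier hε (h.integrable_exp hε)

lemma norm_mollify_le {ε : ℝ} (hε : 0 < ε) (x : Space d) : ‖mollify Λ ε x‖ ≤ peak μ ε := by
  rw [Real.norm_eq_abs, abs_of_nonneg (mollify_nonneg Λ hε x)]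
  exact h.mollify_le hε x

lemma measurable_peak : Measurable (peak μ) := by
  have := h.sigmaFinite_spectral
  have : StronglyMeasurable fun p : ℝ × Space d ↦ Real.exp (-(p.1 / 2) * ‖p.2‖ ^ 2) := by
    fun_prop
  exact this.integral_prod_right.measurable.const_mul _

lemma peak_anti {u v : ℝ} (hu : 0 < u) (huv : u ≤ v) : peak μ v ≤ peak μ u :=
  peak_antitone h.exponent_nonneg h.exponent_le_two h.spectral hu huv

end IsNoiseCovariance

end Data

section TimeMeasure

variable {γ : ℝ → ℝ}

/-- The measure `γ(r-s) dr ds` on the square `[0,t]²`. -/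
noncomputable def timeMeasure (γ : ℝ → ℝ) (t : ℝ) : Measure (ℝ × ℝ) :=
  (volume.restrict (Set.Icc 0 t ×ˢ Set.Icc 0 t)).withDensity
    fun p ↦ ENNReal.ofReal (γ (p.1 - p.2))

lemma lintegral_timeMeasure (hγ : Measurable γ) (t : ℝ) {F : ℝ × ℝ → ℝ≥0∞} (hF : Measurable F) :
    ∫⁻ p, F p ∂(timeMeasure γ t) = ∫⁻ r in Set.Icc 0 t, ∫⁻ s in Set.Icc 0 t,
      ENNReal.ofReal (γ (r - s)) * F (r, s) := by
  have hd : Measurable fun p : ℝ × ℝ ↦ ENNReal.ofReal (γ (p.1 - p.2)) := by fun_prop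
  rw [timeMeasure, lintegral_withDensity_eq_lintegral_mul _ hd hF, Measure.volume_eq_prod,
    ← Measure.prod_restrict, lintegral_prod _ (hd.mul hF).aemeasurable]
  rfl

lemma integral_timeMeasure (hγ : Measurable γ) (hγ0 : ∀ t, 0 ≤ γ t) (t : ℝ) (F : ℝ × ℝ → ℝ) :
    ∫ p, F p ∂(timeMeasure γ t) =
      ∫ p in Set.Icc 0 t ×ˢ Set.Icc 0 t, γ (p.1 - p.2) * F p := by
  have hd : Measurable fun p : ℝ × ℝ ↦ ENNReal.ofReal (γ (p.1 - p.2)) := by fun_prop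
  rw [timeMeasure, integral_withDensity_eq_integral_toReal_smul hd
    (ae_of_all _ fun _ ↦ ENNReal.ofReal_lt_top)]
  simp only [ENNReal.toReal_ofReal (hγ0 _), smul_eq_mul]

lemma integrable_timeMeasure_iff (hγ : Measurable γ) (hγ0 : ∀ t, 0 ≤ γ t) (t : ℝ)
    (F : ℝ × ℝ → ℝ) : Integrable F (timeMeasure γ t) ↔
      IntegrableOn (fun p ↦ γ (p.1 - p.2) * F p) (Set.Icc 0 t ×ˢ Set.Icc 0 t) := by
  have hd : Measurable fun p : ℝ × ℝ ↦ ENNReal.ofReal (γ (p.1 - p.2)) := by fun_prop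
  rw [timeMeasure, integrable_withDensity_iff_integrable_smul' hd
    (ae_of_all _ fun _ ↦ ENNReal.ofReal_lt_top)]
  simp only [ENNReal.toReal_ofReal (hγ0 _), smul_eq_mul, IntegrableOn]

variable {β C : ℝ}

lemma IsTimeKernel.isFiniteMeasure_timeMeasure (hγ : IsTimeKernel γ β C) (t : ℝ) :
    IsFiniteMeasure (timeMeasure γ t) := by
  refine ⟨?_⟩
  rw [← lintegral_one, lintegral_timeMeasure hγ.meas t measurable_const]
  simpa using hγ.lintegral_square_lt_top' t

/-- The diagonal is negligible for `γ(r-s) dr ds`. -/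
lemma ae_timeMeasure_ne (t : ℝ) : ∀ᵐ p ∂(timeMeasure γ t), p.1 ≠ p.2 := by
  refine (withDensity_absolutelyContinuous _ _).ae_le (ae_restrict_of_ae ?_)
  rw [Measure.volume_eq_prod]
  refine (Measure.ae_prod_iff_ae_ae
    (measurableSet_eq_fun measurable_fst measurable_snd).compl).2 (ae_of_all _ fun r ↦ ?_)
  refine measure_mono_null (t := {r}) (fun s hs ↦ ?_) Real.volume_singleton
  simpa [eq_comm] using hs

lemma ae_timeMeasure_mem (t : ℝ) :
    ∀ᵐ p ∂(timeMeasure γ t), p ∈ Set.Icc 0 t ×ˢ Set.Icc 0 t :=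
  (withDensity_absolutelyContinuous _ _).ae_le
    (ae_restrict_mem (measurableSet_Icc.prod measurableSet_Icc))

lemma lintegral_Icc_reflect (t : ℝ) (f : ℝ → ℝ≥0∞) :
    ∫⁻ r in Set.Icc 0 t, f (t - r) = ∫⁻ r in Set.Icc 0 t, f r := by
  rw [← lintegral_indicator measurableSet_Icc, ← lintegral_indicator measurableSet_Icc,
    ← lintegral_sub_left_eq_self (fun r ↦ (Set.Icc 0 t).indicator f r) t]
  refine lintegral_congr fun r ↦ ?_
  by_cases hr : r ∈ Set.Icc 0 t
  · rw [Set.indicator_of_mem hr, Set.indicator_of_mem]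
    exact ⟨by linarith [hr.2], by linarith [hr.1]⟩
  · rw [Set.indicator_of_notMem hr, Set.indicator_of_notMem]
    exact fun h ↦ hr ⟨by linarith [h.2], by linarith [h.1]⟩

lemma integrable_peak_timeMeasure {d : ℕ} {Λ μ : Measure (Space d)}
    (h : IsNoiseCovariance γ Λ μ β C) (t : ℝ) :
    Integrable (fun p : ℝ × ℝ ↦ peak μ |p.1 - p.2|) (timeMeasure γ t) := by
  have hm := h.measurable_peak
  have hm' : Measurable fun p : ℝ × ℝ ↦ peak μ |p.1 - p.2| := by fun_prop
  refine ⟨hm'.aestronglyMeasurable, ?_⟩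
  rw [HasFiniteIntegral, lintegral_timeMeasure h.time.meas t hm'.enorm]
  rcases le_or_gt t 0 with ht | ht
  · rcases ht.lt_or_eq with ht | rfl
    · simp [Set.Icc_eq_empty (not_le.2 ht)]
    · simp
  · refine lt_of_le_of_lt (le_of_eq ?_) (h.time.lintegral_square_lt_top (peak_nonneg μ)
      (integrableOn_rpow_mul_peak h.time.pos h.time.lt_one ht h.spectral))
    refine lintegral_congr fun r ↦ lintegral_congr fun s ↦ ?_
    rw [ENNReal.ofReal_mul (h.time.nonneg _), Real.enorm_eq_ofReal (peak_nonneg _ _)]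

end TimeMeasure

section KernelPairing

variable {d : ℕ} {γ : ℝ → ℝ} {Λ μ : Measure (Space d)} {β C : ℝ}

lemma IsNoiseCovariance.lintegral_kernelA (h : IsNoiseCovariance γ Λ μ β C)
    {ε η : ℝ} (hε : 0 < ε) (hη : 0 < η) (t : ℝ) (x : Space d) {b b' : ℝ≥0 → Space d}
    (hb : Measurable b) (hb' : Measurable b') :
    ∫⁻ p, ENNReal.ofReal (kernelA ε t x b p.1) * ENNReal.ofReal (kernelA η t x b' p.2)
      ∂(covMeasure γ Λ) =
    ∫⁻ p, ENNReal.ofReal (mollify Λ (ε + η) (b' p.1.toNNReal - b p.2.toNNReal))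
      ∂(timeMeasure γ t) := by
  have := h.temperate
  have hγ := h.time.meas
  have hΛm : Measurable (mollify Λ (ε + η)) := (h.continuous_mollify (add_pos hε hη)).measurable
  rw [lintegral_kernelA_mul_kernelA hγ hε hη t x hb hb', lintegral_timeMeasure hγ t (by fun_prop)]
  calc _ = ∫⁻ r in Set.Icc 0 t, ∫⁻ s in Set.Icc 0 t, ENNReal.ofReal (γ (s - r)) *
        ENNReal.ofReal (mollify Λ (ε + η) (b r.toNNReal - b' s.toNNReal)) := by
        rw [← lintegral_Icc_reflect t]
        refine lintegral_congr fun r ↦ ?_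
        rw [← lintegral_Icc_reflect t]
        refine lintegral_congr fun s ↦ ?_
        rw [show t - r - (t - s) = s - r by ring, sub_sub_cancel, sub_sub_cancel]
    _ = _ := by
        rw [lintegral_lintegral_swap (by fun_prop)]
        refine lintegral_congr fun s ↦ lintegral_congr fun r ↦ ?_
        rw [← h.mollify_even (add_pos hε hη), neg_sub]

lemma IsNoiseCovariance.integrable_mollify (h : IsNoiseCovariance γ Λ μ β C) {ε : ℝ}
    (hε : 0 < ε) (t : ℝ) {b b' : ℝ≥0 → Space d} (hb : Measurable b) (hb' : Measurable b') :
    Integrable (fun p : ℝ × ℝ ↦ mollify Λ ε (b p.1.toNNReal - b' p.2.toNNReal))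
      (timeMeasure γ t) := by
  have := h.time.isFiniteMeasure_timeMeasure t
  have hΛm : Measurable (mollify Λ ε) := (h.continuous_mollify hε).measurable
  have hm : Measurable fun p : ℝ × ℝ ↦ mollify Λ ε (b p.1.toNNReal - b' p.2.toNNReal) :=
    hΛm.comp (by fun_prop)
  exact Integrable.of_bound hm.aestronglyMeasurable (peak μ ε)
    (ae_of_all _ fun p ↦ h.norm_mollify_le hε _)

/-- The covariance of the regularised functionals along two paths. -/
lemma IsNoiseCovariance.integral_kernelA (h : IsNoiseCovariance γ Λ μ β C)
    {ε η : ℝ} (hε : 0 < ε) (hη : 0 < η) (t : ℝ) (x : Space d) {b b' : ℝ≥0 → Space d}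
    (hb : Measurable b) (hb' : Measurable b') :
    ∫ p, kernelA ε t x b p.1 * kernelA η t x b' p.2 ∂(covMeasure γ Λ) =
      ∫ p, mollify Λ (ε + η) (b' p.1.toNNReal - b p.2.toNNReal) ∂(timeMeasure γ t) := by
  have hm1 := measurable_kernelA ε t x hb
  have hm2 := measurable_kernelA η t x hb'
  rw [integral_eq_lintegral_of_nonneg_ae (ae_of_all _ fun p ↦
      mul_nonneg (kernelA_nonneg hε t x b _) (kernelA_nonneg hη t x b' _)) (by fun_prop),
    integral_eq_lintegral_of_nonneg_ae (ae_of_all _ fun p ↦ mollify_nonneg Λ (add_pos hε hη) _)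
      (h.integrable_mollify (add_pos hε hη) t hb' hb).aestronglyMeasurable,
    ← h.lintegral_kernelA hε hη t x hb hb']
  congr 1
  refine lintegral_congr fun p ↦ ?_
  rw [ENNReal.ofReal_mul (kernelA_nonneg hε t x b _)]

lemma IsNoiseCovariance.energy_kernelA_lt_top (h : IsNoiseCovariance γ Λ μ β C)
    {ε : ℝ} (hε : 0 < ε) (t : ℝ) (x : Space d) {b : ℝ≥0 → Space d} (hb : Measurable b) :
    energy (covMeasure γ Λ) (kernelA ε t x b) < ∞ := by
  have e : energy (covMeasure γ Λ) (kernelA ε t x b) =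
      ∫⁻ p, ENNReal.ofReal (mollify Λ (ε + ε) (b p.1.toNNReal - b p.2.toNNReal))
        ∂(timeMeasure γ t) := by
    rw [← h.lintegral_kernelA hε hε t x hb hb, energy]
    simp_rw [Real.enorm_eq_ofReal (kernelA_nonneg hε t x b _)]
  rw [e]
  refine lt_of_le_of_lt (lintegral_mono fun p ↦ ?_)
    (h.integrable_mollify (add_pos hε hε) t hb hb).2
  rw [Real.enorm_eq_ofReal (mollify_nonneg Λ (add_pos hε hε) _)]

end KernelPairing

/-! ### Slices of functions on a product space -/

section Slices

variable {Ω Ω' : Type*} [MeasurableSpace Ω] [MeasurableSpace Ω'] {P : Measure Ω} {Q : Measure Ω'}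
  [IsProbabilityMeasure P] [IsProbabilityMeasure Q]

lemma eLpNorm_two_sq {α : Type*} [MeasurableSpace α] {κ : Measure α} {F : Type*}
    [NormedAddCommGroup F] (f : α → F) : eLpNorm f 2 κ ^ 2 = ∫⁻ x, ‖f x‖ₑ ^ 2 ∂κ := by
  have := eLpNorm_nnreal_pow_eq_lintegral (μ := κ) (f := f) (p := 2) (by simp)
  simpa using this

lemma eLpNorm_two_sq_prod {Z : Ω × Ω' → ℝ} (hZ : AEStronglyMeasurable Z (P.prod Q)) :
    eLpNorm Z 2 (P.prod Q) ^ 2 = ∫⁻ ω', eLpNorm (fun ω ↦ Z (ω, ω')) 2 P ^ 2 ∂Q := by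
  simp_rw [eLpNorm_two_sq]
  rw [lintegral_prod_symm _ (hZ.enorm.pow_const 2)]

lemma ae_eq_prod_of_slices {Z Z' : Ω × Ω' → ℝ} (hZ : AEStronglyMeasurable Z (P.prod Q))
    (hZ' : AEStronglyMeasurable Z' (P.prod Q))
    (h : ∀ᵐ ω' ∂Q, (fun ω ↦ Z (ω, ω')) =ᵐ[P] fun ω ↦ Z' (ω, ω')) : Z =ᵐ[P.prod Q] Z' := by
  have h0 : eLpNorm (Z - Z') 2 (P.prod Q) ^ 2 = 0 := by
    rw [eLpNorm_two_sq_prod (hZ.sub hZ'), lintegral_eq_zero_of_ae_eq_zero]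
    filter_upwards [h] with ω' hω'
    have : (fun ω ↦ (Z - Z') (ω, ω')) =ᵐ[P] 0 := by
      filter_upwards [hω'] with ω hω
      simp [hω]
    rw [eLpNorm_congr_ae this]
    simp
  have h1 := (eLpNorm_eq_zero_iff (hZ.sub hZ') (by simp)).1 (pow_eq_zero_iff two_ne_zero |>.1 h0)
  filter_upwards [h1] with p hp
  exact sub_eq_zero.1 hp

/-- Convergence in `L²` of a product gives convergence in `L²` of almost every slice, along a
subsequence. -/
lemma exists_subseq_tendsto_slices {Z : ℕ → Ω × Ω' → ℝ}
    (hZ : ∀ n, AEStronglyMeasurable (Z n) (P.prod Q))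
    (h : Tendsto (fun n ↦ eLpNorm (Z n) 2 (P.prod Q)) atTop (𝓝 0)) :
    ∃ ns : ℕ → ℕ, StrictMono ns ∧ ∀ᵐ ω' ∂Q,
      Tendsto (fun k ↦ eLpNorm (fun ω ↦ Z (ns k) (ω, ω')) 2 P) atTop (𝓝 0) := by
  have h2 : Tendsto (fun n ↦ eLpNorm (Z n) 2 (P.prod Q) ^ 2) atTop (𝓝 0) := by
    simpa using ENNReal.Tendsto.pow (n := 2) h
  have hev : ∀ k : ℕ, ∃ N, ∀ n ≥ N, eLpNorm (Z n) 2 (P.prod Q) ^ 2 < (1 / 2 : ℝ≥0∞) ^ k := fun k ↦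
    (h2.eventually_lt_const (ENNReal.pow_pos (by simp) k)).exists_forall_of_atTop
  obtain ⟨ns, hns, hlt⟩ := extraction_forall_of_eventually'
    (P := fun k n ↦ eLpNorm (Z n) 2 (P.prod Q) ^ 2 < (1 / 2 : ℝ≥0∞) ^ k) hev
  refine ⟨ns, hns, ?_⟩
  have hm : ∀ n, AEMeasurable (fun ω' ↦ eLpNorm (fun ω ↦ Z n (ω, ω')) 2 P ^ 2) Q := fun n ↦ by
    simp_rw [eLpNorm_two_sq]
    exact ((hZ n).enorm.pow_const 2).lintegral_prod_left'
  have hsum : ∫⁻ ω', ∑' k, eLpNorm (fun ω ↦ Z (ns k) (ω, ω')) 2 P ^ 2 ∂Q ≠ ∞ := by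
    rw [lintegral_tsum fun k ↦ hm (ns k)]
    simp_rw [← eLpNorm_two_sq_prod (hZ _)]
    refine ne_top_of_le_ne_top ?_ (ENNReal.tsum_le_tsum fun k ↦ (hlt k).le)
    rw [ENNReal.tsum_geometric]
    simp
  filter_upwards [ae_lt_top' (AEMeasurable.tsum fun k ↦ hm (ns k)) hsum] with ω' hω'
  have h3 := ENNReal.tendsto_atTop_zero_of_tsum_ne_top hω'.ne
  have h4 := (ENNReal.continuous_rpow_const (y := (1 / 2 : ℝ))).tendsto 0 |>.comp h3
  simp only [ENNReal.zero_rpow_of_pos (by norm_num : (0 : ℝ) < 1 / 2)] at h4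
  refine h4.congr fun k ↦ ?_
  rw [Function.comp_apply, ← ENNReal.rpow_natCast, ← ENNReal.rpow_mul]
  norm_num

/-- A bounded strongly measurable family of elements of `L²(P)` has a jointly measurable version. -/
lemma exists_joint_version {F : Ω' → Lp ℝ 2 P} (hF : StronglyMeasurable F) {M : ℝ}
    (hM : ∀ ω', ‖F ω'‖ ≤ M) :
    ∃ Y : Ω × Ω' → ℝ, MemLp Y 2 (P.prod Q) ∧
      ∀ᵐ ω' ∂Q, (fun ω ↦ Y (ω, ω')) =ᵐ[P] F ω' := by
  set G : ℕ → SimpleFunc Ω' (Lp ℝ 2 P) := fun n ↦ hF.approxBounded M n with hG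
  have hGF : ∀ ω', Tendsto (fun n ↦ G n ω') atTop (𝓝 (F ω')) := fun ω' ↦
    hF.tendsto_approxBounded_of_norm_le (hM ω')
  have hM0 : 0 ≤ M := by
    obtain ⟨ω'⟩ := nonempty_of_isProbabilityMeasure Q
    exact (norm_nonneg _).trans (hM ω')
  have hGM : ∀ n ω', ‖G n ω'‖ ≤ M := fun n ω' ↦ hF.norm_approxBounded_le hM0 n ω'
  set Z : ℕ → Ω × Ω' → ℝ := fun n p ↦ (G n p.2 : Lp ℝ 2 P) p.1 with hZ
  have hZm : ∀ n, Measurable (Z n) := fun n ↦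
    SimpleFunc.measurable_bind ((G n).comp Prod.snd measurable_snd)
      (fun (c : Lp ℝ 2 P) p ↦ c p.1) fun c ↦ (Lp.stronglyMeasurable c).measurable.comp
        measurable_fst
  -- the map from families to functions on the product is an isometry
  have hiso : ∀ n m, eLpNorm (Z n - Z m) 2 (P.prod Q) =
      eLpNorm (fun ω' ↦ G n ω' - G m ω') 2 Q := by
    intro n m
    refine (ENNReal.pow_right_strictMono two_ne_zero).injective ?_
    rw [eLpNorm_two_sq_prod ((hZm n).sub (hZm m)).aestronglyMeasurable, eLpNorm_two_sq]
    refine lintegral_congr fun ω' ↦ ?_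
    rw [Lp.enorm_def, eLpNorm_congr_ae (Lp.coeFn_sub _ _)]
    rfl
  have hG2 : ∀ n, MemLp (G n) 2 Q := fun n ↦
    MemLp.of_bound (G n).aestronglyMeasurable M (ae_of_all _ (hGM n))
  have hF2 : MemLp F 2 Q := MemLp.of_bound hF.aestronglyMeasurable M (ae_of_all _ hM)
  have hZ2 : ∀ n, MemLp (Z n) 2 (P.prod Q) := by
    intro n
    refine ⟨(hZm n).aestronglyMeasurable, ?_⟩
    have h1 : eLpNorm (Z n) 2 (P.prod Q) ^ 2 = eLpNorm (G n) 2 Q ^ 2 := by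
      rw [eLpNorm_two_sq_prod (hZm n).aestronglyMeasurable, eLpNorm_two_sq]
      exact lintegral_congr fun ω' ↦ by rw [Lp.enorm_def]
    have h2 := (ENNReal.pow_right_strictMono two_ne_zero).injective h1
    rw [h2]
    exact (hG2 n).2
  have hGt : Tendsto (fun n ↦ eLpNorm (fun ω' ↦ G n ω' - F ω') 2 Q) atTop (𝓝 0) := by
    have h1 : Tendsto (fun n ↦ ∫⁻ ω', ‖G n ω' - F ω'‖ₑ ^ 2 ∂Q) atTop (𝓝 (∫⁻ _, 0 ∂Q)) := by
      refine tendsto_lintegral_of_dominated_convergence (fun _ ↦ (ENNReal.ofReal (2 * M)) ^ 2)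
        (fun n ↦ ((G n).stronglyMeasurable.sub hF).enorm.pow_const 2)
        (fun n ↦ ae_of_all _ fun ω' ↦ ?_) (by simp [ENNReal.mul_eq_top]) (ae_of_all _ fun ω' ↦ ?_)
      · dsimp only
        gcongr
        rw [← ofReal_norm]
        refine ENNReal.ofReal_le_ofReal ((norm_sub_le _ _).trans ?_)
        linarith [hGM n ω', hM ω']
      · have := ((hGF ω').sub_const (F ω')).enorm
        simpa using ENNReal.Tendsto.pow (n := 2) this
    rw [lintegral_zero] at h1
    have h4 := (ENNReal.continuous_rpow_const (y := (1 / 2 : ℝ))).tendsto 0 |>.comp h1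
    simp only [ENNReal.zero_rpow_of_pos (by norm_num : (0 : ℝ) < 1 / 2)] at h4
    refine h4.congr fun k ↦ ?_
    rw [Function.comp_apply, ← eLpNorm_two_sq, ← ENNReal.rpow_natCast, ← ENNReal.rpow_mul]
    norm_num
  have hGc : CauchySeq fun n ↦ (hG2 n).toLp :=
    ((Lp.tendsto_Lp_iff_tendsto_eLpNorm'' _ hG2 _ hF2).2 hGt).cauchySeq
  have hZc : CauchySeq fun n ↦ (hZ2 n).toLp := by
    rw [cauchySeq_iff_tendsto_dist_atTop_0] at hGc ⊢
    refine hGc.congr fun p ↦ ?_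
    rw [Lp.dist_def, Lp.dist_def]
    congr 1
    rw [eLpNorm_congr_ae ((hZ2 p.1).coeFn_toLp.sub (hZ2 p.2).coeFn_toLp), hiso,
      eLpNorm_congr_ae ((hG2 p.1).coeFn_toLp.sub (hG2 p.2).coeFn_toLp)]
    rfl
  obtain ⟨Y, hY⟩ := cauchySeq_tendsto_of_complete hZc
  have hYt : Tendsto (fun n ↦ eLpNorm (fun p ↦ Z n p - Y p) 2 (P.prod Q)) atTop (𝓝 0) := by
    rw [← Lp.toLp_coeFn Y (Lp.memLp Y)] at hY
    exact (Lp.tendsto_Lp_iff_tendsto_eLpNorm'' _ hZ2 _ (Lp.memLp Y)).1 hY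
  refine ⟨Y, Lp.memLp Y, ?_⟩
  obtain ⟨ns, hns, hae⟩ := exists_subseq_tendsto_slices
    (fun n ↦ ((hZ2 n).sub (Lp.memLp Y)).aestronglyMeasurable) hYt
  have hYs : ∀ᵐ ω' ∂Q, AEStronglyMeasurable (fun ω ↦ Y (ω, ω')) P :=
    ae_of_all _ fun ω' ↦ (Lp.stronglyMeasurable Y).aestronglyMeasurable.comp_measurable
      measurable_prodMk_right
  filter_upwards [hae, hYs] with ω' h1 h2
  have h3 : Tendsto (fun k ↦ eLpNorm (fun ω ↦ Z (ns k) (ω, ω') - F ω' ω) 2 P) atTop (𝓝 0) := by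
    have h5 : Tendsto (fun k ↦ G (ns k) ω') atTop (𝓝 (F ω')) := (hGF ω').comp hns.tendsto_atTop
    have h6 := (Lp.tendsto_Lp_iff_tendsto_eLpNorm' (fun k ↦ G (ns k) ω') (F ω')).1 h5
    refine h6.congr fun k ↦ ?_
    rw [hZ]
    rfl
  have hGs : ∀ k, AEStronglyMeasurable (fun ω ↦ Z (ns k) (ω, ω')) P := fun k ↦
    (Lp.stronglyMeasurable (G (ns k) ω')).aestronglyMeasurable
  have hFs : AEStronglyMeasurable (F ω') P := (Lp.stronglyMeasurable (F ω')).aestronglyMeasurable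
  have l1 : TendstoInMeasure P (fun k ω ↦ Z (ns k) (ω, ω')) atTop fun ω ↦ Y (ω, ω') :=
    tendstoInMeasure_of_tendsto_eLpNorm two_ne_zero hGs h2 h1
  have l2 : TendstoInMeasure P (fun k ω ↦ Z (ns k) (ω, ω')) atTop (F ω') :=
    tendstoInMeasure_of_tendsto_eLpNorm two_ne_zero hGs hFs h3
  exact tendstoInMeasure_ae_unique l1 l2

end Slices

/-! ### Wiener integrals along paths -/

lemma tendsto_floor_mul_div (r : ℝ≥0) :
    Tendsto (fun n : ℕ ↦ (⌊r * n⌋₊ / n : ℝ≥0)) atTop (𝓝 r) := by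
  rw [← NNReal.tendsto_coe]
  refine ((tendsto_nat_floor_mul_div_atTop r.2).comp tendsto_natCast_atTop_atTop).congr fun n ↦ ?_
  have : ⌊(r : ℝ) * n⌋₊ = ⌊r * n⌋₊ := Nonneg.nat_floor_coe (r * (n : ℝ≥0))
  simp [this]

section PathDependence

variable {d : ℕ} {γ : ℝ → ℝ} {Λ μ : Measure (Space d)} {β C : ℝ}
  {Ω Ω' : Type*} [MeasurableSpace Ω] [MeasurableSpace Ω'] {P : Measure Ω} {Q : Measure Ω'}
  {W : SpaceTimeTest d → Ω → ℝ}

lemma IsEnergyLimit.congr {X : Type*} [NormedAddCommGroup X] [NormedSpace ℝ X] [MeasurableSpace X]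
    {ν : Measure (X × X)} {W : Test X → Ω → ℝ} {f : X → ℝ} {Y Y' : Ω → ℝ}
    (hY : IsEnergyLimit P ν W f Y) (h : Y =ᵐ[P] Y') : IsEnergyLimit P ν W f Y' := by
  obtain ⟨h1, φ, h2, h3⟩ := hY
  refine ⟨(memLp_congr_ae h).1 h1, φ, h2, h3.congr fun n ↦ eLpNorm_congr_ae ?_⟩
  filter_upwards [h] with ω hω
  rw [hω]

/-- `I ε b` is the Wiener integral of the kernel along the path `b`, as an element of `L²(P)`. -/
def IsWienerFamily (P : Measure Ω) (γ : ℝ → ℝ) (Λ : Measure (Space d))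
    (W : SpaceTimeTest d → Ω → ℝ) (t : ℝ) (x : Space d)
    (I : ℝ → (ℝ≥0 → Space d) → Lp ℝ 2 P) : Prop :=
  ∀ ε b, 0 < ε → Measurable b →
    IsEnergyLimit P (covMeasure γ Λ) W (kernelA ε t x b) (I ε b)

namespace IsNoiseCovariance

variable (h : IsNoiseCovariance γ Λ μ β C)
include h

lemma sigmaFinite : SigmaFinite Λ :=
  have := h.temperate
  sigmaFinite_of_hasTemperateGrowth Λ

lemma isFiniteMeasureOnCompacts : IsFiniteMeasureOnCompacts Λ :=
  have := h.temperate
  isFiniteMeasureOnCompacts_of_hasTemperateGrowth Λ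

lemma isPosDefPair (hW : IsGaussianNoise P γ Λ W) : IsPosDefPair (covMeasure γ Λ) :=
  have := h.sigmaFinite
  have := h.isFiniteMeasureOnCompacts
  hW.isPosDefPair h.time

lemma isIsonormal (hW : IsGaussianNoise P γ Λ W) : IsIsonormal P (covMeasure γ Λ) W :=
  have := h.sigmaFinite
  have := h.isFiniteMeasureOnCompacts
  hW.isIsonormal h.time

lemma exists_isWienerFamily (hW : IsGaussianNoise P γ Λ W) (t : ℝ) (x : Space d) :
    ∃ I, IsWienerFamily P γ Λ W t x I := by
  have key : ∀ ε : ℝ, ∀ b : ℝ≥0 → Space d, ∃ J : Lp ℝ 2 P, 0 < ε → Measurable b →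
      IsEnergyLimit P (covMeasure γ Λ) W (kernelA ε t x b) J := by
    intro ε b
    by_cases hc : 0 < ε ∧ Measurable b
    · obtain ⟨Y, hY⟩ := (h.isIsonormal hW).exists_energyLimit (h.isPosDefPair hW)
        (measurable_kernelA ε t x hc.2) (h.energy_kernelA_lt_top hc.1 t x hc.2)
      exact ⟨hY.1.toLp, fun _ _ ↦ hY.congr hY.1.coeFn_toLp.symm⟩
    · exact ⟨0, fun h1 h2 ↦ absurd ⟨h1, h2⟩ hc⟩
  choose I hI using key
  exact ⟨I, hI⟩

variable {t : ℝ} {x : Space d} {I : ℝ → (ℝ≥0 → Space d) → Lp ℝ 2 P}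

/-- The covariance of two regularised functionals: the two mollifications add up. -/
lemma inner_wienerFamily (hW : IsGaussianNoise P γ Λ W) (hI : IsWienerFamily P γ Λ W t x I)
    {ε η : ℝ} (hε : 0 < ε) (hη : 0 < η) {b b' : ℝ≥0 → Space d} (hb : Measurable b)
    (hb' : Measurable b') :
    inner ℝ (I ε b) (I η b') =
      ∫ p, mollify Λ (ε + η) (b' p.1.toNNReal - b p.2.toNNReal) ∂(timeMeasure γ t) := by
  have h1 := integral_mul_eq_inner_toLp (Lp.memLp (I ε b)) (Lp.memLp (I η b'))
  rw [Lp.toLp_coeFn, Lp.toLp_coeFn] at h1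
  rw [← h1, (h.isIsonormal hW).integral_mul (h.isPosDefPair hW) (measurable_kernelA ε t x hb)
    (measurable_kernelA η t x hb') (h.energy_kernelA_lt_top hε t x hb)
    (h.energy_kernelA_lt_top hη t x hb') (hI ε b hε hb) (hI η b' hη hb'),
    h.integral_kernelA hε hη t x hb hb']

lemma tendsto_integral_mollify (t : ℝ) {ε : ℝ} (hε : 0 < ε) {b b' : ℕ → ℝ≥0 → Space d}
    {c c' : ℝ≥0 → Space d} (hb : ∀ n, Measurable (b n)) (hb' : ∀ n, Measurable (b' n))
    (hbc : ∀ r, Tendsto (fun n ↦ b n r) atTop (𝓝 (c r)))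
    (hbc' : ∀ r, Tendsto (fun n ↦ b' n r) atTop (𝓝 (c' r))) :
    Tendsto (fun n ↦ ∫ p, mollify Λ ε (b n p.1.toNNReal - b' n p.2.toNNReal) ∂(timeMeasure γ t))
      atTop (𝓝 (∫ p, mollify Λ ε (c p.1.toNNReal - c' p.2.toNNReal) ∂(timeMeasure γ t))) := by
  have := h.time.isFiniteMeasure_timeMeasure t
  refine tendsto_integral_of_dominated_convergence (fun _ ↦ peak μ ε)
    (fun n ↦ (h.integrable_mollify hε t (hb n) (hb' n)).aestronglyMeasurable)
    (integrable_const _) (fun n ↦ ae_of_all _ fun p ↦ h.norm_mollify_le hε _)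
    (ae_of_all _ fun p ↦ ?_)
  exact (h.continuous_mollify hε).continuousAt.tendsto.comp ((hbc _).sub (hbc' _))

/-- The Wiener integral depends continuously on the path, for pointwise convergence of paths. -/
lemma tendsto_wienerFamily (hW : IsGaussianNoise P γ Λ W) (hI : IsWienerFamily P γ Λ W t x I)
    {ε : ℝ} (hε : 0 < ε) {b : ℕ → ℝ≥0 → Space d} {c : ℝ≥0 → Space d} (hb : ∀ n, Measurable (b n))
    (hc : Measurable c) (hbc : ∀ r, Tendsto (fun n ↦ b n r) atTop (𝓝 (c r))) :
    Tendsto (fun n ↦ I ε (b n)) atTop (𝓝 (I ε c)) := by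
  rw [tendsto_iff_norm_sub_tendsto_zero]
  have h1 : Tendsto (fun n ↦ ‖I ε (b n) - I ε c‖ ^ 2) atTop (𝓝 0) := by
    have e : ∀ n, ‖I ε (b n) - I ε c‖ ^ 2 =
        (∫ p, mollify Λ (ε + ε) (b n p.1.toNNReal - b n p.2.toNNReal) ∂(timeMeasure γ t)) -
        2 * (∫ p, mollify Λ (ε + ε) (c p.1.toNNReal - b n p.2.toNNReal) ∂(timeMeasure γ t)) +
        ∫ p, mollify Λ (ε + ε) (c p.1.toNNReal - c p.2.toNNReal) ∂(timeMeasure γ t) := fun n ↦ by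
      rw [norm_sub_sq_real, ← real_inner_self_eq_norm_sq, ← real_inner_self_eq_norm_sq,
        h.inner_wienerFamily hW hI hε hε (hb n) (hb n), h.inner_wienerFamily hW hI hε hε (hb n) hc,
        h.inner_wienerFamily hW hI hε hε hc hc]
    simp_rw [e]
    have hε2 : 0 < ε + ε := by positivity
    have l1 := h.tendsto_integral_mollify t hε2 hb hb hbc hbc
    have l2 := h.tendsto_integral_mollify t hε2 (fun _ ↦ hc) hb (fun _ ↦ tendsto_const_nhds) hbc
    have := (l1.sub (l2.const_mul 2)).add_const
      (∫ p, mollify Λ (ε + ε) (c p.1.toNNReal - c p.2.toNNReal) ∂(timeMeasure γ t))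
    refine this.trans_eq ?_
    congr 1
    ring
  have h2 := h1.sqrt
  simpa [Real.sqrt_sq (norm_nonneg _)] using h2

lemma norm_wienerFamily_le (hW : IsGaussianNoise P γ Λ W) (hI : IsWienerFamily P γ Λ W t x I)
    {ε : ℝ} (hε : 0 < ε) : ∃ M, ∀ b : ℝ≥0 → Space d, Measurable b → ‖I ε b‖ ≤ M := by
  have := h.time.isFiniteMeasure_timeMeasure t
  refine ⟨√(peak μ (ε + ε) * (timeMeasure γ t).real Set.univ), fun b hb ↦ Real.le_sqrt_of_sq_le ?_⟩
  rw [← real_inner_self_eq_norm_sq, h.inner_wienerFamily hW hI hε hε hb hb]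
  refine (le_abs_self _).trans ?_
  rw [← Real.norm_eq_abs]
  exact norm_integral_le_of_norm_le_const
    (ae_of_all _ fun p ↦ h.norm_mollify_le (by positivity) _)

/-- Along a process with continuous paths, the Wiener integral is a strongly measurable function of
the realisation: the paths are pointwise limits of step functions, on which the integral depends
continuously through countably many values of the process. -/
lemma stronglyMeasurable_wienerFamily (hW : IsGaussianNoise P γ Λ W)
    (hI : IsWienerFamily P γ Λ W t x I) {ε : ℝ} (hε : 0 < ε) {B : ℝ≥0 → Ω' → Space d}
    (hBm : ∀ s, Measurable (B s)) (hBc : ∀ ω', Continuous fun s ↦ B s ω') :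
    StronglyMeasurable fun ω' ↦ I ε (fun s ↦ B s ω') := by
  have hstep : ∀ (n : ℕ) (c : ℕ → Space d), Measurable fun r : ℝ≥0 ↦ c ⌊r * n⌋₊ := fun n c ↦
    (measurable_from_nat (f := c)).comp (Nat.measurable_floor.comp (by fun_prop))
  refine stronglyMeasurable_of_tendsto (u := atTop)
    (f := fun (n : ℕ) ω' ↦ I ε fun r ↦ B (⌊r * n⌋₊ / n) ω') (fun n ↦ ?_) ?_
  · have hcont : Continuous fun c : ℕ → Space d ↦ I ε fun r ↦ c ⌊r * n⌋₊ := by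
      refine SeqContinuous.continuous fun u c hu ↦ ?_
      exact h.tendsto_wienerFamily hW hI hε (fun m ↦ hstep n (u m)) (hstep n c)
        fun r ↦ (tendsto_pi_nhds.1 hu) _
    exact hcont.stronglyMeasurable.comp_measurable
      (g := fun ω' (k : ℕ) ↦ B (k / n) ω') (measurable_pi_lambda _ fun k ↦ hBm _)
  · refine tendsto_pi_nhds.2 fun ω' ↦ h.tendsto_wienerFamily hW hI hε
      (fun n ↦ hstep n fun k ↦ B (k / n) ω') (hBc ω').measurable fun r ↦ ?_
    refine ((hBc ω').tendsto r).comp ?_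
    exact tendsto_floor_mul_div r

end IsNoiseCovariance

end PathDependence

/-! ### Brownian motion with continuous paths -/

section Brownian

variable {d : ℕ} {Ω' : Type*}

/-- The information carried by a process up to time `m`. -/
abbrev past (B : ℝ≥0 → Ω' → Space d) (m : ℝ≥0) : MeasurableSpace Ω' :=
  MeasurableSpace.comap (fun ω (s : Set.Iic m) ↦ B s ω) inferInstance

lemma measurable_past (B : ℝ≥0 → Ω' → Space d) {s m : ℝ≥0} (hs : s ≤ m) :
    Measurable[past B m] (B s) := by
  have h : Measurable[past B m] fun ω (s : Set.Iic m) ↦ B s ω := comap_measurable _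
  exact (measurable_pi_apply (⟨s, hs⟩ : Set.Iic m)).comp h

lemma past_mono (B : ℝ≥0 → Ω' → Space d) {a m : ℝ≥0} (h : a ≤ m) : past B a ≤ past B m := by
  refine Measurable.comap_le ?_
  exact @measurable_pi_lambda _ _ _ (past B m) _ _ fun s ↦ measurable_past B (s.2.trans h)

variable [mΩ' : MeasurableSpace Ω'] {Q : Measure Ω'}

lemma past_le {B : ℝ≥0 → Ω' → Space d} (hB : ∀ s, Measurable (B s)) (m : ℝ≥0) :
    past B m ≤ mΩ' :=
  (measurable_pi_lambda _ fun s : Set.Iic m ↦ hB s).comap_le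

/-- A Brownian motion all of whose paths are continuous, with the two properties of its increments
that matter here: independence of the past and Gaussian characteristic function. -/
structure IsRegularBrownian (Q : Measure Ω') (B : ℝ≥0 → Ω' → Space d) : Prop where
  measurable : ∀ s, Measurable (B s)
  continuous : ∀ ω, Continuous fun s ↦ B s ω
  indep : ∀ m r, m ≤ r → Indep (past B m)
    (MeasurableSpace.comap (fun ω ↦ B r ω - B m ω) inferInstance) Q
  charFun_sub : ∀ m r, m ≤ r → ∀ ξ : Space d, charFun (Q.map fun ω ↦ B r ω - B m ω) ξ =
    Complex.exp (((-(((r : ℝ) - m) / 2) * ‖ξ‖ ^ 2 : ℝ)) : ℂ)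

lemma iIndepFun_bool {E : Type*} [MeasurableSpace E] [IsProbabilityMeasure Q] {X : Bool → Ω' → E}
    (h : IndepFun (X true) (X false) Q) : iIndepFun X Q := by
  rw [iIndepFun_iff_measure_inter_preimage_eq_mul]
  intro S sets hS
  have h2 := (indepFun_iff_measure_inter_preimage_eq_mul.1 h)
  by_cases ht : true ∈ S <;> by_cases hf : false ∈ S
  · have : S = {true, false} := by ext b; cases b <;> simp [ht, hf]
    subst this
    simp only [Finset.mem_insert, Finset.mem_singleton, Set.iInter_iInter_eq_or_left,
      Set.iInter_iInter_eq_left]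
    rw [Finset.prod_pair (by simp)]
    exact h2 _ _ (hS true ht) (hS false hf)
  · have : S = {true} := by ext b; cases b <;> simp [ht, hf]
    subst this
    simp
  · have : S = {false} := by ext b; cases b <;> simp [ht, hf]
    subst this
    simp
  · have : S = ∅ := by ext b; cases b <;> simp [ht, hf]
    subst this
    simp

/-- Independence of coordinates promotes the weak Markov property from one dimension to `d`. -/
lemma indep_past_increment [IsProbabilityMeasure Q] {B : ℝ≥0 → Ω' → Space d}
    (hm : ∀ s, Measurable (B s)) (hB : ∀ i, IsPreBrownianReal (fun t ω ↦ B t ω i) Q)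
    (hind : iIndepFun (fun (i : Fin d) ω (t : ℝ≥0) ↦ B t ω i) Q) {m r : ℝ≥0} (hmr : m ≤ r) :
    Indep (past B m) (MeasurableSpace.comap (fun ω ↦ B r ω - B m ω) inferInstance) Q := by
  have hc : ∀ s i, Measurable fun ω ↦ B s ω i := fun s i ↦ by
    have := hm s
    fun_prop
  -- past and future of the coordinates, written with a common target space
  let X : Fin d → Bool → Ω' → (Set.Iic m → ℝ) := fun i j ω ↦
    if j then fun s ↦ B s ω i else fun _ ↦ B r ω i - B m ω i
  have hX : ∀ i j, Measurable (X i j) := by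
    rintro i (_ | _)
    · exact measurable_pi_lambda _ fun _ ↦ (hc r i).sub (hc m i)
    · exact measurable_pi_lambda _ fun s ↦ hc s i
  have h1 : iIndepFun (fun i ω ↦ (X i · ω)) Q := by
    refine hind.comp (fun i (z : ℝ≥0 → ℝ) j ↦
      if (j : Bool) then fun s : Set.Iic m ↦ z s else fun _ ↦ z r - z m) fun i ↦ ?_
    refine measurable_pi_lambda _ fun j ↦ ?_
    cases j
    · exact measurable_pi_lambda _ fun _ ↦ (measurable_pi_apply r).sub (measurable_pi_apply m)
    · exact measurable_pi_lambda _ fun s ↦ measurable_pi_apply _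
  have h2 : ∀ i, iIndepFun (X i) Q := by
    intro i
    refine iIndepFun_bool ?_
    have := ((hB i).indepFun_shift m).symm.comp (φ := fun z : Set.Iic m → ℝ ↦ z)
      (ψ := fun (z : ℝ≥0 → ℝ) (_ : Set.Iic m) ↦ z (r - m)) measurable_id
      (measurable_pi_lambda _ fun _ ↦ measurable_pi_apply _)
    simpa [X, Function.comp_def, add_tsub_cancel_of_le hmr] using this
  have h3 := iIndepFun_uncurry' hX h1 h2
  have h4 := h3.indepFun_finset (Finset.univ ×ˢ {true}) (Finset.univ ×ˢ {false})
    (by rw [Finset.disjoint_left]; rintro ⟨i, j⟩; simp) fun p ↦ hX p.1 p.2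
  have mk : ∀ (b : Bool) (i : Fin d), (i, b) ∈ (Finset.univ : Finset (Fin d)) ×ˢ {b} := by simp
  have h5 := h4.comp
    (φ := fun z (s : Set.Iic m) ↦
      (WithLp.toLp 2 fun i : Fin d ↦ z ⟨(i, true), mk true i⟩ s : Space d))
    (ψ := fun z ↦
      (WithLp.toLp 2 fun i : Fin d ↦ z ⟨(i, false), mk false i⟩ ⟨m, Set.mem_Iic.2 le_rfl⟩ : Space d))
    (by fun_prop) (by fun_prop)
  exact h5

/-- The increment of a vector of independent Brownian motions is a centred Gaussian vector with
covariance `(r - s) I`. -/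
lemma charFun_increment [IsProbabilityMeasure Q] {B : ℝ≥0 → Ω' → Space d}
    (hm : ∀ s, Measurable (B s)) (hB : ∀ i, IsPreBrownianReal (fun t ω ↦ B t ω i) Q)
    (hind : iIndepFun (fun (i : Fin d) ω (t : ℝ≥0) ↦ B t ω i) Q) {m r : ℝ≥0} (hmr : m ≤ r)
    (ξ : Space d) : charFun (Q.map fun ω ↦ B r ω - B m ω) ξ =
      Complex.exp (((-(((r : ℝ) - m) / 2) * ‖ξ‖ ^ 2 : ℝ)) : ℂ) := by
  have hc : ∀ s i, Measurable fun ω ↦ B s ω i := fun s i ↦ by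
    have := hm s
    fun_prop
  have h1 : iIndepFun (fun (i : Fin d) ω ↦ B r ω i - B m ω i) Q :=
    hind.comp (fun i (z : ℝ≥0 → ℝ) ↦ z r - z m) fun i ↦ by fun_prop
  have h2 := (iIndepFun_iff_charFun_pi (X := fun i ω ↦ B r ω i - B m ω i)
    (fun i ↦ ((hc r i).sub (hc m i)).aemeasurable)).1 h1 ξ
  have h3 : (fun ω ↦ WithLp.toLp 2 fun i ↦ B r ω i - B m ω i) = fun ω ↦ B r ω - B m ω := rfl
  rw [h3] at h2
  rw [h2]
  have h4 : ∀ i, charFun (Q.map fun ω ↦ B r ω i - B m ω i) (ξ i) =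
      Complex.exp ((-(((r : ℝ) - m) / 2) * (ξ i) ^ 2 : ℝ) : ℂ) := by
    intro i
    have := ((hB i).hasLaw_sub r m).map_eq
    have e : ((fun ω ↦ B r ω i) - fun ω ↦ B m ω i) = fun ω ↦ B r ω i - B m ω i := rfl
    rw [e] at this
    have hv : ∀ v : ℝ≥0, (v : ℝ) = r - m → charFun (gaussianReal 0 v) (ξ i) =
        Complex.exp ((-(((r : ℝ) - m) / 2) * (ξ i) ^ 2 : ℝ) : ℂ) := by
      intro v hv
      rw [charFun_gaussianReal, ← hv]
      congr 1
      push_cast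
      ring
    rw [this]
    refine hv _ ?_
    rw [coe_nndist, Real.dist_eq]
    exact abs_of_nonneg (sub_nonneg.2 (by exact_mod_cast hmr))
  simp_rw [h4]
  rw [← Complex.exp_sum, ← Complex.ofReal_sum, ← Finset.mul_sum, EuclideanSpace.norm_sq_eq]
  simp

/-- A Brownian motion agrees almost surely, at all times, with one having only continuous paths. -/
lemma IsBrownianMotion.exists_regular [IsProbabilityMeasure Q] {B : ℝ≥0 → Ω' → Space d}
    (hB : IsBrownianMotion Q B) :
    ∃ B' : ℝ≥0 → Ω' → Space d, IsRegularBrownian Q B' ∧ ∀ᵐ ω ∂Q, ∀ s, B s ω = B' s ω := by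
  have hae : ∀ s, AEMeasurable (B s) Q := by
    intro s
    have h1 : AEMeasurable (fun ω i ↦ B s ω i) Q :=
      aemeasurable_pi_lambda _ fun i ↦ (hB.coord i).aemeasurable s
    exact (WithLp.measurable_toLp 2 (Fin d → ℝ)).comp_aemeasurable h1
  have hcont : ∀ᵐ ω ∂Q, Continuous fun s ↦ B s ω := by
    filter_upwards [ae_all_iff.2 fun i ↦ (hB.coord i).cont] with ω hω
    have : Continuous fun s i ↦ B s ω i := continuous_pi hω
    exact (PiLp.continuous_toLp 2 _).comp this
  have hgrid : ∀ᵐ ω ∂Q, ∀ k n : ℕ, B (k / n) ω = (hae (k / n)).mk (B (k / n)) ω :=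
    ae_all_iff.2 fun k ↦ ae_all_iff.2 fun n ↦ (hae _).ae_eq_mk
  -- a measurable set of full measure on which the paths are good
  set N := toMeasurable Q {ω | ¬ ((Continuous fun s ↦ B s ω) ∧
    ∀ k n : ℕ, B (k / n) ω = (hae (k / n)).mk (B (k / n)) ω)} with hN
  have hN0 : Q N = 0 := by
    rw [hN, measure_toMeasurable]
    exact hcont.and hgrid
  have hgood : ∀ ω ∉ N, (Continuous fun s ↦ B s ω) ∧
      ∀ k n : ℕ, B (k / n) ω = (hae (k / n)).mk (B (k / n)) ω := fun ω hω ↦ by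
    by_contra hc
    exact hω (subset_toMeasurable _ _ hc)
  set B' : ℝ≥0 → Ω' → Space d := fun s ↦ Nᶜ.indicator (B s) with hB'
  have hNm : MeasurableSet Nᶜ := (measurableSet_toMeasurable _ _).compl
  have hB'1 : ∀ s, ∀ ω ∉ N, B' s ω = B s ω := fun s ω hω ↦ Set.indicator_of_mem hω _
  have hB'0 : ∀ s, ∀ ω ∈ N, B' s ω = 0 := fun s ω hω ↦
    Set.indicator_of_notMem (not_not.2 hω) _
  have heq : ∀ᵐ ω ∂Q, ∀ s, B s ω = B' s ω := by
    filter_upwards [measure_eq_zero_iff_ae_notMem.1 hN0] with ω hω s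
    rw [hB'1 s ω hω]
  have hc : ∀ ω, Continuous fun s ↦ B' s ω := by
    intro ω
    by_cases hω : ω ∈ N
    · have : (fun s ↦ B' s ω) = fun _ ↦ 0 := funext fun s ↦ hB'0 s ω hω
      rw [this]
      exact continuous_const
    · have : (fun s ↦ B' s ω) = fun s ↦ B s ω := funext fun s ↦ hB'1 s ω hω
      rw [this]
      exact (hgood ω hω).1
  have hgm : ∀ k n : ℕ, Measurable (B' (k / n)) := by
    intro k n
    have : B' (k / n) = Nᶜ.indicator ((hae (k / n)).mk (B (k / n))) := by
      ext1 ω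
      by_cases hω : ω ∈ N
      · rw [hB'0 _ _ hω, Set.indicator_of_notMem (not_not.2 hω)]
      · rw [hB'1 _ _ hω, Set.indicator_of_mem (show ω ∈ Nᶜ from hω), (hgood ω hω).2]
    rw [this]
    exact (hae _).measurable_mk.indicator hNm
  have hm : ∀ s, Measurable (B' s) := fun s ↦
    measurable_of_tendsto_metrizable (fun n : ℕ ↦ hgm ⌊s * n⌋₊ n)
      (tendsto_pi_nhds.2 fun ω ↦ ((hc ω).tendsto s).comp (tendsto_floor_mul_div s))
  have hpre : ∀ i, IsPreBrownianReal (fun t ω ↦ B' t ω i) Q := fun i ↦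
    (hB.coord i).toIsPreBrownianReal.congr fun t ↦ by
      filter_upwards [heq] with ω hω
      rw [hω]
  have hind : iIndepFun (fun (i : Fin d) ω (t : ℝ≥0) ↦ B' t ω i) Q :=
    hB.indep.congr fun i ↦ by
      filter_upwards [heq] with ω hω
      ext t
      rw [hω]
  exact ⟨B', ⟨hm, hc, fun m r h ↦ indep_past_increment hm hpre hind h,
    fun m r h ↦ charFun_increment hm hpre hind h⟩, heq⟩

end Brownian

/-! ### The heat flow along Brownian motion -/

section HeatFlow

variable {d : ℕ} {Ω' : Type*} [mΩ' : MeasurableSpace Ω'] {Q : Measure Ω'} [IsProbabilityMeasure Q]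
  {B : ℝ≥0 → Ω' → Space d}

lemma IsRegularBrownian.integral_cos_sin (hB : IsRegularBrownian Q B) {m r : ℝ≥0} (hmr : m ≤ r)
    (ξ : Space d) :
    ∫ ω, Real.cos (inner ℝ (B r ω - B m ω) ξ) ∂Q = Real.exp (-(((r : ℝ) - m) / 2) * ‖ξ‖ ^ 2) ∧
    ∫ ω, Real.sin (inner ℝ (B r ω - B m ω) ξ) ∂Q = 0 := by
  have hm : Measurable fun ω ↦ B r ω - B m ω := (hB.measurable r).sub (hB.measurable m)
  have h := hB.charFun_sub m r hmr ξ
  rw [charFun_apply, integral_map hm.aemeasurable (by fun_prop)] at h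
  have hint : Integrable (fun ω ↦ Complex.exp ((inner ℝ (B r ω - B m ω) ξ : ℝ) * Complex.I)) Q := by
    refine Integrable.of_bound ?_ 1 (ae_of_all _ fun ω ↦ by rw [Complex.norm_exp_ofReal_mul_I])
    have : Continuous fun z : Space d ↦ Complex.exp ((inner ℝ z ξ : ℝ) * Complex.I) := by fun_prop
    exact (this.measurable.comp hm).aestronglyMeasurable
  rw [← Complex.ofReal_exp] at h
  constructor
  · have := congrArg Complex.re h
    rw [Complex.ofReal_re, ← RCLike.re_eq_complex_re, ← integral_re hint] at this
    simpa [Complex.exp_ofReal_mul_I_re] using this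
  · have := congrArg Complex.im h
    rw [Complex.ofReal_im, ← RCLike.im_eq_complex_im, ← integral_im hint] at this
    simpa [Complex.exp_ofReal_mul_I_im] using this

/-- Conditionally on the past, a Gaussian increment multiplies each frequency `ξ` by
`e^{-(r-m)|ξ|²/2}`. The sine term vanishes by symmetry. -/
lemma IsRegularBrownian.integral_mul_cos (hB : IsRegularBrownian Q B) {m r : ℝ≥0} (hmr : m ≤ r)
    {G : Ω' → ℝ} {D : Ω' → Space d} (hG : Measurable[past B m] G) (hD : Measurable[past B m] D)
    {K : ℝ} (hK : ∀ ω, |G ω| ≤ K) (ξ : Space d) :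
    ∫ ω, G ω * Real.cos (inner ℝ (B r ω - B m ω + D ω) ξ) ∂Q =
      Real.exp (-(((r : ℝ) - m) / 2) * ‖ξ‖ ^ 2) * ∫ ω, G ω * Real.cos (inner ℝ (D ω) ξ) ∂Q := by
  have hle := past_le hB.measurable m
  have hm : Measurable fun ω ↦ B r ω - B m ω := (hB.measurable r).sub (hB.measurable m)
  obtain ⟨hcos, hsin⟩ := hB.integral_cos_sin hmr ξ
  have hcosm : Measurable fun z : Space d ↦ Real.cos (inner ℝ z ξ) := by fun_prop
  have hsinm : Measurable fun z : Space d ↦ Real.sin (inner ℝ z ξ) := by fun_prop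
  -- products of a variable of the past and a function of the increment
  have key : ∀ (H : Ω' → ℝ) (f : Space d → ℝ), Measurable[past B m] H → Measurable f →
      ∫ ω, H ω * f (B r ω - B m ω) ∂Q = (∫ ω, H ω ∂Q) * ∫ ω, f (B r ω - B m ω) ∂Q := by
    intro H f hH hf
    have hind : IndepFun H (fun ω ↦ f (B r ω - B m ω)) Q := by
      rw [IndepFun_iff_Indep]
      refine indep_of_indep_of_le_left (indep_of_indep_of_le_right (hB.indep m r hmr) ?_)
        hH.comap_le
      have : (fun ω ↦ f (B r ω - B m ω)) = f ∘ fun ω ↦ B r ω - B m ω := rfl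
      rw [this, ← MeasurableSpace.comap_comp]
      exact MeasurableSpace.comap_mono hf.comap_le
    exact hind.integral_fun_mul_eq_mul_integral (hH.mono hle le_rfl).aestronglyMeasurable
      (hf.comp hm).aestronglyMeasurable
  have hGc : Measurable[past B m] fun ω ↦ G ω * Real.cos (inner ℝ (D ω) ξ) :=
    hG.mul (hcosm.comp hD)
  have hGs : Measurable[past B m] fun ω ↦ G ω * Real.sin (inner ℝ (D ω) ξ) :=
    hG.mul (hsinm.comp hD)
  have hint : ∀ (H : Ω' → ℝ) (f : Space d → ℝ), Measurable[past B m] H → Measurable f →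
      (∀ ω, |H ω| ≤ K) → (∀ z, |f z| ≤ 1) → Integrable (fun ω ↦ H ω * f (B r ω - B m ω)) Q := by
    intro H f hH hf h1 h2
    refine Integrable.of_bound ((hH.mono hle le_rfl).mul (hf.comp hm)).aestronglyMeasurable K
      (ae_of_all _ fun ω ↦ ?_)
    rw [norm_mul]
    calc ‖H ω‖ * ‖f (B r ω - B m ω)‖ ≤ K * 1 :=
          mul_le_mul (h1 ω) (h2 _) (norm_nonneg _) ((abs_nonneg _).trans (h1 ω))
      _ = K := mul_one K
  have hb : ∀ ω (c : ℝ), |c| ≤ 1 → |G ω * c| ≤ K := fun ω c hc ↦ by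
    rw [abs_mul]
    exact (mul_le_of_le_one_right (abs_nonneg _) hc).trans (hK ω)
  calc ∫ ω, G ω * Real.cos (inner ℝ (B r ω - B m ω + D ω) ξ) ∂Q
      = ∫ ω, G ω * Real.cos (inner ℝ (D ω) ξ) * Real.cos (inner ℝ (B r ω - B m ω) ξ) -
          G ω * Real.sin (inner ℝ (D ω) ξ) * Real.sin (inner ℝ (B r ω - B m ω) ξ) ∂Q := by
        refine integral_congr_ae (ae_of_all _ fun ω ↦ ?_)
        dsimp only
        rw [inner_add_left, Real.cos_add]
        ring
    _ = (∫ ω, G ω * Real.cos (inner ℝ (D ω) ξ) * Real.cos (inner ℝ (B r ω - B m ω) ξ) ∂Q) -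
          ∫ ω, G ω * Real.sin (inner ℝ (D ω) ξ) * Real.sin (inner ℝ (B r ω - B m ω) ξ) ∂Q :=
        integral_sub
          (hint _ _ hGc hcosm (fun ω ↦ hb ω _ (Real.abs_cos_le_one _))
            fun z ↦ Real.abs_cos_le_one _)
          (hint _ _ hGs hsinm (fun ω ↦ hb ω _ (Real.abs_sin_le_one _))
            fun z ↦ Real.abs_sin_le_one _)
    _ = _ := by
        rw [key _ _ hGc hcosm, key _ _ hGs hsinm, hcos, hsin]
        ring

variable {γ : ℝ → ℝ} {Λ μ : Measure (Space d)} {β C : ℝ}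

lemma IsNoiseCovariance.integral_mul_mollify (h : IsNoiseCovariance γ Λ μ β C) {ε : ℝ}
    (hε : 0 < ε) {G : Ω' → ℝ} {Z : Ω' → Space d} (hG : Measurable G) (hZ : Measurable Z) {K : ℝ}
    (hK : ∀ ω, |G ω| ≤ K) :
    ∫ ω, G ω * mollify Λ ε (Z ω) ∂Q = ((2 * Real.pi) ^ d)⁻¹ *
      ∫ ξ, Real.exp (-(ε / 2) * ‖ξ‖ ^ 2) * (∫ ω, G ω * Real.cos (inner ℝ (Z ω) ξ) ∂Q) ∂μ := by
  have := h.sigmaFinite_spectral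
  have hm : Measurable fun p : Ω' × Space d ↦
      G p.1 * Real.cos (inner ℝ (Z p.1) p.2) * Real.exp (-(ε / 2) * ‖p.2‖ ^ 2) := by
    have h1 : Measurable fun p : Ω' × Space d ↦ (inner ℝ (Z p.1) p.2 : ℝ) :=
      (hZ.comp measurable_fst).inner measurable_snd
    fun_prop
  have hint : Integrable (fun p : Ω' × Space d ↦
      G p.1 * Real.cos (inner ℝ (Z p.1) p.2) * Real.exp (-(ε / 2) * ‖p.2‖ ^ 2)) (Q.prod μ) := by
    refine (((h.integrable_exp hε).comp_snd Q).const_mul K).mono' hm.aestronglyMeasurable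
      (ae_of_all _ fun p ↦ ?_)
    rw [norm_mul, norm_mul, Real.norm_eq_abs (Real.exp _), Real.abs_exp]
    refine mul_le_mul_of_nonneg_right ?_ (Real.exp_pos _).le
    exact (mul_le_of_le_one_right (norm_nonneg _) (Real.abs_cos_le_one _)).trans (hK _)
  calc ∫ ω, G ω * mollify Λ ε (Z ω) ∂Q
      = ∫ ω, ((2 * Real.pi) ^ d)⁻¹ * (∫ ξ, G ω * Real.cos (inner ℝ (Z ω) ξ) *
          Real.exp (-(ε / 2) * ‖ξ‖ ^ 2) ∂μ) ∂Q := by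
        refine integral_congr_ae (ae_of_all _ fun ω ↦ ?_)
        dsimp only
        rw [mollify_eq_integral_cos h.fourier hε (h.integrable_exp hε), mul_left_comm,
          ← integral_const_mul]
        simp_rw [mul_assoc]
    _ = ((2 * Real.pi) ^ d)⁻¹ * ∫ ξ, ∫ ω, G ω * Real.cos (inner ℝ (Z ω) ξ) *
          Real.exp (-(ε / 2) * ‖ξ‖ ^ 2) ∂Q ∂μ := by
        rw [integral_const_mul, integral_integral_swap hint]
    _ = _ := by
        congr 1
        refine integral_congr_ae (ae_of_all _ fun ξ ↦ ?_)
        dsimp only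
        rw [integral_mul_const, mul_comm]

/-- The increment of a Brownian motion acts on `p_ε * Λ` by the heat flow, also conditionally on the
past. -/
lemma IsNoiseCovariance.integral_mul_mollify_increment (h : IsNoiseCovariance γ Λ μ β C)
    (hB : IsRegularBrownian Q B) {ε : ℝ} (hε : 0 < ε) {m r : ℝ≥0} (hmr : m ≤ r)
    {G : Ω' → ℝ} {D : Ω' → Space d} (hG : Measurable[past B m] G) (hD : Measurable[past B m] D)
    {K : ℝ} (hK : ∀ ω, |G ω| ≤ K) :
    ∫ ω, G ω * mollify Λ ε (B r ω - B m ω + D ω) ∂Q =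
      ∫ ω, G ω * mollify Λ (ε + (r - m)) (D ω) ∂Q := by
  have hle := past_le hB.measurable m
  have hr : (0 : ℝ) ≤ r - m := sub_nonneg.2 (by exact_mod_cast hmr)
  have hG' := hG.mono hle le_rfl
  have hD' := hD.mono hle le_rfl
  have hZ : Measurable fun ω ↦ B r ω - B m ω + D ω :=
    ((hB.measurable r).sub (hB.measurable m)).add hD'
  rw [h.integral_mul_mollify hε hG' hZ hK,
    h.integral_mul_mollify (by positivity) hG' hD' hK]
  congr 1
  refine integral_congr_ae (ae_of_all _ fun ξ ↦ ?_)
  dsimp only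
  rw [hB.integral_mul_cos hmr hG hD hK, ← mul_assoc, ← Real.exp_add]
  congr 2
  ring

/-- Given the past up to `m`, the expectation of `p_ε * Λ` at an increment to time `r`, shifted by any
variable of the past, is at most `peak μ (r - m)`: the bound does not depend on `ε`. -/
lemma IsNoiseCovariance.integral_mul_mollify_increment_le (h : IsNoiseCovariance γ Λ μ β C)
    (hB : IsRegularBrownian Q B) {ε : ℝ} (hε : 0 < ε) {m r : ℝ≥0} (hmr : m < r)
    {G : Ω' → ℝ} {D : Ω' → Space d} (hG : Measurable[past B m] G) (hD : Measurable[past B m] D)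
    (hG0 : ∀ ω, 0 ≤ G ω) {K : ℝ} (hK : ∀ ω, G ω ≤ K) :
    ∫ ω, G ω * mollify Λ ε (B r ω - B m ω + D ω) ∂Q ≤ (∫ ω, G ω ∂Q) * peak μ (r - m) := by
  have hle := past_le hB.measurable m
  have hr : (0 : ℝ) < r - m := sub_pos.2 (by exact_mod_cast hmr)
  have hG' := hG.mono hle le_rfl
  have hD' := hD.mono hle le_rfl
  have hK' : ∀ ω, |G ω| ≤ K := fun ω ↦ by rw [abs_of_nonneg (hG0 ω)]; exact hK ω
  rw [h.integral_mul_mollify_increment hB hε hmr.le hG hD hK', ← integral_mul_const]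
  have hiG : Integrable G Q := Integrable.of_bound hG'.aestronglyMeasurable K (ae_of_all _ hK')
  have hpk : ∀ z, mollify Λ (ε + (r - m)) z ≤ peak μ (r - m) := fun z ↦
    (h.mollify_le (by positivity) z).trans (h.peak_anti hr (by linarith))
  refine integral_mono_of_nonneg (ae_of_all _ fun ω ↦
    mul_nonneg (hG0 ω) (mollify_nonneg Λ (by positivity) _)) (hiG.mul_const _)
    (ae_of_all _ fun ω ↦ mul_le_mul_of_nonneg_left (hpk _) (hG0 ω))

lemma IsNoiseCovariance.integral_mollify_brownian (h : IsNoiseCovariance γ Λ μ β C)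
    (hB : IsRegularBrownian Q B) {ε : ℝ} (hε : 0 < ε) (r s : ℝ≥0) :
    ∫ ω, mollify Λ ε (B r ω - B s ω) ∂Q = peak μ (ε + |(r : ℝ) - s|) := by
  have key : ∀ r s : ℝ≥0, s ≤ r →
      ∫ ω, mollify Λ ε (B r ω - B s ω) ∂Q = peak μ (ε + |(r : ℝ) - s|) := by
    intro r s hsr
    have hr : (0 : ℝ) ≤ r - s := sub_nonneg.2 (by exact_mod_cast hsr)
    have := h.integral_mul_mollify_increment hB hε hsr (G := fun _ ↦ 1) (D := fun _ ↦ 0)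
      measurable_const measurable_const (K := 1) (by simp)
    have hp : 0 < ε + (r - s : ℝ) := by positivity
    simp only [one_mul, add_zero, mollify_zero h.fourier hp (h.integrable_exp hp)] at this
    rw [this, abs_of_nonneg hr]
    simp
  rcases le_total s r with hsr | hsr
  · exact key r s hsr
  · rw [abs_sub_comm, ← key s r hsr]
    refine integral_congr_ae (ae_of_all _ fun ω ↦ ?_)
    dsimp only
    rw [← h.mollify_even hε, neg_sub]

end HeatFlow

/-! ### Regularised self-intersections -/

section Intersection

variable {d : ℕ} {γ : ℝ → ℝ} {Λ μ : Measure (Space d)} {β C : ℝ}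
  {Ω' : Type*} [mΩ' : MeasurableSpace Ω'] {Q : Measure Ω'} {B : ℝ≥0 → Ω' → Space d}

/-- The self-intersection integral `∫₀ᵗ∫₀ᵗ γ(r-s) (p_ε * Λ)(b_r - b_s) dr ds` of a path, written with
the measure `γ(r-s) dr ds`. -/
noncomputable def mollifiedIntersection (γ : ℝ → ℝ) (Λ : Measure (Space d)) (t ε : ℝ)
    (b : ℝ≥0 → Space d) : ℝ :=
  ∫ p, mollify Λ ε (b p.1.toNNReal - b p.2.toNNReal) ∂(timeMeasure γ t)

/-- The Gaussian bound `∫₀ᵗ∫₀ᵗ γ(r-s) peak(ε + |r-s|) dr ds` for the expected self-intersection. -/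
noncomputable def meanIntersection (γ : ℝ → ℝ) (μ : Measure (Space d)) (t ε : ℝ) : ℝ :=
  ∫ p, peak μ (ε + |p.1 - p.2|) ∂(timeMeasure γ t)

lemma selfIntersection_mollify (hγ : IsTimeKernel γ β C) (t ε : ℝ) (b : ℝ≥0 → Space d) :
    selfIntersection γ (fun w ↦ ∫ y, heatKernel d ε (w - y) ∂Λ) t b =
      mollifiedIntersection γ Λ t ε b :=
  (integral_timeMeasure hγ.meas hγ.nonneg t _).symm

lemma IsRegularBrownian.measurable_uncurry (hB : IsRegularBrownian Q B) :
    Measurable fun p : ℝ≥0 × Ω' ↦ B p.1 p.2 :=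
  measurable_uncurry_of_continuous_of_measurable hB.continuous hB.measurable

lemma IsRegularBrownian.measurable_sub (hB : IsRegularBrownian Q B) :
    Measurable fun q : Ω' × (ℝ × ℝ) ↦ B q.2.1.toNNReal q.1 - B q.2.2.toNNReal q.1 := by
  have := hB.measurable_uncurry
  exact (this.comp (f := fun q : Ω' × (ℝ × ℝ) ↦ (q.2.1.toNNReal, q.1)) (by fun_prop)).sub
    (this.comp (f := fun q : Ω' × (ℝ × ℝ) ↦ (q.2.2.toNNReal, q.1)) (by fun_prop))

namespace IsNoiseCovariance

variable (h : IsNoiseCovariance γ Λ μ β C)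
include h

lemma measurable_mollifiedIntersection (hB : IsRegularBrownian Q B) {ε : ℝ} (hε : 0 < ε) (t : ℝ) :
    Measurable fun ω ↦ mollifiedIntersection γ Λ t ε fun s ↦ B s ω := by
  have := h.time.isFiniteMeasure_timeMeasure t
  have hm : Measurable fun q : Ω' × (ℝ × ℝ) ↦
      mollify Λ ε (B q.2.1.toNNReal q.1 - B q.2.2.toNNReal q.1) :=
    (h.continuous_mollify hε).measurable.comp hB.measurable_sub
  exact hm.stronglyMeasurable.integral_prod_right.measurable

lemma mollifiedIntersection_le {ε : ℝ} (hε : 0 < ε) (t : ℝ) (b : ℝ≥0 → Space d) :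
    ‖mollifiedIntersection γ Λ t ε b‖ ≤ peak μ ε * (timeMeasure γ t).real Set.univ :=
  have := h.time.isFiniteMeasure_timeMeasure t
  norm_integral_le_of_norm_le_const (ae_of_all _ fun _ ↦ h.norm_mollify_le hε _)

lemma integrable_mollifiedIntersection [IsProbabilityMeasure Q] (hB : IsRegularBrownian Q B) {ε : ℝ}
    (hε : 0 < ε) (t : ℝ) :
    Integrable (fun ω ↦ mollifiedIntersection γ Λ t ε fun s ↦ B s ω) Q :=
  Integrable.of_bound (h.measurable_mollifiedIntersection hB hε t).aestronglyMeasurable _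
    (ae_of_all _ fun _ ↦ h.mollifiedIntersection_le hε t _)

lemma integral_mollifiedIntersection [IsProbabilityMeasure Q] (hB : IsRegularBrownian Q B) {ε : ℝ}
    (hε : 0 < ε) (t : ℝ) :
    ∫ ω, mollifiedIntersection γ Λ t ε (fun s ↦ B s ω) ∂Q = meanIntersection γ μ t ε := by
  have := h.time.isFiniteMeasure_timeMeasure t
  have hm : Measurable fun q : Ω' × (ℝ × ℝ) ↦
      mollify Λ ε (B q.2.1.toNNReal q.1 - B q.2.2.toNNReal q.1) :=
    (h.continuous_mollify hε).measurable.comp hB.measurable_sub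
  unfold mollifiedIntersection
  rw [integral_integral_swap (Integrable.of_bound hm.aestronglyMeasurable _
    (ae_of_all _ fun q ↦ h.norm_mollify_le hε _)), meanIntersection]
  refine integral_congr_ae ?_
  filter_upwards [ae_timeMeasure_mem t] with p hp
  rw [h.integral_mollify_brownian hB hε, Real.coe_toNNReal _ hp.1.1, Real.coe_toNNReal _ hp.2.1]

/-- The expected self-intersections converge, dominated by the integrable function
`peak μ |r - s|`. -/
lemma tendsto_meanIntersection (t : ℝ) :
    Tendsto (meanIntersection γ μ t) (𝓝[>] 0) (𝓝 (meanIntersection γ μ t 0)) := by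
  have hc := continuousOn_peak h.exponent_nonneg h.exponent_le_two h.spectral
  refine tendsto_integral_filter_of_dominated_convergence (fun p ↦ peak μ |p.1 - p.2|) ?_ ?_
    (integrable_peak_timeMeasure h t) ?_
  · filter_upwards [self_mem_nhdsWithin] with ε hε
    exact (h.measurable_peak.comp (by fun_prop)).aestronglyMeasurable
  · filter_upwards [self_mem_nhdsWithin] with ε hε
    filter_upwards [ae_timeMeasure_ne t] with p hp
    rw [Real.norm_eq_abs, abs_of_nonneg (peak_nonneg _ _)]
    exact h.peak_anti (abs_pos.2 (sub_ne_zero.2 hp)) (by have : (0:ℝ) < ε := hε; linarith)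
  · filter_upwards [ae_timeMeasure_ne t] with p hp
    have h1 : 0 < |p.1 - p.2| := abs_pos.2 (sub_ne_zero.2 hp)
    have h2 : ContinuousAt (peak μ) (0 + |p.1 - p.2|) :=
      hc.continuousAt (by rw [zero_add]; exact Ioi_mem_nhds h1)
    refine (ContinuousAt.comp (f := fun ε ↦ ε + |p.1 - p.2|) h2 (by fun_prop)).tendsto.mono_left
      nhdsWithin_le_nhds

end IsNoiseCovariance

end Intersection

/-! ### Regularised functionals on the product space -/

section Limit

variable {d : ℕ} {γ : ℝ → ℝ} {Λ μ : Measure (Space d)} {β C : ℝ}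
  {Ω Ω' : Type*} [MeasurableSpace Ω] [MeasurableSpace Ω'] {P : Measure Ω} {Q : Measure Ω'}
  [IsProbabilityMeasure P] [IsProbabilityMeasure Q]
  {W : SpaceTimeTest d → Ω → ℝ} {B : ℝ≥0 → Ω' → Space d}

/-- Convergence in `L²` of the product implies convergence in `L¹` of the conditional second
moments, by Cauchy–Schwarz for `z² - v² = (z - v)((z - v) + 2v)`. -/
lemma tendsto_eLpNorm_integral_sq {ι : Type*} {l : Filter ι} {Z : ι → Ω × Ω' → ℝ} {V : Ω × Ω' → ℝ}
    (hZ : ∀ i, MemLp (Z i) 2 (P.prod Q)) (hV : MemLp V 2 (P.prod Q))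
    (h : Tendsto (fun i ↦ eLpNorm (fun p ↦ Z i p - V p) 2 (P.prod Q)) l (𝓝 0)) :
    Tendsto (fun i ↦ eLpNorm (fun ω' ↦ (∫ ω, Z i (ω, ω') * Z i (ω, ω') ∂P) -
      ∫ ω, V (ω, ω') * V (ω, ω') ∂P) 1 Q) l (𝓝 0) := by
  have hle : ∀ i, eLpNorm (fun ω' ↦ (∫ ω, Z i (ω, ω') * Z i (ω, ω') ∂P) -
      ∫ ω, V (ω, ω') * V (ω, ω') ∂P) 1 Q ≤ eLpNorm (fun p ↦ Z i p - V p) 2 (P.prod Q) *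
        (eLpNorm (fun p ↦ Z i p - V p) 2 (P.prod Q) + 2 * eLpNorm V 2 (P.prod Q)) := by
    intro i
    have hd : MemLp (fun p ↦ Z i p - V p) 2 (P.prod Q) := (hZ i).sub hV
    have i1 : Integrable (fun p ↦ Z i p * Z i p) (P.prod Q) := (hZ i).integrable_mul (hZ i)
    have i2 : Integrable (fun p ↦ V p * V p) (P.prod Q) := hV.integrable_mul hV
    have hV2 : AEStronglyMeasurable (fun p ↦ 2 * V p) (P.prod Q) :=
      hV.aestronglyMeasurable.const_mul 2
    have i3 := (i1.sub i2).aestronglyMeasurable.enorm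
    calc _ ≤ ∫⁻ ω', ∫⁻ ω, ‖Z i (ω, ω') * Z i (ω, ω') - V (ω, ω') * V (ω, ω')‖ₑ ∂P ∂Q := by
          rw [eLpNorm_one_eq_lintegral_enorm]
          refine lintegral_mono_ae ?_
          filter_upwards [i1.prod_left_ae, i2.prod_left_ae] with ω' h1 h2
          rw [← integral_sub h1 h2]
          exact enorm_integral_le_lintegral_enorm _
      _ = eLpNorm (fun p ↦ (Z i p - V p) * ((Z i p - V p) + 2 * V p)) 1 (P.prod Q) := by
          rw [eLpNorm_one_eq_lintegral_enorm]
          refine (lintegral_prod_symm _ i3).symm.trans (lintegral_congr fun p ↦ congrArg _ ?_)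
          simp only [Pi.sub_apply]
          ring
      _ ≤ eLpNorm (fun p ↦ Z i p - V p) 2 (P.prod Q) *
            eLpNorm (fun p ↦ (Z i p - V p) + 2 * V p) 2 (P.prod Q) := by
          exact eLpNorm_smul_le_mul_eLpNorm (p := 2) (q := 2) (r := 1)
            (f := fun p ↦ (Z i p - V p) + 2 * V p) (φ := fun p ↦ Z i p - V p)
            (hd.aestronglyMeasurable.add hV2) hd.aestronglyMeasurable
      _ ≤ _ := by
          gcongr
          refine (eLpNorm_add_le (f := fun p ↦ Z i p - V p) (g := fun p ↦ 2 * V p)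
            hd.aestronglyMeasurable hV2 (by norm_num)).trans ?_
          gcongr
          have := eLpNorm_const_smul (2 : ℝ) V 2 (P.prod Q)
          rw [Real.enorm_eq_ofReal (by norm_num), ENNReal.ofReal_ofNat] at this
          exact le_of_eq this
  refine tendsto_of_tendsto_of_tendsto_of_le_of_le tendsto_const_nhds ?_ (fun _ ↦ zero_le) hle
  have h2 : Tendsto (fun i ↦ eLpNorm (fun p ↦ Z i p - V p) 2 (P.prod Q) +
      2 * eLpNorm V 2 (P.prod Q)) l (𝓝 (0 + 2 * eLpNorm V 2 (P.prod Q))) :=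
    h.add tendsto_const_nhds
  have h3 := ENNReal.Tendsto.mul h (.inr ?_) h2 (.inr ENNReal.zero_ne_top)
  · simpa using h3
  · rw [zero_add]
    exact ENNReal.mul_ne_top (by simp) hV.2.ne

namespace IsNoiseCovariance

variable (h : IsNoiseCovariance γ Λ μ β C) (hW : IsGaussianNoise P γ Λ W)
  (hB : IsRegularBrownian Q B) {t : ℝ} {x : Space d} {I : ℝ → (ℝ≥0 → Space d) → Lp ℝ 2 P}
  (hI : IsWienerFamily P γ Λ W t x I)
include h hW hB hI

/-- A jointly measurable version of the path-by-path Wiener integral. -/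
lemma exists_joint_wiener {ε : ℝ} (hε : 0 < ε) :
    ∃ Y : Ω × Ω' → ℝ, MemLp Y 2 (P.prod Q) ∧
      ∀ᵐ ω' ∂Q, (fun ω ↦ Y (ω, ω')) =ᵐ[P] I ε (fun s ↦ B s ω') := by
  obtain ⟨M, hM⟩ := h.norm_wienerFamily_le hW hI hε
  exact exists_joint_version
    (h.stronglyMeasurable_wienerFamily hW hI hε hB.measurable hB.continuous)
    fun ω' ↦ hM _ (hB.continuous ω').measurable

omit [IsProbabilityMeasure P] [IsProbabilityMeasure Q] in
/-- Wiener integrals being unique, being a regularised functional means agreeing with the chosen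
family along almost every path. -/
lemma isRegularized_iff {ε : ℝ} (hε : 0 < ε) (V : Ω × Ω' → ℝ) :
    IsRegularized P Q γ Λ W B ε t x V ↔ AEStronglyMeasurable V (P.prod Q) ∧
      ∀ᵐ ω' ∂Q, (fun ω ↦ V (ω, ω')) =ᵐ[P] I ε (fun s ↦ B s ω') := by
  have := h.sigmaFinite
  refine and_congr_right fun _ ↦ eventually_congr (ae_of_all _ fun ω' ↦ ?_)
  have hb : Measurable fun s ↦ B s ω' := (hB.continuous ω').measurable
  have hk := measurable_kernelA ε t x hb
  rw [isWienerIntegral_iff h.time.meas hk]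
  exact ⟨fun hY ↦ (h.isIsonormal hW).ae_eq (h.isPosDefPair hW) hk
    (h.energy_kernelA_lt_top hε t x hb) hY (hI ε _ hε hb), fun e ↦ (hI ε _ hε hb).congr e.symm⟩

omit [IsProbabilityMeasure P] [IsProbabilityMeasure Q] in
lemma norm_sub_sq_wienerFamily {ε η : ℝ} (hε : 0 < ε) (hη : 0 < η) (ω' : Ω') :
    ‖I ε (fun s ↦ B s ω') - I η (fun s ↦ B s ω')‖ ^ 2 =
      mollifiedIntersection γ Λ t (ε + ε) (fun s ↦ B s ω') -
        2 * mollifiedIntersection γ Λ t (ε + η) (fun s ↦ B s ω') +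
        mollifiedIntersection γ Λ t (η + η) (fun s ↦ B s ω') := by
  have hb : Measurable fun s ↦ B s ω' := (hB.continuous ω').measurable
  rw [norm_sub_sq_real, ← real_inner_self_eq_norm_sq, ← real_inner_self_eq_norm_sq,
    h.inner_wienerFamily hW hI hε hε hb hb, h.inner_wienerFamily hW hI hε hη hb hb,
    h.inner_wienerFamily hW hI hη hη hb hb]
  rfl

/-- The `L²` distance of two regularisations, computed from the expected self-intersections. -/
lemma dist_sq_toLp {ε η : ℝ} (hε : 0 < ε) (hη : 0 < η) {Y Z : Ω × Ω' → ℝ}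
    (hY : MemLp Y 2 (P.prod Q)) (hZ : MemLp Z 2 (P.prod Q))
    (hYI : ∀ᵐ ω' ∂Q, (fun ω ↦ Y (ω, ω')) =ᵐ[P] I ε (fun s ↦ B s ω'))
    (hZI : ∀ᵐ ω' ∂Q, (fun ω ↦ Z (ω, ω')) =ᵐ[P] I η (fun s ↦ B s ω')) :
    dist hY.toLp hZ.toLp ^ 2 = meanIntersection γ μ t (ε + ε) -
      2 * meanIntersection γ μ t (ε + η) + meanIntersection γ μ t (η + η) := by
  have hd : AEStronglyMeasurable (fun p ↦ Y p - Z p) (P.prod Q) := (hY.sub hZ).aestronglyMeasurable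
  have hint : ∀ {ε : ℝ}, 0 < ε →
      Integrable (fun ω ↦ mollifiedIntersection γ Λ t ε fun s ↦ B s ω) Q :=
    fun hε ↦ h.integrable_mollifiedIntersection hB hε t
  have hεε : 0 < ε + ε := by positivity
  have hεη : 0 < ε + η := by positivity
  have hηη : 0 < η + η := by positivity
  have hi1 : Integrable (fun ω' ↦ mollifiedIntersection γ Λ t (ε + ε) (fun s ↦ B s ω') -
        2 * mollifiedIntersection γ Λ t (ε + η) (fun s ↦ B s ω')) Q :=
    (hint hεε).sub ((hint hεη).const_mul 2)
  have hi2 : Integrable (fun ω' ↦ mollifiedIntersection γ Λ t (ε + ε) (fun s ↦ B s ω') -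
        2 * mollifiedIntersection γ Λ t (ε + η) (fun s ↦ B s ω') +
        mollifiedIntersection γ Λ t (η + η) (fun s ↦ B s ω')) Q :=
    hi1.add (hint hηη)
  have hpos : ∀ ω', 0 ≤ mollifiedIntersection γ Λ t (ε + ε) (fun s ↦ B s ω') -
        2 * mollifiedIntersection γ Λ t (ε + η) (fun s ↦ B s ω') +
        mollifiedIntersection γ Λ t (η + η) (fun s ↦ B s ω') := fun ω' ↦ by
    rw [← h.norm_sub_sq_wienerFamily hW hB hI hε hη]
    positivity
  have e1 : eLpNorm (fun p ↦ Y p - Z p) 2 (P.prod Q) ^ 2 =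
      ENNReal.ofReal (meanIntersection γ μ t (ε + ε) -
      2 * meanIntersection γ μ t (ε + η) + meanIntersection γ μ t (η + η)) := by
    rw [← h.integral_mollifiedIntersection hB hεε, ← h.integral_mollifiedIntersection hB hεη,
      ← h.integral_mollifiedIntersection hB hηη, ← integral_const_mul,
      ← integral_sub (hint hεε) ((hint hεη).const_mul 2), ← integral_add hi1 (hint hηη),
      ofReal_integral_eq_lintegral_ofReal hi2 (ae_of_all _ hpos),
      eLpNorm_two_sq_prod hd]
    refine lintegral_congr_ae ?_
    filter_upwards [hYI, hZI] with ω' h1 h2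
    rw [← h.norm_sub_sq_wienerFamily hW hB hI hε hη, ENNReal.ofReal_pow (norm_nonneg _),
      ofReal_norm, Lp.enorm_def, eLpNorm_congr_ae (Lp.coeFn_sub _ _)]
    exact congrArg (· ^ 2) (eLpNorm_congr_ae (h1.sub h2))
  have e2 : dist hY.toLp hZ.toLp = (eLpNorm (fun p ↦ Y p - Z p) 2 (P.prod Q)).toReal := by
    rw [Lp.dist_def, eLpNorm_congr_ae (hY.coeFn_toLp.sub hZ.coeFn_toLp)]
    rfl
  rw [e2, ← ENNReal.toReal_pow, e1, ENNReal.toReal_ofReal]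
  rw [← h.integral_mollifiedIntersection hB hεε, ← h.integral_mollifiedIntersection hB hεη,
    ← h.integral_mollifiedIntersection hB hηη, ← integral_const_mul,
    ← integral_sub (hint hεε) ((hint hεη).const_mul 2), ← integral_add hi1 (hint hηη)]
  exact integral_nonneg hpos

end IsNoiseCovariance

end Limit

/-! ### The limiting functional -/

section LimitTheorem

variable {d : ℕ} {γ : ℝ → ℝ} {Λ μ : Measure (Space d)} {β C : ℝ}
  {Ω Ω' : Type*} [MeasurableSpace Ω] [MeasurableSpace Ω'] {P : Measure Ω} {Q : Measure Ω'}
  [IsProbabilityMeasure P] [IsProbabilityMeasure Q]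
  {W : SpaceTimeTest d → Ω → ℝ} {B : ℝ≥0 → Ω' → Space d}

lemma tendsto_add_nhdsGT_zero {ι : Type*} {l : Filter ι} {f g : ι → ℝ}
    (hf : Tendsto f l (𝓝[>] 0)) (hg : Tendsto g l (𝓝[>] 0)) :
    Tendsto (fun i ↦ f i + g i) l (𝓝[>] 0) := by
  rw [tendsto_nhdsWithin_iff] at *
  refine ⟨by simpa using hf.1.add hg.1, ?_⟩
  filter_upwards [hf.2, hg.2] with i h1 h2
  exact add_pos (Set.mem_Ioi.1 h1) (Set.mem_Ioi.1 h2)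

/-- Existence of the regularised functionals. -/
lemma IsNoiseCovariance.exists_isRegularized (h : IsNoiseCovariance γ Λ μ β C)
    (hW : IsGaussianNoise P γ Λ W) (hB : IsRegularBrownian Q B) {ε : ℝ} (hε : 0 < ε) (t : ℝ)
    (x : Space d) :
    ∃ Y : Ω × Ω' → ℝ, IsRegularized P Q γ Λ W B ε t x Y ∧ MemLp Y 2 (P.prod Q) := by
  obtain ⟨I, hI⟩ := h.exists_isWienerFamily hW t x
  obtain ⟨Y, hY, hYI⟩ := h.exists_joint_wiener hW hB hI hε
  exact ⟨Y, (h.isRegularized_iff hW hB hI hε Y).2 ⟨hY.aestronglyMeasurable, hYI⟩, hY⟩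

/-- The regularised functionals converge in `L²`. Conditionally on the Brownian motion the limit is
centred Gaussian, with variance the renormalised self-intersection integral. -/
theorem IsNoiseCovariance.exists_limit (h : IsNoiseCovariance γ Λ μ β C)
    (hW : IsGaussianNoise P γ Λ W) (hB : IsRegularBrownian Q B) (t : ℝ) (x : Space d) :
    ∃ V : Ω × Ω' → ℝ, MemLp V 2 (P.prod Q) ∧
      (∀ Vε : ℝ → Ω × Ω' → ℝ,
        (∀ ε : ℝ, 0 < ε → IsRegularized P Q γ Λ W B ε t x (Vε ε)) →
        Tendsto (fun ε : ℝ ↦ eLpNorm (fun p ↦ Vε ε p - V p) 2 (P.prod Q)) (𝓝[>] 0) (𝓝 0)) ∧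
      ∃ σ2 : Ω' → ℝ, IsSelfIntersection Q γ Λ B t σ2 ∧
        ∀ᵐ ω' ∂Q, 0 ≤ σ2 ω' ∧
          P.map (fun ω ↦ V (ω, ω')) = gaussianReal 0 (σ2 ω').toNNReal := by
  obtain ⟨I, hI⟩ := h.exists_isWienerFamily hW t x
  -- a regularised functional for every `ε`, extended by `0` to `ε ≤ 0`
  have hex : ∀ ε : ℝ, ∃ Y : Ω × Ω' → ℝ, MemLp Y 2 (P.prod Q) ∧ (0 < ε →
      ∀ᵐ ω' ∂Q, (fun ω ↦ Y (ω, ω')) =ᵐ[P] I ε (fun s ↦ B s ω')) := by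
    intro ε
    by_cases hε : 0 < ε
    · obtain ⟨Y, hY, hYI⟩ := h.exists_joint_wiener hW hB hI hε
      exact ⟨Y, hY, fun _ ↦ hYI⟩
    · exact ⟨0, MemLp.zero, fun h ↦ absurd h hε⟩
  choose Y hY hYI using hex
  have hm := h.tendsto_meanIntersection t
  set l : Filter ℝ := 𝓝[>] 0 with hl
  have hcau : Cauchy (map (fun ε ↦ (hY ε).toLp) l) := by
    rw [cauchy_map_iff]
    refine ⟨inferInstance, ?_⟩
    rw [Metric.uniformity_eq_comap_nhds_zero, tendsto_comap_iff]
    have hfst : Tendsto Prod.fst (l ×ˢ l) l := tendsto_fst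
    have hsnd : Tendsto Prod.snd (l ×ˢ l) l := tendsto_snd
    have l1 := ((hm.comp (tendsto_add_nhdsGT_zero hfst hfst)).sub
      ((hm.comp (tendsto_add_nhdsGT_zero hfst hsnd)).const_mul 2)).add
      (hm.comp (tendsto_add_nhdsGT_zero hsnd hsnd))
    have l2 : Tendsto (fun p : ℝ × ℝ ↦ dist (hY p.1).toLp (hY p.2).toLp ^ 2) (l ×ˢ l) (𝓝 0) := by
      have e0 : meanIntersection γ μ t 0 - 2 * meanIntersection γ μ t 0 +
          meanIntersection γ μ t 0 = 0 := by ring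
      rw [e0] at l1
      refine l1.congr' ?_
      filter_upwards [hfst self_mem_nhdsWithin, hsnd self_mem_nhdsWithin] with p h1 h2
      exact (h.dist_sq_toLp hW hB hI h1 h2 _ _ (hYI _ h1) (hYI _ h2)).symm
    have l3 := l2.sqrt
    simpa [Real.sqrt_sq dist_nonneg, Function.comp_def] using l3
  obtain ⟨V, hV⟩ := CompleteSpace.complete hcau
  have hV2 : MemLp V 2 (P.prod Q) := Lp.memLp V
  have hYV : Tendsto (fun ε ↦ eLpNorm (fun p ↦ Y ε p - V p) 2 (P.prod Q)) l (𝓝 0) := by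
    have h1 : Tendsto (fun ε ↦ (hY ε).toLp) l (𝓝 hV2.toLp) := by
      rw [Lp.toLp_coeFn]
      exact hV
    exact (Lp.tendsto_Lp_iff_tendsto_eLpNorm'' _ hY _ hV2).1 h1
  refine ⟨V, hV2, fun Vε hVε ↦ hYV.congr' ?_,
    fun ω' ↦ ∫ ω, V (ω, ω') * V (ω, ω') ∂P, ⟨?_, ?_⟩, ?_⟩
  · filter_upwards [self_mem_nhdsWithin] with ε hε
    obtain ⟨h1, h2⟩ := (h.isRegularized_iff hW hB hI hε _).1 (hVε ε hε)
    have h3 : Y ε =ᵐ[P.prod Q] Vε ε := by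
      refine ae_eq_prod_of_slices (hY ε).aestronglyMeasurable h1 ?_
      filter_upwards [hYI ε hε, h2] with ω' e1 e2 using e1.trans e2.symm
    exact eLpNorm_congr_ae (h3.sub (ae_eq_refl _))
  · exact (hV2.integrable_mul hV2).integral_prod_right
  · -- the conditional variance of the regularisation at `ε / 2` is the self-intersection at `ε`
    have h1 := tendsto_eLpNorm_integral_sq hY hV2 hYV
    have h2 : Tendsto (fun ε : ℝ ↦ ε / 2) l l := by
      rw [hl, tendsto_nhdsWithin_iff]
      constructor
      · have : Tendsto (fun ε : ℝ ↦ ε / 2) (𝓝 0) (𝓝 (0 / 2)) :=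
          (continuous_id.div_const 2).tendsto 0
        rw [zero_div] at this
        exact this.mono_left nhdsWithin_le_nhds
      · filter_upwards [self_mem_nhdsWithin] with ε hε
        exact half_pos (Set.mem_Ioi.1 hε)
    refine (h1.comp h2).congr' ?_
    filter_upwards [self_mem_nhdsWithin] with ε hε
    refine eLpNorm_congr_ae ?_
    filter_upwards [hYI (ε / 2) (half_pos hε)] with ω' hω'
    have hb : Measurable fun s ↦ B s ω' := (hB.continuous ω').measurable
    rw [selfIntersection_mollify h.time]
    congr 1
    calc ∫ ω, Y (ε / 2) (ω, ω') * Y (ε / 2) (ω, ω') ∂P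
        = ∫ ω, I (ε / 2) (fun s ↦ B s ω') ω * I (ε / 2) (fun s ↦ B s ω') ω ∂P := by
          refine integral_congr_ae ?_
          filter_upwards [hω'] with ω hω
          rw [hω]
      _ = _ := by
          rw [integral_mul_eq_inner_toLp (Lp.memLp _) (Lp.memLp _), Lp.toLp_coeFn,
            h.inner_wienerFamily hW hI (half_pos hε) (half_pos hε) hb hb, add_halves]
          rfl
  · have h0 : Tendsto (fun n : ℕ ↦ 1 / ((n : ℝ) + 1)) atTop l := by
      rw [hl, tendsto_nhdsWithin_iff]
      exact ⟨tendsto_one_div_add_atTop_nhds_zero_nat, Eventually.of_forall fun n ↦ by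
        simp only [Set.mem_Ioi]; positivity⟩
    obtain ⟨ns, -, hns⟩ := exists_subseq_tendsto_slices
      (fun n ↦ ((hY (1 / ((n : ℝ) + 1))).sub hV2).aestronglyMeasurable) (hYV.comp h0)
    have hall : ∀ᵐ ω' ∂Q, ∀ n : ℕ, (fun ω ↦ Y (1 / ((n : ℝ) + 1)) (ω, ω')) =ᵐ[P]
        I (1 / ((n : ℝ) + 1)) (fun s ↦ B s ω') :=
      ae_all_iff.2 fun n ↦ hYI _ (by positivity)
    have hV2' : ∀ᵐ ω' ∂Q, MemLp (fun ω ↦ V (ω, ω')) 2 P := by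
      have i2 : Integrable (fun p ↦ V p ^ 2) (P.prod Q) := hV2.integrable_sq
      filter_upwards [i2.prod_left_ae] with ω' hω'
      exact (memLp_two_iff_integrable_sq
        ((Lp.stronglyMeasurable V).aestronglyMeasurable.comp_measurable
        measurable_prodMk_right)).2 hω'
    filter_upwards [hns, hall, hV2'] with ω' h1 h2 h3
    have hb : Measurable fun s ↦ B s ω' := (hB.continuous ω').measurable
    refine ⟨integral_nonneg fun ω ↦ mul_self_nonneg _, ?_⟩
    have hE : ∀ n : ℕ, IsEnergyLimit P (covMeasure γ Λ) W
        (kernelA (1 / ((n : ℝ) + 1)) t x fun s ↦ B s ω')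
        (fun ω ↦ Y (1 / ((n : ℝ) + 1)) (ω, ω')) := fun n ↦
      (hI _ _ (by positivity) hb).congr (h2 n).symm
    exact map_eq_gaussianReal_of_tendsto_eLpNorm (fun k ↦ (hE (ns k)).1) h3
      (fun k ↦ (h.isIsonormal hW).map_eq_gaussianReal (hE (ns k))) h1

end LimitTheorem

/-! ### Khas'minskii's lemma -/

section Khasminskii

variable {Ω' : Type*} [mΩ' : MeasurableSpace Ω'] {Q : Measure Ω'} [IsProbabilityMeasure Q]

/-- The exponential of `∫ a`, expanded at the smallest time: the identity behind the iteration in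
Khas'minskii's lemma. -/
lemma exp_integral_eq {a : ℝ → ℝ} (ha : Continuous a) (lam r T : ℝ) :
    Real.exp (lam * ∫ v in r..T, a v) =
      1 + ∫ u in r..T, lam * a u * Real.exp (lam * ∫ v in u..T, a v) := by
  have hA : ∀ u, HasDerivAt (fun u ↦ ∫ v in u..T, a v) (-a u) u := fun u ↦
    intervalIntegral.integral_hasDerivAt_left (ha.intervalIntegrable _ _)
      ha.stronglyMeasurable.stronglyMeasurableAtFilter ha.continuousAt
  have hAc : Continuous fun u ↦ ∫ v in u..T, a v :=
    continuous_iff_continuousAt.2 fun u ↦ (hA u).continuousAt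
  have hE : ∀ u ∈ Set.uIcc r T, HasDerivAt (fun u ↦ Real.exp (lam * ∫ v in u..T, a v))
      (-(lam * a u * Real.exp (lam * ∫ v in u..T, a v))) u := fun u _ ↦ by
    convert ((hA u).const_mul lam).exp using 1
    ring
  have h1 := intervalIntegral.integral_eq_sub_of_hasDerivAt hE
    (Continuous.intervalIntegrable (by fun_prop) _ _)
  rw [intervalIntegral.integral_neg, intervalIntegral.integral_same, mul_zero, Real.exp_zero] at h1
  linarith

/-- Khas'minskii's lemma: if, given the past up to time `r`, the expectation of `a u` is at most
`g (u - r)`, then the exponential moment of `∫ a` is controlled by `g` alone. The bound follows by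
iterating `M ↦ 1 + M / 2` on the constant in `E[G exp(λ ∫_r^T a)] ≤ M e^{κ(T-r)} E[G]`. -/
lemma integral_exp_le_of_conditional_bound {ℱ : ℝ → MeasurableSpace Ω'} (hle : ∀ u, ℱ u ≤ mΩ')
    (hmono : ∀ r u, r ≤ u → ℱ r ≤ ℱ u) {a : ℝ → Ω' → ℝ} (had : ∀ u, Measurable[ℱ u] (a u))
    (hc : ∀ ω, Continuous fun u ↦ a u ω) {K : ℝ} (ha0 : ∀ u ω, 0 ≤ a u ω)
    (haK : ∀ u ω, a u ω ≤ K) {g : ℝ → ℝ} {T lam κ : ℝ} (hT : 0 ≤ T)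
    (hg : IntegrableOn g (Set.Ioc 0 T)) (hg0 : ∀ u, 0 ≤ g u) (hlam : 0 ≤ lam) (hκ : 0 ≤ κ)
    (hbound : ∀ r u, 0 ≤ r → r < u → u ≤ T → ∀ G : Ω' → ℝ, Measurable[ℱ r] G → (∀ ω, 0 ≤ G ω) →
      ∀ L, (∀ ω, G ω ≤ L) → ∫ ω, G ω * a u ω ∂Q ≤ (∫ ω, G ω ∂Q) * g (u - r))
    (hsmall : lam * ∫ v in Set.Ioc 0 T, Real.exp (-κ * v) * g v ≤ 1 / 2) :
    ∫ ω, Real.exp (lam * ∫ v in (0 : ℝ)..T, a v ω) ∂Q ≤ 2 * Real.exp (κ * T) := by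
  have ham : ∀ u, Measurable (a u) := fun u ↦ (had u).mono (hle u) le_rfl
  have hjoint : Measurable fun p : ℝ × Ω' ↦ a p.1 p.2 :=
    measurable_uncurry_of_continuous_of_measurable hc ham
  have hK : 0 ≤ K := by
    obtain ⟨ω⟩ := nonempty_of_isProbabilityMeasure Q
    exact (ha0 0 ω).trans (haK 0 ω)
  -- the integral over the remaining time interval `[u, T]`
  set A : ℝ → Ω' → ℝ := fun u ω ↦ ∫ v in u..T, a v ω with hA
  have hAc : ∀ ω, Continuous fun u ↦ A u ω := fun ω ↦
    continuous_iff_continuousAt.2 fun u ↦ (intervalIntegral.integral_hasDerivAt_left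
      ((hc ω).intervalIntegrable _ _) (hc ω).stronglyMeasurable.stronglyMeasurableAtFilter
      (hc ω).continuousAt).continuousAt
  have hAm : ∀ u, Measurable (A u) := by
    intro u
    have hsm : StronglyMeasurable fun p : Ω' × ℝ ↦ a p.2 p.1 :=
      (hjoint.comp measurable_swap).stronglyMeasurable
    simp only [hA, intervalIntegral]
    exact (hsm.integral_prod_right.sub hsm.integral_prod_right).measurable
  have hAj : Measurable fun p : ℝ × Ω' ↦ A p.1 p.2 :=
    measurable_uncurry_of_continuous_of_measurable hAc hAm
  have hA0 : ∀ u ω, u ≤ T → 0 ≤ A u ω := fun u ω hu ↦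
    intervalIntegral.integral_nonneg hu fun v _ ↦ ha0 v ω
  have hAK : ∀ u ω, 0 ≤ u → u ≤ T → A u ω ≤ K * T := by
    intro u ω hu0 hu
    calc A u ω ≤ ∫ v in u..T, K := intervalIntegral.integral_mono_on hu
          ((hc ω).intervalIntegrable _ _) (by simp) fun v _ ↦ haK v ω
      _ = (T - u) * K := by simp
      _ ≤ K * T := by nlinarith
  have hexpK : ∀ u ω, 0 ≤ u → u ≤ T → Real.exp (lam * A u ω) ≤ Real.exp (lam * (K * T)) :=
    fun u ω h1 h2 ↦ Real.exp_le_exp.2 (mul_le_mul_of_nonneg_left (hAK u ω h1 h2) hlam)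
  -- the bound with constant `M`, for all starting times and all weights `G` of the past at once
  let Claim : ℝ → Prop := fun M ↦ ∀ r, 0 ≤ r → r ≤ T → ∀ G : Ω' → ℝ, Measurable[ℱ r] G →
    (∀ ω, 0 ≤ G ω) → ∀ L, (∀ ω, G ω ≤ L) →
      ∫ ω, G ω * Real.exp (lam * A r ω) ∂Q ≤ M * Real.exp (κ * (T - r)) * ∫ ω, G ω ∂Q
  have hGint : ∀ {r : ℝ} {G : Ω' → ℝ}, Measurable[ℱ r] G → (∀ ω, 0 ≤ G ω) → ∀ L,
      (∀ ω, G ω ≤ L) → Integrable G Q := fun {r G} hG h0 L hL ↦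
    Integrable.of_bound (hG.mono (hle r) le_rfl).aestronglyMeasurable L
      (ae_of_all _ fun ω ↦ by rw [Real.norm_eq_abs, abs_of_nonneg (h0 ω)]; exact hL ω)
  -- since `a` is bounded by `K`, some finite, `K`-dependent constant works
  have hinit : Claim (Real.exp (lam * (K * T))) := by
    intro r hr0 hrT G hG hG0 L hGL
    have hi := hGint hG hG0 L hGL
    calc ∫ ω, G ω * Real.exp (lam * A r ω) ∂Q ≤ ∫ ω, G ω * Real.exp (lam * (K * T)) ∂Q := by
          refine integral_mono_of_nonneg (ae_of_all _ fun ω ↦ mul_nonneg (hG0 ω) (Real.exp_pos _).le)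
            (hi.mul_const _) (ae_of_all _ fun ω ↦ ?_)
          exact mul_le_mul_of_nonneg_left (hexpK r ω hr0 hrT) (hG0 ω)
      _ = Real.exp (lam * (K * T)) * 1 * ∫ ω, G ω ∂Q := by rw [integral_mul_const]; ring
      _ ≤ _ := by
          have : 0 ≤ ∫ ω, G ω ∂Q := integral_nonneg hG0
          gcongr
          exact Real.one_le_exp (mul_nonneg hκ (by linarith))
  -- expanding at the smallest time `u` and using the bound from `u` on with the weight `G * a u`
  have hstep : ∀ M, 0 ≤ M → Claim M → Claim (1 + M / 2) := by
    intro M hM0 hM r hr0 hrT G hG hG0 L hGL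
    have hi := hGint hG hG0 L hGL
    have hGm : Measurable G := hG.mono (hle r) le_rfl
    have hL0 : 0 ≤ L := by
      obtain ⟨ω⟩ := nonempty_of_isProbabilityMeasure Q
      exact (hG0 ω).trans (hGL ω)
    set J := ∫ ω, G ω ∂Q with hJ
    have hJ0 : 0 ≤ J := integral_nonneg hG0
    have hbd : Integrable (fun p : Ω' × ℝ ↦ G p.1 * (lam * a p.2 p.1 * Real.exp (lam * A p.2 p.1)))
        (Q.prod (volume.restrict (Set.Ioc r T))) := by
      refine Integrable.of_bound (C := L * (lam * K * Real.exp (lam * (K * T)))) ?_ ?_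
      · have h1 : Measurable fun p : Ω' × ℝ ↦ a p.2 p.1 := hjoint.comp measurable_swap
        have h2 : Measurable fun p : Ω' × ℝ ↦ A p.2 p.1 := hAj.comp measurable_swap
        exact ((hGm.comp measurable_fst).mul ((h1.const_mul lam).mul
          (h2.const_mul lam).exp)).aestronglyMeasurable
      · have : ∀ᵐ p ∂(Q.prod (volume.restrict (Set.Ioc r T))), p.2 ∈ Set.Ioc r T :=
          Measure.quasiMeasurePreserving_snd.ae (ae_restrict_mem measurableSet_Ioc)
        filter_upwards [this] with p hp
        have hp0 : 0 ≤ p.2 := hr0.trans hp.1.le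
        rw [Real.norm_eq_abs, abs_of_nonneg (mul_nonneg (hG0 _) (mul_nonneg
          (mul_nonneg hlam (ha0 _ _)) (Real.exp_pos _).le))]
        have := hexpK p.2 p.1 hp0 hp.2
        have := haK p.2 p.1
        have := ha0 p.2 p.1
        have := hGL p.1
        have := hG0 p.1
        gcongr
    have hinner : ∀ u ∈ Set.Ioc r T, ∫ ω, G ω * (lam * a u ω * Real.exp (lam * A u ω)) ∂Q ≤
        lam * M * J * (Real.exp (κ * (T - u)) * g (u - r)) := by
      intro u hu
      have hu0 : 0 ≤ u := hr0.trans hu.1.le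
      have e1 : ∫ ω, G ω * (lam * a u ω * Real.exp (lam * A u ω)) ∂Q =
          lam * ∫ ω, (G ω * a u ω) * Real.exp (lam * A u ω) ∂Q := by
        rw [← integral_const_mul]
        exact integral_congr_ae (ae_of_all _ fun ω ↦ by dsimp only; ring)
      have e2 := hM u hu0 hu.2 (fun ω ↦ G ω * a u ω)
        ((hG.mono (hmono r u hu.1.le) le_rfl).mul (had u)) (fun ω ↦ mul_nonneg (hG0 ω) (ha0 u ω))
        (L * K) fun ω ↦ mul_le_mul (hGL ω) (haK u ω) (ha0 u ω) hL0
      have e3 := hbound r u hr0 hu.1 hu.2 G hG hG0 L hGL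
      rw [e1]
      calc lam * ∫ ω, (G ω * a u ω) * Real.exp (lam * A u ω) ∂Q
          ≤ lam * (M * Real.exp (κ * (T - u)) * (J * g (u - r))) := by
            refine mul_le_mul_of_nonneg_left (e2.trans ?_) hlam
            exact mul_le_mul_of_nonneg_left e3 (mul_nonneg hM0 (Real.exp_pos _).le)
        _ = _ := by ring
    -- the kernel after the translation `u ↦ u - r`
    have hgr : IntegrableOn (fun u ↦ Real.exp (κ * (T - u)) * g (u - r)) (Set.Ioc r T) ∧
        ∫ u in Set.Ioc r T, Real.exp (κ * (T - u)) * g (u - r) ≤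
          Real.exp (κ * (T - r)) * ∫ v in Set.Ioc 0 T, Real.exp (-κ * v) * g v := by
      have hexp : IntegrableOn (fun v ↦ Real.exp (-κ * v) * g v) (Set.Ioc 0 T) := by
        refine Integrable.mono' hg
          ((by fun_prop : Continuous fun v ↦ Real.exp (-κ * v)).aestronglyMeasurable.mul
          hg.aestronglyMeasurable) ?_
        filter_upwards [ae_restrict_mem measurableSet_Ioc] with v hv
        rw [norm_mul, Real.norm_eq_abs, Real.abs_exp, Real.norm_eq_abs, abs_of_nonneg (hg0 v)]
        refine mul_le_of_le_one_left (hg0 v) (Real.exp_le_one_iff.2 ?_)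
        nlinarith [hv.1]
      have hexp' : IntegrableOn (fun v ↦ Real.exp (-κ * v) * g v) (Set.Ioc 0 (T - r)) :=
        hexp.mono_set (Set.Ioc_subset_Ioc_right (by linarith))
      have hpre : (fun u ↦ u - r) ⁻¹' Set.Ioc 0 (T - r) = Set.Ioc r T := by
        ext u; simp
      have hmp := measurePreserving_sub_right (volume : Measure ℝ) r
      have e : ∀ u, Real.exp (κ * (T - u)) * g (u - r) =
          Real.exp (κ * (T - r)) * (Real.exp (-κ * (u - r)) * g (u - r)) := fun u ↦ by
        rw [← mul_assoc, ← Real.exp_add]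
        congr 2
        ring
      simp_rw [e]
      have i1 : IntegrableOn (fun u ↦ Real.exp (-κ * (u - r)) * g (u - r)) (Set.Ioc r T) := by
        have := (hmp.integrableOn_comp_preimage (MeasurableEquiv.subRight r).measurableEmbedding).2
          hexp'
        rw [hpre] at this
        exact this
      refine ⟨i1.const_mul _, ?_⟩
      rw [integral_const_mul]
      refine mul_le_mul_of_nonneg_left ?_ (Real.exp_pos _).le
      have e3 := hmp.setIntegral_preimage_emb (MeasurableEquiv.subRight r).measurableEmbedding
        (fun v ↦ Real.exp (-κ * v) * g v) (Set.Ioc 0 (T - r))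
      rw [hpre] at e3
      rw [e3]
      exact setIntegral_mono_set hexp (ae_of_all _ fun v ↦ mul_nonneg (Real.exp_pos _).le (hg0 v))
        (Set.Ioc_subset_Ioc_right (by linarith)).eventuallyLE
    calc ∫ ω, G ω * Real.exp (lam * A r ω) ∂Q
        = ∫ ω, (G ω + ∫ u in Set.Ioc r T, G ω * (lam * a u ω * Real.exp (lam * A u ω))) ∂Q := by
          refine integral_congr_ae (ae_of_all _ fun ω ↦ ?_)
          dsimp only
          rw [hA, exp_integral_eq (hc ω), intervalIntegral.integral_of_le hrT, integral_const_mul]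
          ring
      _ = J + ∫ ω, (∫ u in Set.Ioc r T, G ω * (lam * a u ω * Real.exp (lam * A u ω))) ∂Q :=
          integral_add hi hbd.integral_prod_left
      _ = J + ∫ u in Set.Ioc r T, ∫ ω, G ω * (lam * a u ω * Real.exp (lam * A u ω)) ∂Q := by
          rw [integral_integral_swap hbd]
      _ ≤ J + ∫ u in Set.Ioc r T, lam * M * J * (Real.exp (κ * (T - u)) * g (u - r)) := by
          gcongr 1
          exact setIntegral_mono_on hbd.integral_prod_right (hgr.1.const_mul _) measurableSet_Ioc
            hinner
      _ = J + lam * M * J * ∫ u in Set.Ioc r T, Real.exp (κ * (T - u)) * g (u - r) := by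
          rw [integral_const_mul]
      _ ≤ J + lam * M * J *
            (Real.exp (κ * (T - r)) * ∫ v in Set.Ioc 0 T, Real.exp (-κ * v) * g v) := by
          gcongr
          exact hgr.2
      _ = J + M * J * Real.exp (κ * (T - r)) *
            (lam * ∫ v in Set.Ioc 0 T, Real.exp (-κ * v) * g v) := by ring
      _ ≤ J * Real.exp (κ * (T - r)) + M * J * Real.exp (κ * (T - r)) * (1 / 2) := by
          gcongr
          exact le_mul_of_one_le_right hJ0 (Real.one_le_exp (mul_nonneg hκ (by linarith)))
      _ = (1 + M / 2) * Real.exp (κ * (T - r)) * J := by ring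
  -- the iteration forgets the initial constant and converges to the fixed point `2`
  have hiter : ∀ n : ℕ, Claim (2 + Real.exp (lam * (K * T)) * (1 / 2) ^ n) := by
    intro n
    induction n with
    | zero =>
      intro r h1 h2 G hG h3 L h4
      refine (hinit r h1 h2 G hG h3 L h4).trans ?_
      have : 0 ≤ ∫ ω, G ω ∂Q := integral_nonneg h3
      gcongr
      simp
    | succ n ih =>
      have := hstep _ (by positivity) ih
      convert this using 1
      ring
  have hlim : Tendsto (fun n : ℕ ↦ (2 + Real.exp (lam * (K * T)) * (1 / 2) ^ n) *
      Real.exp (κ * T)) atTop (𝓝 ((2 + Real.exp (lam * (K * T)) * 0) * Real.exp (κ * T))) :=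
    ((tendsto_const_nhds.add ((tendsto_pow_atTop_nhds_zero_of_lt_one (by norm_num)
      (by norm_num)).const_mul _)).mul_const _)
  rw [mul_zero, add_zero] at hlim
  refine ge_of_tendsto' hlim fun n ↦ ?_
  have := hiter n 0 le_rfl hT (fun _ ↦ 1) measurable_const (fun _ ↦ zero_le_one) 1 fun _ ↦ le_rfl
  simpa using this

/-- The exponential weight `e^{-κv}` makes the integral of an integrable function small. -/
lemma exists_exp_weight_small {g : ℝ → ℝ} {T : ℝ} (hg : IntegrableOn g (Set.Ioc 0 T)) {lam δ : ℝ}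
    (hδ : 0 < δ) : ∃ κ : ℝ, 0 ≤ κ ∧ lam * ∫ v in Set.Ioc 0 T, Real.exp (-κ * v) * g v ≤ δ := by
  have h : Tendsto (fun n : ℕ ↦ ∫ v in Set.Ioc 0 T, Real.exp (-(n : ℝ) * v) * g v) atTop
      (𝓝 (∫ v in Set.Ioc 0 T, 0)) := by
    refine tendsto_integral_of_dominated_convergence (fun v ↦ ‖g v‖)
      (fun n ↦ (by fun_prop :
        Continuous fun v : ℝ ↦ Real.exp (-(n : ℝ) * v)).aestronglyMeasurable.mul
        hg.aestronglyMeasurable) hg.norm (fun n ↦ ?_) ?_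
    · filter_upwards [ae_restrict_mem measurableSet_Ioc] with v hv
      rw [norm_mul, Real.norm_eq_abs, Real.abs_exp]
      refine mul_le_of_le_one_left (norm_nonneg _) (Real.exp_le_one_iff.2 ?_)
      have : (0 : ℝ) ≤ n := n.cast_nonneg
      nlinarith [hv.1]
    · filter_upwards [ae_restrict_mem measurableSet_Ioc] with v hv
      have h1 : Tendsto (fun n : ℕ ↦ -(n : ℝ) * v) atTop atBot := by
        have := (tendsto_natCast_atTop_atTop (R := ℝ)).atTop_mul_const hv.1
        exact (tendsto_neg_atTop_atBot.comp this).congr fun n ↦ by simp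
      simpa using (Real.tendsto_exp_atBot.comp h1).mul_const (g v)
  have h2 := h.const_mul lam
  simp only [integral_zero, mul_zero] at h2
  obtain ⟨n, hn⟩ := (h2.eventually_lt_const hδ).exists
  exact ⟨n, n.cast_nonneg, hn.le⟩

end Khasminskii

/-! ### Exponential moments of self-intersections -/

section Rate

variable {d : ℕ}

/-- A bound, up to time `T`, for the rate at which the self-intersection of the path `b` grows at
time `u`. The times before `0` are frozen at `0`, which keeps the rate continuous. -/
noncomputable def intersectionRate (Λ : Measure (Space d)) (β C ε T : ℝ) (b : ℝ≥0 → Space d)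
    (u : ℝ) : ℝ :=
  2 * C * ∫ v in Set.Ioc 0 T, v ^ (-β) * mollify Λ ε (b u.toNNReal - b (u - v).toNNReal)

/-- The bound for the conditional expectation of the rate, a time `w` after the conditioning. The
increment over a lag `v` has a part independent of the past of length `min v w`, and
`peak (min v w)` is bounded by the sum of the two values. -/
noncomputable def rateBound (μ : Measure (Space d)) (β C T w : ℝ) : ℝ :=
  2 * C * ((∫ v in Set.Ioc 0 T, v ^ (-β)) * peak μ w + ∫ v in Set.Ioc 0 T, v ^ (-β) * peak μ v)

lemma measurable_setIntegral_mul_of_continuous {Ω' : Type*} {m : MeasurableSpace Ω'}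
    {f : ℝ → Ω' → ℝ} (hc : ∀ ω, Continuous fun v ↦ f v ω) (hm : ∀ v, Measurable (f v))
    {w : ℝ → ℝ} (hw : Measurable w) (s : Set ℝ) :
    Measurable fun ω ↦ ∫ v in s, w v * f v ω := by
  have hj : Measurable fun p : ℝ × Ω' ↦ f p.1 p.2 :=
    measurable_uncurry_of_continuous_of_measurable hc hm
  have : StronglyMeasurable fun p : Ω' × ℝ ↦ w p.2 * f p.2 p.1 :=
    ((hw.comp measurable_snd).mul (hj.comp measurable_swap)).stronglyMeasurable
  exact this.integral_prod_right.measurable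

variable {γ : ℝ → ℝ} {Λ μ : Measure (Space d)} {β C : ℝ}

namespace IsNoiseCovariance

variable (h : IsNoiseCovariance γ Λ μ β C)
include h

lemma integrableOn_rate {ε : ℝ} (hε : 0 < ε) (T : ℝ) {b : ℝ≥0 → Space d} (hb : Measurable b)
    (u : ℝ) : IntegrableOn
      (fun v ↦ v ^ (-β) * mollify Λ ε (b u.toNNReal - b (u - v).toNNReal)) (Set.Ioc 0 T) := by
  have hm : Measurable fun v : ℝ ↦ mollify Λ ε (b u.toNNReal - b (u - v).toNNReal) :=
    (h.continuous_mollify hε).measurable.comp (by fun_prop)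
  exact (integrableOn_rpow_neg h.time.lt_one T).mul_bdd hm.aestronglyMeasurable
    (ae_of_all _ fun v ↦ h.norm_mollify_le hε _)

lemma intersectionRate_nonneg {ε : ℝ} (hε : 0 < ε) (T : ℝ) (b : ℝ≥0 → Space d) (u : ℝ) :
    0 ≤ intersectionRate Λ β C ε T b u := by
  have := h.time.const_pos
  refine mul_nonneg (by positivity) (setIntegral_nonneg measurableSet_Ioc fun v hv ↦ ?_)
  exact mul_nonneg (Real.rpow_nonneg hv.1.le _) (mollify_nonneg Λ hε _)

lemma intersectionRate_le {ε : ℝ} (hε : 0 < ε) (T : ℝ) {b : ℝ≥0 → Space d} (hb : Measurable b)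
    (u : ℝ) : intersectionRate Λ β C ε T b u ≤
      2 * C * ∫ v in Set.Ioc 0 T, v ^ (-β) * peak μ ε := by
  have := h.time.const_pos
  refine mul_le_mul_of_nonneg_left ?_ (by positivity)
  refine setIntegral_mono_on (h.integrableOn_rate hε T hb u)
    ((integrableOn_rpow_neg h.time.lt_one T).mul_const _) measurableSet_Ioc fun v hv ↦ ?_
  exact mul_le_mul_of_nonneg_left (h.mollify_le hε _) (Real.rpow_nonneg hv.1.le _)

lemma continuous_intersectionRate {ε : ℝ} (hε : 0 < ε) (T : ℝ) {b : ℝ≥0 → Space d}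
    (hb : Continuous b) : Continuous (intersectionRate Λ β C ε T b) := by
  have hc := h.continuous_mollify hε
  refine continuous_const.mul (continuous_of_dominated
    (fun u ↦ (h.integrableOn_rate hε T hb.measurable u).aestronglyMeasurable)
    (bound := fun v ↦ v ^ (-β) * peak μ ε) (fun u ↦ ?_)
    ((integrableOn_rpow_neg h.time.lt_one T).mul_const _) (ae_of_all _ fun v ↦ ?_))
  · filter_upwards [ae_restrict_mem measurableSet_Ioc] with v hv
    rw [norm_mul, Real.norm_eq_abs, abs_of_nonneg (Real.rpow_nonneg hv.1.le _)]
    exact mul_le_mul_of_nonneg_left (h.norm_mollify_le hε _) (Real.rpow_nonneg hv.1.le _)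
  · have : Continuous fun u : ℝ ↦ b u.toNNReal - b (u - v).toNNReal := by
      have h1 : Continuous Real.toNNReal := continuous_real_toNNReal
      fun_prop
    exact continuous_const.mul (hc.comp this)

omit h in
lemma measurable_rpow_neg : Measurable fun v : ℝ ↦ v ^ (-β) := by fun_prop

lemma measurable_intersectionRate {Ω' : Type*} {B : ℝ≥0 → Ω' → Space d}
    (hBc : ∀ ω, Continuous fun s ↦ B s ω) {ε : ℝ} (hε : 0 < ε) (T u : ℝ) :
    Measurable[past B u.toNNReal] fun ω ↦ intersectionRate Λ β C ε T (fun s ↦ B s ω) u := by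
  have hc := h.continuous_mollify hε
  -- on the domain of integration the second time lies in the past of `u`
  have e : (fun ω ↦ intersectionRate Λ β C ε T (fun s ↦ B s ω) u) = fun ω ↦
      2 * C * ∫ v in Set.Ioc 0 T, v ^ (-β) *
        mollify Λ ε (B u.toNNReal ω - B (min (u - v).toNNReal u.toNNReal) ω) := by
    ext ω
    rw [intersectionRate]
    congr 1
    refine setIntegral_congr_fun measurableSet_Ioc fun v hv ↦ ?_
    have : (u - v).toNNReal ≤ u.toNNReal := Real.toNNReal_mono (by linarith [hv.1])
    simp only [min_eq_left this]
  rw [e]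
  refine Measurable.const_mul ?_ _
  refine @measurable_setIntegral_mul_of_continuous Ω' (past B u.toNNReal)
    (fun v ω ↦ mollify Λ ε (B u.toNNReal ω - B (min (u - v).toNNReal u.toNNReal) ω))
    (fun ω ↦ ?_) (fun v ↦ ?_) _ measurable_rpow_neg _
  · have h1 : Continuous Real.toNNReal := continuous_real_toNNReal
    have h2 := hBc ω
    exact hc.comp (continuous_const.sub (h2.comp (by fun_prop)))
  · exact hc.measurable.comp ((measurable_past B le_rfl).sub (measurable_past B (min_le_right _ _)))

/-- The self-intersection is at most the integral of its rate: symmetry reduces the square to the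
triangle `s < r`, where `s = r - v`. -/
lemma mollifiedIntersection_le_integral_rate {ε t T : ℝ} (hε : 0 < ε) (ht : 0 ≤ t) (htT : t ≤ T)
    {b : ℝ≥0 → Space d} (hb : Continuous b) :
    mollifiedIntersection γ Λ t ε b ≤ ∫ u in (0 : ℝ)..T, intersectionRate Λ β C ε T b u := by
  have hC := h.time.const_pos
  have hbm := hb.measurable
  have hΛm := (h.continuous_mollify hε).measurable
  have hT : 0 ≤ T := ht.trans htT
  set k : ℝ → ℝ≥0∞ := fun v ↦ ENNReal.ofReal (v ^ (-β)) with hk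
  set G : ℝ → ℝ → ℝ≥0∞ := fun r s ↦
    ENNReal.ofReal (mollify Λ ε (b r.toNNReal - b s.toNNReal)) with hG
  have hkm : Measurable k := by fun_prop
  have hGm : Measurable fun p : ℝ × ℝ ↦ G p.1 p.2 := (hΛm.comp (by fun_prop)).ennreal_ofReal
  have hGs : ∀ r s, G r s = G s r := fun r s ↦ by
    simp only [hG]
    rw [← h.mollify_even hε, neg_sub]
  set H : ℝ → ℝ → ℝ≥0∞ := fun r s ↦ if s < r then k (r - s) * G r s else 0 with hH
  have hHm : Measurable fun p : ℝ × ℝ ↦ H p.1 p.2 :=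
    Measurable.ite (measurableSet_lt measurable_snd measurable_fst)
      ((hkm.comp (by fun_prop)).mul hGm) measurable_const
  have hsplit : ∀ r s, s ≠ r → ENNReal.ofReal (γ (r - s)) * G r s ≤
      ENNReal.ofReal C * (H r s + H s r) := by
    intro r s hsr
    have h1 : ENNReal.ofReal (γ (r - s)) ≤ ENNReal.ofReal C * k |r - s| := by
      rw [hk, ← ENNReal.ofReal_mul hC.le]
      exact ENNReal.ofReal_le_ofReal (h.time.le _ (sub_ne_zero.2 hsr.symm))
    have h2 : k |r - s| * G r s = H r s + H s r := by
      rcases lt_or_gt_of_ne hsr with hlt | hlt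
      · simp only [hH, if_pos hlt, if_neg hlt.le.not_gt, add_zero]
        rw [abs_of_pos (sub_pos.2 hlt)]
      · simp only [hH, if_pos hlt, if_neg hlt.le.not_gt, zero_add]
        rw [abs_of_neg (sub_neg.2 hlt), neg_sub, hGs]
    calc _ ≤ ENNReal.ofReal C * k |r - s| * G r s := by gcongr
      _ = _ := by rw [mul_assoc, h2]
  have htri : ∀ r ∈ Set.Icc 0 t, ∫⁻ s in Set.Icc 0 t, H r s ≤
      ∫⁻ v in Set.Ioc 0 T, k v * G r (r - v) := by
    intro r hr
    rw [← lintegral_indicator measurableSet_Icc, ← lintegral_indicator measurableSet_Ioc,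
      ← lintegral_sub_left_eq_self (fun s ↦ (Set.Icc 0 t).indicator (fun s ↦ H r s) s) r]
    refine lintegral_mono fun v ↦ Set.indicator_apply_le' (fun hv ↦ ?_) fun _ ↦ zero_le
    by_cases hv0 : 0 < v
    · have h1 : v ∈ Set.Ioc 0 T := ⟨hv0, by linarith [hv.1, hr.2]⟩
      rw [Set.indicator_of_mem h1]
      simp only [hH]
      rw [if_pos (by linarith), sub_sub_cancel]
    · simp only [hH]
      rw [if_neg (by linarith)]
      exact zero_le
  have hrate : ∀ r, ENNReal.ofReal (intersectionRate Λ β C ε T b r) =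
      ENNReal.ofReal (2 * C) * ∫⁻ v in Set.Ioc 0 T, k v * G r (r - v) := by
    intro r
    rw [intersectionRate, ENNReal.ofReal_mul (by positivity),
      ofReal_integral_eq_lintegral_ofReal (h.integrableOn_rate hε T hbm r)]
    · congr 1
      refine setLIntegral_congr_fun measurableSet_Ioc fun v hv ↦ ?_
      exact ENNReal.ofReal_mul (Real.rpow_nonneg hv.1.le _)
    · filter_upwards [ae_restrict_mem measurableSet_Ioc] with v hv
      exact mul_nonneg (Real.rpow_nonneg hv.1.le _) (mollify_nonneg Λ hε _)
  have hcr := h.continuous_intersectionRate hε T hb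
  have hmain : ENNReal.ofReal (mollifiedIntersection γ Λ t ε b) ≤
      ENNReal.ofReal (∫ u in (0 : ℝ)..T, intersectionRate Λ β C ε T b u) := by
    rw [intervalIntegral.integral_of_le hT, ofReal_integral_eq_lintegral_ofReal
      (hcr.integrableOn_Ioc) (ae_of_all _ fun u ↦ h.intersectionRate_nonneg hε T b u),
      mollifiedIntersection, ofReal_integral_eq_lintegral_ofReal
      (h.integrable_mollify hε t hbm hbm) (ae_of_all _ fun p ↦ mollify_nonneg Λ hε _)]
    calc ∫⁻ p, G p.1 p.2 ∂(timeMeasure γ t)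
        = ∫⁻ r in Set.Icc 0 t, ∫⁻ s in Set.Icc 0 t, ENNReal.ofReal (γ (r - s)) * G r s :=
          lintegral_timeMeasure h.time.meas t hGm
      _ ≤ ∫⁻ r in Set.Icc 0 t, ∫⁻ s in Set.Icc 0 t, ENNReal.ofReal C * (H r s + H s r) := by
          refine lintegral_mono fun r ↦ lintegral_mono_ae (ae_restrict_of_ae ?_)
          filter_upwards [Measure.ae_ne volume r] with s hs using hsplit r s hs
      _ = ENNReal.ofReal C * ((∫⁻ r in Set.Icc 0 t, ∫⁻ s in Set.Icc 0 t, H r s) +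
            ∫⁻ r in Set.Icc 0 t, ∫⁻ s in Set.Icc 0 t, H s r) := by
          have hH1 : ∀ r, Measurable fun s ↦ H r s := fun r ↦
            hHm.comp (g := fun p : ℝ × ℝ ↦ H p.1 p.2) (f := fun s : ℝ ↦ (r, s)) (by fun_prop)
          simp_rw [lintegral_const_mul' _ _ ENNReal.ofReal_ne_top]
          congr 1
          rw [← lintegral_add_left hHm.lintegral_prod_right']
          exact lintegral_congr fun r ↦ lintegral_add_left (hH1 r) _
      _ = ENNReal.ofReal (2 * C) * ∫⁻ r in Set.Icc 0 t, ∫⁻ s in Set.Icc 0 t, H r s := by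
          rw [lintegral_lintegral_swap (f := fun r s ↦ H s r)
            (hHm.comp measurable_swap).aemeasurable, ← two_mul, ENNReal.ofReal_mul zero_le_two,
            ENNReal.ofReal_ofNat]
          ring
      _ ≤ ENNReal.ofReal (2 * C) *
            ∫⁻ r in Set.Icc 0 t, ∫⁻ v in Set.Ioc 0 T, k v * G r (r - v) := by
          gcongr 1
          exact setLIntegral_mono' measurableSet_Icc htri
      _ = ∫⁻ r in Set.Ioc 0 t, ENNReal.ofReal (intersectionRate Λ β C ε T b r) := by
          rw [← lintegral_const_mul' _ _ ENNReal.ofReal_ne_top, setLIntegral_congr Ioc_ae_eq_Icc]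
          simp_rw [hrate]
      _ ≤ _ := lintegral_mono_set (Set.Ioc_subset_Ioc_right htT)
  exact (ENNReal.ofReal_le_ofReal_iff (intervalIntegral.integral_nonneg hT fun u _ ↦
    h.intersectionRate_nonneg hε T b u)).1 hmain

lemma rateBound_nonneg (T w : ℝ) : 0 ≤ rateBound μ β C T w := by
  have := h.time.const_pos
  have h1 : 0 ≤ ∫ v in Set.Ioc 0 T, v ^ (-β) :=
    setIntegral_nonneg measurableSet_Ioc fun v hv ↦ Real.rpow_nonneg hv.1.le _
  have h2 : 0 ≤ ∫ v in Set.Ioc 0 T, v ^ (-β) * peak μ v :=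
    setIntegral_nonneg measurableSet_Ioc fun v hv ↦
      mul_nonneg (Real.rpow_nonneg hv.1.le _) (peak_nonneg _ _)
  have h3 := peak_nonneg μ w
  unfold rateBound
  positivity

lemma integrableOn_rateBound {T : ℝ} (hT : 0 < T) :
    IntegrableOn (rateBound μ β C T) (Set.Ioc 0 T) := by
  have h1 := integrableOn_rpow_mul_peak h.time.pos h.time.lt_one hT h.spectral
  have h2 : IntegrableOn (peak μ) (Set.Ioc 0 T) := by
    refine Integrable.mono' (h1.const_mul (T ^ β)) h.measurable_peak.aestronglyMeasurable ?_
    filter_upwards [ae_restrict_mem measurableSet_Ioc] with v hv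
    rw [Real.norm_eq_abs, abs_of_nonneg (peak_nonneg _ _), ← mul_assoc]
    refine le_mul_of_one_le_left (peak_nonneg _ _) ?_
    calc (1 : ℝ) = v ^ β * v ^ (-β) := by rw [← Real.rpow_add hv.1]; simp
      _ ≤ T ^ β * v ^ (-β) := by
        have := Real.rpow_nonneg hv.1.le (-β)
        have := Real.rpow_le_rpow hv.1.le hv.2 h.time.pos.le
        gcongr
  exact ((h2.const_mul _).add (integrable_const _)).const_mul _

/-- Conditionally on the past up to time `r`, the rate at time `u` is at most
`rateBound (u - r)` in expectation. -/
lemma integral_mul_rate_le {Ω' : Type*} [MeasurableSpace Ω'] {Q : Measure Ω'}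
    [IsProbabilityMeasure Q] {B : ℝ≥0 → Ω' → Space d} (hB : IsRegularBrownian Q B) {ε T : ℝ}
    (hε : 0 < ε) {r u : ℝ} (hr : 0 ≤ r) (hru : r < u) (huT : u ≤ T) {G : Ω' → ℝ}
    (hG : Measurable[past B r.toNNReal] G) (hG0 : ∀ ω, 0 ≤ G ω) {L : ℝ} (hL : ∀ ω, G ω ≤ L) :
    ∫ ω, G ω * intersectionRate Λ β C ε T (fun s ↦ B s ω) u ∂Q ≤
      (∫ ω, G ω ∂Q) * rateBound μ β C T (u - r) := by
  have hC := h.time.const_pos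
  have hu0 : 0 < u := hr.trans_lt hru
  have hT : 0 < T := hu0.trans_le huT
  have hGm : Measurable G := hG.mono (past_le hB.measurable _) le_rfl
  have hGi : Integrable G Q := Integrable.of_bound hGm.aestronglyMeasurable L
    (ae_of_all _ fun ω ↦ by rw [Real.norm_eq_abs, abs_of_nonneg (hG0 ω)]; exact hL ω)
  have hw := integrableOn_rpow_neg h.time.lt_one T
  have hwp := integrableOn_rpow_mul_peak h.time.pos h.time.lt_one hT h.spectral
  set J := ∫ ω, G ω ∂Q
  have hJ : 0 ≤ J := integral_nonneg hG0
  -- condition at `max r (u - v)`, after which the increment up to `u` is independent of the past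
  have hpoint : ∀ v ∈ Set.Ioc 0 T, ∫ ω, G ω * mollify Λ ε (B u.toNNReal ω - B (u - v).toNNReal ω) ∂Q
      ≤ J * (peak μ (u - r) + peak μ v) := by
    intro v hv
    set m := max r.toNNReal (u - v).toNNReal with hm
    have hmu : m < u.toNNReal := max_lt ((Real.toNNReal_lt_toNNReal_iff hu0).2 hru)
      ((Real.toNNReal_lt_toNNReal_iff hu0).2 (by linarith [hv.1]))
    have h1 := h.integral_mul_mollify_increment_le hB hε hmu
      (hG.mono (past_mono B (le_max_left _ _)) le_rfl)
      (D := fun ω ↦ B m ω - B (u - v).toNNReal ω)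
      ((measurable_past B le_rfl).sub (measurable_past B (le_max_right _ _))) hG0 hL
    simp only [sub_add_sub_cancel] at h1
    refine h1.trans (mul_le_mul_of_nonneg_left ?_ hJ)
    rw [Real.coe_toNNReal _ hu0.le]
    rcases le_total (u - v).toNNReal r.toNNReal with hle | hle
    · rw [hm, max_eq_left hle, Real.coe_toNNReal _ hr]
      linarith [peak_nonneg μ v]
    · rcases le_total 0 (u - v) with h0 | h0
      · rw [hm, max_eq_right hle, Real.coe_toNNReal _ h0, sub_sub_cancel]
        linarith [peak_nonneg μ (u - r)]
      · rw [Real.toNNReal_of_nonpos h0, ← Real.toNNReal_zero,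
          Real.toNNReal_le_toNNReal_iff le_rfl] at hle
        have hr0 : r = 0 := le_antisymm hle hr
        rw [hm, Real.toNNReal_of_nonpos h0, hr0]
        simp only [Real.toNNReal_zero, max_self, NNReal.coe_zero]
        linarith [peak_nonneg μ v]
  have hjoint : Measurable fun p : Ω' × ℝ ↦
      mollify Λ ε (B u.toNNReal p.1 - B (u - p.2).toNNReal p.1) := by
    refine (h.continuous_mollify hε).measurable.comp
      (((hB.measurable _).comp measurable_fst).sub ?_)
    exact hB.measurable_uncurry.comp (f := fun p : Ω' × ℝ ↦ ((u - p.2).toNNReal, p.1))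
      (by fun_prop)
  have hint : Integrable (fun p : Ω' × ℝ ↦
      p.2 ^ (-β) * (G p.1 * mollify Λ ε (B u.toNNReal p.1 - B (u - p.2).toNNReal p.1)))
      (Q.prod (volume.restrict (Set.Ioc 0 T))) := by
    refine (hw.comp_snd Q).mul_bdd (c := L * peak μ ε)
      ((hGm.comp measurable_fst).mul hjoint).aestronglyMeasurable (ae_of_all _ fun p ↦ ?_)
    rw [norm_mul, Real.norm_eq_abs, abs_of_nonneg (hG0 _)]
    exact mul_le_mul (hL _) (h.norm_mollify_le hε _) (norm_nonneg _) ((hG0 p.1).trans (hL _))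
  have hwpeak : IntegrableOn (fun v ↦ v ^ (-β) * (J * (peak μ (u - r) + peak μ v)))
      (Set.Ioc 0 T) := by
    have : IntegrableOn (fun v ↦ J * (v ^ (-β) * peak μ (u - r) + v ^ (-β) * peak μ v))
      (Set.Ioc 0 T) := ((hw.mul_const _).add hwp).const_mul J
    refine this.congr (ae_of_all _ fun v ↦ ?_)
    dsimp only
    ring
  calc ∫ ω, G ω * intersectionRate Λ β C ε T (fun s ↦ B s ω) u ∂Q
      = ∫ ω, 2 * C * (∫ v in Set.Ioc 0 T,
          v ^ (-β) * (G ω * mollify Λ ε (B u.toNNReal ω - B (u - v).toNNReal ω))) ∂Q := by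
        refine integral_congr_ae (ae_of_all _ fun ω ↦ ?_)
        simp only [intersectionRate]
        rw [mul_left_comm, ← integral_const_mul]
        simp_rw [mul_left_comm (G ω)]
    _ = 2 * C * ∫ v in Set.Ioc 0 T, v ^ (-β) *
          ∫ ω, G ω * mollify Λ ε (B u.toNNReal ω - B (u - v).toNNReal ω) ∂Q := by
        rw [integral_const_mul, integral_integral_swap hint]
        simp_rw [integral_const_mul]
    _ ≤ 2 * C * ∫ v in Set.Ioc 0 T, v ^ (-β) * (J * (peak μ (u - r) + peak μ v)) := by
        refine mul_le_mul_of_nonneg_left ?_ (by positivity)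
        refine setIntegral_mono_on ?_ hwpeak measurableSet_Ioc fun v hv ↦
          mul_le_mul_of_nonneg_left (hpoint v hv) (Real.rpow_nonneg hv.1.le _)
        have := hint.integral_prod_right
        simp_rw [integral_const_mul] at this
        exact this
    _ = _ := by
        have e : ∫ v in Set.Ioc 0 T, v ^ (-β) * (J * (peak μ (u - r) + peak μ v)) =
            J * ∫ v in Set.Ioc 0 T, (v ^ (-β) * peak μ (u - r) + v ^ (-β) * peak μ v) := by
          rw [← integral_const_mul]
          refine integral_congr_ae (ae_of_all _ fun v ↦ ?_)
          dsimp only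
          ring
        rw [e, integral_add (hw.mul_const _) hwp, integral_mul_const, rateBound]
        ring

/-- Exponential moments of the regularised self-intersections, uniform in `ε` and in time. -/
theorem exists_integral_exp_mollifiedIntersection_le {Ω' : Type*} [MeasurableSpace Ω']
    {Q : Measure Ω'} [IsProbabilityMeasure Q] {B : ℝ≥0 → Ω' → Space d}
    (hB : IsRegularBrownian Q B) {lam T : ℝ} (hlam : 0 ≤ lam) (hT : 0 < T) :
    ∃ K : ℝ, ∀ ε t, 0 < ε → 0 ≤ t → t ≤ T →
      ∫ ω, Real.exp (lam * mollifiedIntersection γ Λ t ε fun s ↦ B s ω) ∂Q ≤ K := by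
  obtain ⟨κ, hκ, hsmall⟩ := exists_exp_weight_small (h.integrableOn_rateBound hT) (lam := lam)
    (δ := 1 / 2) (by norm_num)
  refine ⟨2 * Real.exp (κ * T), fun ε t hε ht htT ↦ ?_⟩
  have hbm : ∀ ω, Measurable fun s ↦ B s ω := fun ω ↦ (hB.continuous ω).measurable
  have hmain := integral_exp_le_of_conditional_bound (Q := Q) (ℱ := fun u ↦ past B u.toNNReal)
    (fun u ↦ past_le hB.measurable _) (fun r u hru ↦ past_mono B (Real.toNNReal_mono hru))
    (a := fun u ω ↦ intersectionRate Λ β C ε T (fun s ↦ B s ω) u)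
    (fun u ↦ h.measurable_intersectionRate hB.continuous hε T u)
    (fun ω ↦ h.continuous_intersectionRate hε T (hB.continuous ω))
    (fun u ω ↦ h.intersectionRate_nonneg hε T _ u)
    (fun u ω ↦ h.intersectionRate_le hε T (hbm ω) u) hT.le (h.integrableOn_rateBound hT)
    (h.rateBound_nonneg T) hlam hκ
    (fun r u hr hru huT G hG hG0 L hL ↦ h.integral_mul_rate_le hB hε hr hru huT hG hG0 hL) hsmall
  refine le_trans (integral_mono_of_nonneg (ae_of_all _ fun ω ↦ (Real.exp_pos _).le) ?_
    (ae_of_all _ fun ω ↦ Real.exp_le_exp.2 (mul_le_mul_of_nonneg_left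
      (h.mollifiedIntersection_le_integral_rate hε ht htT (hB.continuous ω)) hlam))) hmain
  have hm : Measurable fun ω ↦ ∫ u in (0 : ℝ)..T, intersectionRate Λ β C ε T (fun s ↦ B s ω) u := by
    have hj : Measurable fun p : ℝ × Ω' ↦ intersectionRate Λ β C ε T (fun s ↦ B s p.2) p.1 :=
      measurable_uncurry_of_continuous_of_measurable
        (u := fun u ω ↦ intersectionRate Λ β C ε T (fun s ↦ B s ω) u)
        (fun ω ↦ h.continuous_intersectionRate hε T (hB.continuous ω))
        fun u ↦ (h.measurable_intersectionRate hB.continuous hε T u).mono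
          (past_le hB.measurable _) le_rfl
    have hsm : StronglyMeasurable fun p : Ω' × ℝ ↦
        intersectionRate Λ β C ε T (fun s ↦ B s p.1) p.2 :=
      (hj.comp measurable_swap).stronglyMeasurable
    simp only [intervalIntegral.integral_of_le hT.le]
    exact hsm.integral_prod_right.measurable
  refine Integrable.of_bound (hm.const_mul lam).exp.aestronglyMeasurable
    (Real.exp (lam * ((2 * C * ∫ v in Set.Ioc 0 T, v ^ (-β) * peak μ ε) * T)))
    (ae_of_all _ fun ω ↦ ?_)
  rw [Real.norm_eq_abs, Real.abs_exp]
  refine Real.exp_le_exp.2 (mul_le_mul_of_nonneg_left ?_ hlam)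
  calc ∫ u in (0 : ℝ)..T, intersectionRate Λ β C ε T (fun s ↦ B s ω) u
      ≤ ∫ u in (0 : ℝ)..T, (2 * C * ∫ v in Set.Ioc 0 T, v ^ (-β) * peak μ ε) :=
        intervalIntegral.integral_mono_on hT.le
          ((h.continuous_intersectionRate hε T (hB.continuous ω)).intervalIntegrable _ _)
          (by simp) fun u _ ↦ h.intersectionRate_le hε T (hbm ω) u
    _ = _ := by rw [intervalIntegral.integral_const, sub_zero, smul_eq_mul, mul_comm]

end IsNoiseCovariance

end Rate

/-! ### The law of Brownian increments -/

section HeatKernelLaw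

variable {d : ℕ}

lemma integral_heatKernel_mul_cexp {u : ℝ} (hu : 0 < u) (w : Space d) :
    ∫ v, (heatKernel d u v : ℂ) * Complex.exp ((inner ℝ w v : ℝ) * Complex.I) =
      Complex.exp ((-(u / 2) * ‖w‖ ^ 2 : ℝ)) := by
  have hb : 0 < ((1 / (2 * u) : ℝ) : ℂ).re := by
    rw [Complex.ofReal_re]
    positivity
  have key := GaussianFourier.integral_cexp_neg_mul_sq_norm_add (V := Space d) hb Complex.I w
  have hpu : 0 < 2 * Real.pi * u := by positivity
  have e : ∀ v : Space d,
      (heatKernel d u v : ℂ) * Complex.exp ((inner ℝ w v : ℝ) * Complex.I) =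
      (((2 * Real.pi * u) ^ (-(d : ℝ) / 2) : ℝ) : ℂ) *
        Complex.exp (-((1 / (2 * u) : ℝ) : ℂ) * ‖v‖ ^ 2 + Complex.I * (inner ℝ w v : ℝ)) := by
    intro v
    rw [heatKernel, Complex.ofReal_mul, Complex.ofReal_exp, Complex.exp_add, mul_assoc]
    congr 3
    · push_cast
      field_simp
    · ring
  simp_rw [e]
  rw [integral_const_mul, key, ← mul_assoc]
  have e1 : (Real.pi / ((1 / (2 * u) : ℝ) : ℂ)) ^ ((Module.finrank ℝ (Space d) : ℂ) / 2) =
      (((2 * Real.pi * u) ^ ((d : ℝ) / 2) : ℝ) : ℂ) := by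
    rw [finrank_euclideanSpace_fin, Complex.ofReal_cpow hpu.le]
    congr 1
    · push_cast
      field_simp
    · push_cast
      ring
  rw [e1, ← Complex.ofReal_mul, ← Real.rpow_add hpu]
  have e2 : -(d : ℝ) / 2 + d / 2 = 0 := by ring
  rw [e2, Real.rpow_zero, Complex.ofReal_one, one_mul, Complex.I_sq]
  congr 1
  have : (u : ℂ) ≠ 0 := by exact_mod_cast hu.ne'
  push_cast
  field_simp
  norm_num

lemma integrable_heatKernel {u : ℝ} (hu : 0 < u) : Integrable (heatKernel d u) := by
  simpa [heatKernel_neg] using integrable_heatKernel_sub (volume : Measure (Space d)) hu 0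

lemma integral_heatKernel {u : ℝ} (hu : 0 < u) : ∫ v, heatKernel d u v = 1 := by
  have h := integral_heatKernel_mul_cexp hu (0 : Space d)
  simp only [inner_zero_left, Complex.ofReal_zero, zero_mul, Complex.exp_zero, mul_one, norm_zero,
    ne_eq, OfNat.ofNat_ne_zero, not_false_eq_true, zero_pow, mul_zero] at h
  rw [integral_complex_ofReal] at h
  exact_mod_cast h

lemma lintegral_heatKernel {u : ℝ} (hu : 0 < u) :
    ∫⁻ v, ENNReal.ofReal (heatKernel d u v) = 1 := by
  rw [← ofReal_integral_eq_lintegral_ofReal (integrable_heatKernel hu)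
    (ae_of_all _ fun v ↦ heatKernel_nonneg hu v), integral_heatKernel hu, ENNReal.ofReal_one]

variable {Ω' : Type*} [MeasurableSpace Ω'] {Q : Measure Ω'} [IsProbabilityMeasure Q]
  {B : ℝ≥0 → Ω' → Space d}

/-- The increments of Brownian motion have the heat kernel as density. -/
lemma IsRegularBrownian.map_sub (hB : IsRegularBrownian Q B) {s r : ℝ≥0} (hsr : s < r) :
    Q.map (fun ω ↦ B r ω - B s ω) =
      volume.withDensity fun x ↦ ENNReal.ofReal (heatKernel d ((r : ℝ) - s) x) := by
  have hu : 0 < (r : ℝ) - s := sub_pos.2 (by exact_mod_cast hsr)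
  have hm := (measurable_heatKernel (d := d) ((r : ℝ) - s)).ennreal_ofReal
  have : IsFiniteMeasure (volume.withDensity fun x ↦
      ENNReal.ofReal (heatKernel d ((r : ℝ) - s) x)) :=
    isFiniteMeasure_withDensity (by rw [lintegral_heatKernel hu]; exact ENNReal.one_ne_top)
  have : IsProbabilityMeasure (Q.map (fun ω ↦ B r ω - B s ω)) :=
    Measure.isProbabilityMeasure_map ((hB.measurable r).sub (hB.measurable s)).aemeasurable
  refine Measure.ext_of_charFun (funext fun ξ ↦ ?_)
  rw [hB.charFun_sub _ _ hsr.le, charFun_apply, integral_withDensity_eq_integral_toReal_smul hm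
    (ae_of_all _ fun _ ↦ ENNReal.ofReal_lt_top)]
  simp only [ENNReal.toReal_ofReal (heatKernel_nonneg hu _), Complex.real_smul]
  simp_rw [real_inner_comm ξ]
  rw [integral_heatKernel_mul_cexp hu]

lemma IsRegularBrownian.lintegral_sub (hB : IsRegularBrownian Q B) {s r : ℝ≥0} (hsr : s ≠ r)
    {f : Space d → ℝ≥0∞} (hf : Measurable f) :
    ∫⁻ ω, f (B r ω - B s ω) ∂Q =
      ∫⁻ x, f x * ENNReal.ofReal (heatKernel d |(r : ℝ) - s| x) := by
  have key : ∀ {s r : ℝ≥0}, s < r → ∀ {f : Space d → ℝ≥0∞}, Measurable f →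
      ∫⁻ ω, f (B r ω - B s ω) ∂Q =
        ∫⁻ x, f x * ENNReal.ofReal (heatKernel d ((r : ℝ) - s) x) := by
    intro s r hsr f hf
    have h1 := lintegral_map (μ := Q) (g := fun ω ↦ B r ω - B s ω) hf
      ((hB.measurable r).sub (hB.measurable s))
    rw [hB.map_sub hsr, lintegral_withDensity_eq_lintegral_mul _
      (measurable_heatKernel _).ennreal_ofReal hf] at h1
    rw [← h1]
    exact lintegral_congr fun x ↦ mul_comm _ _
  rcases lt_or_gt_of_ne hsr with h | h
  · rw [key h hf, abs_of_pos (sub_pos.2 (by exact_mod_cast h))]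
  · have h1 := key h (f := fun x ↦ f (-x)) (hf.comp measurable_neg)
    simp only [neg_sub] at h1
    rw [h1, abs_of_neg (sub_neg.2 (by exact_mod_cast h)), neg_sub,
      ← lintegral_neg_eq_self]
    simp only [neg_neg, heatKernel_neg]

end HeatKernelLaw

/-! ### The heat semigroup at time zero -/

section HeatSemigroup

variable {d : ℕ}

/-- Pointwise convergence of the heat semigroup at time zero. -/
lemma tendsto_integral_heatKernel_mul {g : Space d → ℝ} (hg : Continuous g) (hgi : Integrable g)
    (x : Space d) :
    Tendsto (fun ε ↦ ∫ y, heatKernel d ε (x - y) * g y) (𝓝[>] 0) (𝓝 (g x)) := by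
  have h1 := Real.tendsto_integral_gaussian_smul' (V := Space d) (hgi.ofReal (𝕜 := ℂ))
    (v := x) (Complex.continuous_ofReal.comp hg).continuousAt
  have h2 : Tendsto (fun ε : ℝ ↦ (2 * Real.pi ^ 2)⁻¹ * ε⁻¹) (𝓝[>] 0) atTop :=
    tendsto_inv_nhdsGT_zero.const_mul_atTop (by positivity)
  have h3 := h1.comp h2
  have h4 : Tendsto (fun ε ↦ ((∫ y, heatKernel d ε (x - y) * g y : ℝ) : ℂ)) (𝓝[>] 0)
      (𝓝 (g x : ℂ)) := by
    refine h3.congr' ?_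
    filter_upwards [self_mem_nhdsWithin] with ε hε
    have hε : 0 < ε := hε
    rw [← integral_complex_ofReal]
    refine integral_congr_ae (ae_of_all _ fun y ↦ ?_)
    have hc : (0 : ℝ) < Real.pi * ((2 * Real.pi ^ 2)⁻¹ * ε⁻¹) := by positivity
    have e1 : ((Real.pi : ℂ) * (((2 * Real.pi ^ 2)⁻¹ * ε⁻¹ : ℝ) : ℂ)) ^
        ((Module.finrank ℝ (Space d) : ℂ) / 2) =
        (((2 * Real.pi * ε) ^ (-(d : ℝ) / 2) : ℝ) : ℂ) := by
      have e2 : Real.pi * ((2 * Real.pi ^ 2)⁻¹ * ε⁻¹) = (2 * Real.pi * ε)⁻¹ := by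
        field_simp
      rw [neg_div, Real.rpow_neg (by positivity), ← Real.inv_rpow (by positivity), ← e2,
        Complex.ofReal_cpow hc.le, finrank_euclideanSpace_fin]
      push_cast
      rfl
    dsimp only [Function.comp_apply]
    rw [e1, heatKernel]
    simp only [smul_eq_mul, Complex.ofReal_mul, Complex.ofReal_exp]
    congr 3
    have : (ε : ℂ) ≠ 0 := by exact_mod_cast hε.ne'
    have : (Real.pi : ℂ) ≠ 0 := by exact_mod_cast Real.pi_ne_zero
    push_cast
    field_simp
  exact (Complex.continuous_re.tendsto _).comp h4

lemma heatKernel_le_two_mul {u v : ℝ} (hu : 0 < u) (huv : u ≤ v) (hv : v ≤ 2 * u) (x : Space d) :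
    heatKernel d v x ≤ 2 ^ ((d : ℝ) / 2) * heatKernel d (2 * u) x := by
  have hv0 : 0 < v := hu.trans_le huv
  have hpi := Real.pi_pos
  have e : (2 : ℝ) ^ ((d : ℝ) / 2) * (2 * Real.pi * (2 * u)) ^ (-(d : ℝ) / 2) =
      (2 * Real.pi * u) ^ (-(d : ℝ) / 2) := by
    rw [show 2 * Real.pi * (2 * u) = 2 * (2 * Real.pi * u) by ring,
      Real.mul_rpow (by norm_num) (by positivity), ← mul_assoc, ← Real.rpow_add (by norm_num)]
    ring_nf
    simp
  unfold heatKernel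
  rw [← mul_assoc, e]
  gcongr ?_ * Real.exp ?_
  · refine Real.rpow_le_rpow_of_nonpos (by positivity) (by gcongr) ?_
    rw [neg_div]
    exact neg_nonpos.2 (by positivity)
  · rw [neg_div, neg_div]
    gcongr

lemma lintegral_heatKernel_mul_heatKernel {ε η : ℝ} (hε : 0 < ε) (hη : 0 < η) (y : Space d) :
    ∫⁻ x, ENNReal.ofReal (heatKernel d ε (x - y)) * ENNReal.ofReal (heatKernel d η x) =
      ENNReal.ofReal (heatKernel d (ε + η) y) := by
  have hint : Integrable fun x ↦ heatKernel d ε (y - x) * heatKernel d η (0 - x) := by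
    by_contra hcon
    have h1 := integral_heatKernel_mul_heatKernel hε hη y 0
    rw [integral_undef hcon] at h1
    exact (heatKernel_pos (d := d) (add_pos hε hη) (y - 0)).ne h1
  rw [← sub_zero y, ← integral_heatKernel_mul_heatKernel hε hη, sub_zero,
    ofReal_integral_eq_lintegral_ofReal hint
    (ae_of_all _ fun y ↦ mul_nonneg (heatKernel_nonneg hε _) (heatKernel_nonneg hη _))]
  refine lintegral_congr fun x ↦ ?_
  rw [ENNReal.ofReal_mul (heatKernel_nonneg hε _), ← heatKernel_neg, neg_sub, zero_sub,
    heatKernel_neg]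

variable {Λ : Measure (Space d)} [Λ.HasTemperateGrowth] {ℓ : Space d → ℝ}

lemma lintegral_heatKernel_add_smul {ε u : ℝ} (hε : 0 < ε) (hu : 0 < u)
    {f : Space d → ℝ≥0∞} (hf : Measurable f) :
    ∫⁻ x, (∫⁻ y, ENNReal.ofReal (heatKernel d ε (x - y)) * f y) * ENNReal.ofReal (heatKernel d u x)
      = ∫⁻ y, f y * ENNReal.ofReal (heatKernel d (ε + u) y) := by
  have h1 := measurable_heatKernel (d := d) ε
  have h2 := measurable_heatKernel (d := d) u
  simp_rw [← lintegral_mul_const' _ _ ENNReal.ofReal_ne_top]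
  rw [lintegral_lintegral_swap (by fun_prop)]
  refine lintegral_congr fun y ↦ ?_
  rw [← lintegral_heatKernel_mul_heatKernel hε hu, ← lintegral_const_mul _ (by fun_prop)]
  refine lintegral_congr fun x ↦ ?_
  ring

lemma integrable_heatKernel_mul_density (hℓ : Measurable ℓ) (hℓ0 : ∀ y, 0 ≤ ℓ y)
    (hΛ : Λ = volume.withDensity fun y ↦ ENNReal.ofReal (ℓ y)) {ε : ℝ} (hε : 0 < ε) (x : Space d) :
    Integrable fun y ↦ heatKernel d ε (x - y) * ℓ y := by
  have h1 := integrable_heatKernel_sub Λ hε x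
  rw [hΛ, integrable_withDensity_iff_integrable_smul' hℓ.ennreal_ofReal
    (ae_of_all _ fun _ ↦ ENNReal.ofReal_lt_top)] at h1
  simpa only [ENNReal.toReal_ofReal (hℓ0 _), smul_eq_mul, mul_comm] using h1

omit [Λ.HasTemperateGrowth] in
lemma mollify_eq_integral_density (hℓ : Measurable ℓ) (hℓ0 : ∀ y, 0 ≤ ℓ y)
    (hΛ : Λ = volume.withDensity fun y ↦ ENNReal.ofReal (ℓ y)) (ε : ℝ) (x : Space d) :
    mollify Λ ε x = ∫ y, heatKernel d ε (x - y) * ℓ y := by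
  rw [mollify, hΛ, integral_withDensity_eq_integral_toReal_smul hℓ.ennreal_ofReal
    (ae_of_all _ fun _ ↦ ENNReal.ofReal_lt_top)]
  simp only [ENNReal.toReal_ofReal (hℓ0 _), smul_eq_mul, mul_comm]

lemma lintegral_density_mul_heatKernel (hℓ : Measurable ℓ)
    (hΛ : Λ = volume.withDensity fun y ↦ ENNReal.ofReal (ℓ y)) {u : ℝ} (hu : 0 < u) :
    ∫⁻ y, ENNReal.ofReal (ℓ y) * ENNReal.ofReal (heatKernel d u y) =
      ENNReal.ofReal (mollify Λ u 0) := by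
  have h2 := (measurable_heatKernel (d := d) u).ennreal_ofReal
  rw [mollify, ofReal_integral_eq_lintegral_ofReal (integrable_heatKernel_sub Λ hu 0)
    (ae_of_all _ fun _ ↦ heatKernel_nonneg hu _)]
  simp only [zero_sub, heatKernel_neg]
  rw [hΛ, lintegral_withDensity_eq_lintegral_mul _ hℓ.ennreal_ofReal h2]
  rfl

/-- The regularisations of a density converge to it in the Gaussian space `L¹(p_u)`. The density is
first replaced by a continuous function with compact support; the error is controlled in
`L¹(p_{2u})`, as `p_{u+ε}` is dominated by `p_{2u}` for `ε ≤ u`. -/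
lemma tendsto_lintegral_mollify_sub (hℓ : Measurable ℓ) (hℓ0 : ∀ y, 0 ≤ ℓ y)
    (hΛ : Λ = volume.withDensity fun y ↦ ENNReal.ofReal (ℓ y)) {u : ℝ} (hu : 0 < u) :
    Tendsto (fun ε ↦ ∫⁻ x, ‖mollify Λ ε x - ℓ x‖ₑ * ENNReal.ofReal (heatKernel d u x))
      (𝓝[>] 0) (𝓝 0) := by
  have hp : ∀ v, Measurable fun x : Space d ↦ ENNReal.ofReal (heatKernel d v x) := fun v ↦
    (measurable_heatKernel v).ennreal_ofReal
  set ρ : Measure (Space d) :=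
    volume.withDensity fun x ↦ ENNReal.ofReal (heatKernel d (2 * u) x) with hρ
  have h2u : 0 < 2 * u := by positivity
  have : IsFiniteMeasure ρ :=
    isFiniteMeasure_withDensity (by rw [lintegral_heatKernel h2u]; exact ENNReal.one_ne_top)
  have hℓρ : Integrable ℓ ρ := by
    refine ⟨hℓ.aestronglyMeasurable, ?_⟩
    rw [HasFiniteIntegral, hρ, lintegral_withDensity_eq_lintegral_mul _ (hp _) hℓ.enorm]
    refine lt_of_le_of_lt (le_of_eq ?_) (ENNReal.ofReal_lt_top (r := mollify Λ (2 * u) 0))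
    rw [← lintegral_density_mul_heatKernel hℓ hΛ h2u]
    refine lintegral_congr fun y ↦ ?_
    rw [Pi.mul_apply, Real.enorm_eq_ofReal (hℓ0 y), mul_comm]
  set c : ℝ≥0∞ := ENNReal.ofReal (2 ^ ((d : ℝ) / 2)) with hc
  have hc0 : 0 < c := ENNReal.ofReal_pos.2 (by positivity)
  have hdom : ∀ v, u ≤ v → v ≤ 2 * u → ∀ f : Space d → ℝ≥0∞, Measurable f →
      ∫⁻ x, f x * ENNReal.ofReal (heatKernel d v x) ≤ c * ∫⁻ x, f x ∂ρ := by
    intro v h1 h2 f hf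
    rw [hρ, lintegral_withDensity_eq_lintegral_mul _ (hp _) hf,
      ← lintegral_const_mul _ ((hp _).mul hf)]
    refine lintegral_mono fun x ↦ ?_
    rw [Pi.mul_apply, ← mul_assoc, hc, ← ENNReal.ofReal_mul (by positivity), mul_comm]
    gcongr
    exact heatKernel_le_two_mul hu h1 h2 x
  refine ENNReal.tendsto_nhds_zero.2 fun δ hδ ↦ ?_
  rcases eq_or_ne δ ∞ with rfl | hδt
  · simp
  -- the error allowed for the approximation by `g`
  set δ' : ℝ≥0∞ := δ / 2 / (2 * c) with hδ'
  have h2c : 2 * c ≠ ∞ := ENNReal.mul_ne_top (by norm_num) ENNReal.ofReal_ne_top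
  have hδ'0 : δ' ≠ 0 := (ENNReal.div_pos (ENNReal.half_pos hδ.ne').ne' h2c).ne'
  obtain ⟨g, hgc, hgle, hg, -⟩ := hℓρ.exists_hasCompactSupport_lintegral_sub_le hδ'0
  have hgi : Integrable g := hg.integrable_of_hasCompactSupport hgc
  have hgm : Measurable g := hg.measurable
  obtain ⟨M, hM⟩ := hg.bounded_above_of_compact_support hgc
  have hM0 : 0 ≤ M := (norm_nonneg _).trans (hM 0)
  have hPint : ∀ ε, 0 < ε → ∀ x, Integrable fun y ↦ heatKernel d ε (x - y) * g y := fun ε hε x ↦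
    (integrable_heatKernel_sub volume hε x).mul_bdd hgm.aestronglyMeasurable (ae_of_all _ hM)
  have hPm : ∀ ε, Measurable fun x ↦ ∫ y, heatKernel d ε (x - y) * g y := by
    intro ε
    have h1 := measurable_heatKernel (d := d) ε
    have : StronglyMeasurable fun p : Space d × Space d ↦ heatKernel d ε (p.1 - p.2) * g p.2 :=
      Measurable.stronglyMeasurable (by fun_prop)
    exact this.integral_prod_right.measurable
  have hPle : ∀ ε, 0 < ε → ∀ x, ‖∫ y, heatKernel d ε (x - y) * g y‖ ≤ M := by
    intro ε hε x
    have h1 := integrable_heatKernel_sub (volume : Measure (Space d)) hε x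
    calc ‖∫ y, heatKernel d ε (x - y) * g y‖ ≤ ∫ y, heatKernel d ε (x - y) * M := by
          refine norm_integral_le_of_norm_le (h1.mul_const M) (ae_of_all _ fun y ↦ ?_)
          rw [norm_mul, Real.norm_eq_abs, abs_of_pos (heatKernel_pos hε _)]
          exact mul_le_mul_of_nonneg_left (hM y) (heatKernel_nonneg hε _)
      _ = M := by
          rw [integral_mul_const, integral_sub_left_eq_self (heatKernel d ε),
            integral_heatKernel hε, one_mul]
  have hmid : Tendsto (fun ε ↦ ∫⁻ x, ‖(∫ y, heatKernel d ε (x - y) * g y) - g x‖ₑ *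
      ENNReal.ofReal (heatKernel d u x)) (𝓝[>] 0) (𝓝 0) := by
    have := tendsto_lintegral_filter_of_dominated_convergence (μ := (volume : Measure (Space d)))
      (F := fun ε x ↦ ‖(∫ y, heatKernel d ε (x - y) * g y) - g x‖ₑ *
        ENNReal.ofReal (heatKernel d u x)) (f := fun _ ↦ 0) (l := 𝓝[>] (0 : ℝ))
      (fun x ↦ ENNReal.ofReal (2 * M) * ENNReal.ofReal (heatKernel d u x))
      (Eventually.of_forall fun ε ↦ (((hPm ε).sub hgm).enorm.mul (hp u))) ?_ ?_ ?_
    · simpa using this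
    · filter_upwards [self_mem_nhdsWithin] with ε hε
      refine ae_of_all _ fun x ↦ ?_
      gcongr
      rw [← ofReal_norm]
      refine ENNReal.ofReal_le_ofReal ((norm_sub_le _ _).trans ?_)
      linarith [hPle ε hε x, hM x]
    · rw [lintegral_const_mul _ (hp u), lintegral_heatKernel hu, mul_one]
      exact ENNReal.ofReal_ne_top
    · refine ae_of_all _ fun x ↦ ?_
      have h1 := ((tendsto_integral_heatKernel_mul hg hgi x).sub_const (g x)).enorm
      rw [sub_self, enorm_zero] at h1
      have h2 := ENNReal.Tendsto.mul_const (b := ENNReal.ofReal (heatKernel d u x)) h1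
        (Or.inr ENNReal.ofReal_ne_top)
      rwa [zero_mul] at h2
  have hmid' := ENNReal.tendsto_nhds_zero.1 hmid (δ / 2) (ENNReal.half_pos hδ.ne')
  filter_upwards [hmid', Ioc_mem_nhdsGT hu] with ε h1 hε
  have hLm : Measurable fun y ↦ ‖ℓ y - g y‖ₑ := (hℓ.sub hgm).enorm
  have hpt : ∀ x, ‖mollify Λ ε x - ℓ x‖ₑ ≤
      (∫⁻ y, ENNReal.ofReal (heatKernel d ε (x - y)) * ‖ℓ y - g y‖ₑ) +
        ‖(∫ y, heatKernel d ε (x - y) * g y) - g x‖ₑ + ‖ℓ x - g x‖ₑ := by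
    intro x
    have e : mollify Λ ε x - ℓ x = (∫ y, heatKernel d ε (x - y) * (ℓ y - g y)) +
        ((∫ y, heatKernel d ε (x - y) * g y) - g x) - (ℓ x - g x) := by
      rw [mollify_eq_integral_density hℓ hℓ0 hΛ]
      simp_rw [mul_sub]
      rw [integral_sub (integrable_heatKernel_mul_density hℓ hℓ0 hΛ hε.1 x) (hPint ε hε.1 x)]
      ring
    rw [e]
    refine enorm_sub_le.trans (add_le_add_left ((enorm_add_le _ _).trans (add_le_add_left ?_ _)) _)
    refine (enorm_integral_le_lintegral_enorm _).trans (lintegral_mono fun y ↦ ?_)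
    rw [enorm_mul, Real.enorm_eq_ofReal (heatKernel_nonneg hε.1 _)]
  have hk : Measurable fun p : Space d × Space d ↦
      ENNReal.ofReal (heatKernel d ε (p.1 - p.2)) * ‖ℓ p.2 - g p.2‖ₑ := by
    have := measurable_heatKernel (d := d) ε
    fun_prop
  have hA : Measurable fun x ↦ (∫⁻ y, ENNReal.ofReal (heatKernel d ε (x - y)) * ‖ℓ y - g y‖ₑ) :=
    hk.lintegral_prod_right'
  calc ∫⁻ x, ‖mollify Λ ε x - ℓ x‖ₑ * ENNReal.ofReal (heatKernel d u x)
      ≤ ∫⁻ x, ((∫⁻ y, ENNReal.ofReal (heatKernel d ε (x - y)) * ‖ℓ y - g y‖ₑ) *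
            ENNReal.ofReal (heatKernel d u x) +
          ‖(∫ y, heatKernel d ε (x - y) * g y) - g x‖ₑ * ENNReal.ofReal (heatKernel d u x) +
          ‖ℓ x - g x‖ₑ * ENNReal.ofReal (heatKernel d u x)) := by
        refine lintegral_mono fun x ↦ ?_
        rw [← add_mul, ← add_mul]
        gcongr
        exact hpt x
    _ = (∫⁻ y, ‖ℓ y - g y‖ₑ * ENNReal.ofReal (heatKernel d (ε + u) y)) +
          (∫⁻ x, ‖(∫ y, heatKernel d ε (x - y) * g y) - g x‖ₑ *
            ENNReal.ofReal (heatKernel d u x)) +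
          ∫⁻ x, ‖ℓ x - g x‖ₑ * ENNReal.ofReal (heatKernel d u x) := by
        rw [lintegral_add_right (g := fun x ↦ ‖ℓ x - g x‖ₑ * ENNReal.ofReal (heatKernel d u x)) _
            (hLm.mul (hp u)),
          lintegral_add_left (f := fun x ↦ (∫⁻ y, ENNReal.ofReal (heatKernel d ε (x - y)) *
            ‖ℓ y - g y‖ₑ) * ENNReal.ofReal (heatKernel d u x)) (hA.mul (hp u)),
          lintegral_heatKernel_add_smul hε.1 hu hLm]
    _ ≤ c * δ' + δ / 2 + c * δ' := by
        gcongr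
        · exact (hdom _ (by linarith [hε.1]) (by linarith [hε.2]) _ hLm).trans (by gcongr)
        · exact (hdom _ le_rfl (by linarith) _ hLm).trans (by gcongr)
    _ = 2 * c * δ' + δ / 2 := by ring
    _ = δ := by
        rw [hδ', ENNReal.mul_div_cancel (by positivity) h2c, ENNReal.add_halves]

end HeatSemigroup

/-! ### Self-intersections for a density -/

section Density

variable {d : ℕ} {γ : ℝ → ℝ} {Λ μ : Measure (Space d)} {β C : ℝ}
  {Ω' : Type*} [MeasurableSpace Ω'] {Q : Measure Ω'} [IsProbabilityMeasure Q]
  {B : ℝ≥0 → Ω' → Space d} {ℓ : Space d → ℝ}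

namespace IsNoiseCovariance

variable (h : IsNoiseCovariance γ Λ μ β C) (hB : IsRegularBrownian Q B)
  (hℓ : Measurable ℓ) (hℓ0 : ∀ y, 0 ≤ ℓ y)
  (hΛ : Λ = volume.withDensity fun y ↦ ENNReal.ofReal (ℓ y))
include h hB hℓ hℓ0 hΛ

/-- The expectation of the density at an increment of length `u` is `peak μ u`. -/
lemma lintegral_density_sub {r s : ℝ} (hr : 0 ≤ r) (hs : 0 ≤ s) (hrs : r ≠ s) :
    ∫⁻ ω, ‖ℓ (B r.toNNReal ω - B s.toNNReal ω)‖ₑ ∂Q = ENNReal.ofReal (peak μ |r - s|) := by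
  have := h.temperate
  have hu : 0 < |r - s| := abs_pos.2 (sub_ne_zero.2 hrs)
  have hne : s.toNNReal ≠ r.toNNReal := fun e ↦ hrs ((Real.toNNReal_eq_toNNReal_iff hs hr).1 e).symm
  rw [hB.lintegral_sub hne hℓ.enorm, Real.coe_toNNReal _ hr, Real.coe_toNNReal _ hs,
    ← mollify_zero h.fourier hu (h.integrable_exp hu), ← lintegral_density_mul_heatKernel hℓ hΛ hu]
  exact lintegral_congr fun y ↦ by rw [Real.enorm_eq_ofReal (hℓ0 y)]

/-- Convergence of the mollified density along the increments, in `L¹` of the law of the path times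
`γ(r-s) dr ds`, by dominated convergence in `(r, s)` of the Gaussian `L¹` distances. -/
lemma tendsto_lintegral_mollify_density (t : ℝ) :
    Tendsto (fun ε ↦ ∫⁻ p, ∫⁻ ω, ‖mollify Λ ε (B p.1.toNNReal ω - B p.2.toNNReal ω) -
      ℓ (B p.1.toNNReal ω - B p.2.toNNReal ω)‖ₑ ∂Q ∂(timeMeasure γ t)) (𝓝[>] 0) (𝓝 0) := by
  have := h.temperate
  have hmeas : ∀ ε, 0 < ε → Measurable fun x ↦ ‖mollify Λ ε x - ℓ x‖ₑ := fun ε hε ↦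
    ((h.continuous_mollify hε).measurable.sub hℓ).enorm
  have key := tendsto_lintegral_filter_of_dominated_convergence (μ := timeMeasure γ t)
    (l := 𝓝[>] (0 : ℝ)) (f := fun _ ↦ 0)
    (F := fun ε p ↦ ∫⁻ ω, ‖mollify Λ ε (B p.1.toNNReal ω - B p.2.toNNReal ω) -
      ℓ (B p.1.toNNReal ω - B p.2.toNNReal ω)‖ₑ ∂Q)
    (fun p ↦ ENNReal.ofReal (2 * peak μ |p.1 - p.2|)) ?_ ?_ ?_ ?_
  · simpa using key
  · filter_upwards [self_mem_nhdsWithin] with ε hε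
    have : Measurable fun q : Ω' × (ℝ × ℝ) ↦
        ‖mollify Λ ε (B q.2.1.toNNReal q.1 - B q.2.2.toNNReal q.1) -
          ℓ (B q.2.1.toNNReal q.1 - B q.2.2.toNNReal q.1)‖ₑ :=
      (hmeas ε hε).comp hB.measurable_sub
    exact this.lintegral_prod_left'
  · filter_upwards [self_mem_nhdsWithin] with ε hε
    have hε : 0 < ε := hε
    filter_upwards [ae_timeMeasure_ne t, ae_timeMeasure_mem t] with p hp hpm
    have hu : 0 < |p.1 - p.2| := abs_pos.2 (sub_ne_zero.2 hp)
    have hm : Measurable fun ω ↦ mollify Λ ε (B p.1.toNNReal ω - B p.2.toNNReal ω) :=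
      (h.continuous_mollify hε).measurable.comp ((hB.measurable _).sub (hB.measurable _))
    have h1 : ∫⁻ ω, ‖mollify Λ ε (B p.1.toNNReal ω - B p.2.toNNReal ω)‖ₑ ∂Q ≤
        ENNReal.ofReal (peak μ |p.1 - p.2|) := by
      have e : ∀ ω, ‖mollify Λ ε (B p.1.toNNReal ω - B p.2.toNNReal ω)‖ₑ =
          ENNReal.ofReal (mollify Λ ε (B p.1.toNNReal ω - B p.2.toNNReal ω)) := fun ω ↦
        Real.enorm_eq_ofReal (mollify_nonneg Λ hε _)
      simp_rw [e]
      rw [← ofReal_integral_eq_lintegral_ofReal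
        (Integrable.of_bound hm.aestronglyMeasurable _ (ae_of_all _ fun ω ↦ h.norm_mollify_le hε _))
        (ae_of_all _ fun ω ↦ mollify_nonneg Λ hε _), h.integral_mollify_brownian hB hε,
        Real.coe_toNNReal _ hpm.1.1, Real.coe_toNNReal _ hpm.2.1]
      exact ENNReal.ofReal_le_ofReal (h.peak_anti hu (by linarith))
    have h2 := h.lintegral_density_sub hB hℓ hℓ0 hΛ hpm.1.1 hpm.2.1 hp
    calc _ ≤ ∫⁻ ω, (‖mollify Λ ε (B p.1.toNNReal ω - B p.2.toNNReal ω)‖ₑ +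
          ‖ℓ (B p.1.toNNReal ω - B p.2.toNNReal ω)‖ₑ) ∂Q := lintegral_mono fun ω ↦ enorm_sub_le
      _ ≤ _ := by
        rw [lintegral_add_left hm.enorm, h2, two_mul,
          ENNReal.ofReal_add (peak_nonneg _ _) (peak_nonneg _ _)]
        gcongr
  · have := (integrable_peak_timeMeasure h t).const_mul 2
    exact this.lintegral_lt_top.ne
  · filter_upwards [ae_timeMeasure_ne t, ae_timeMeasure_mem t] with p hp hpm
    have hu : 0 < |p.1 - p.2| := abs_pos.2 (sub_ne_zero.2 hp)
    refine (tendsto_lintegral_mollify_sub hℓ hℓ0 hΛ hu).congr' ?_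
    filter_upwards [self_mem_nhdsWithin] with ε hε
    have hne : p.2.toNNReal ≠ p.1.toNNReal := fun e ↦
      hp ((Real.toNNReal_eq_toNNReal_iff hpm.2.1 hpm.1.1).1 e).symm
    rw [hB.lintegral_sub hne (hmeas ε hε), Real.coe_toNNReal _ hpm.1.1,
      Real.coe_toNNReal _ hpm.2.1]

/-- For a density, the renormalised self-intersection is an absolutely convergent integral. -/
theorem ae_eq_selfIntersection_density {t : ℝ} {σ2 : Ω' → ℝ}
    (hσ : IsSelfIntersection Q γ Λ B t σ2) :
    ∀ᵐ ω ∂Q, IntegrableOn (fun p : ℝ × ℝ ↦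
        γ (p.1 - p.2) * ℓ (B p.1.toNNReal ω - B p.2.toNNReal ω))
        (Set.Icc (0 : ℝ) t ×ˢ Set.Icc (0 : ℝ) t) ∧
      σ2 ω = selfIntersection γ ℓ t (fun s ↦ B s ω) := by
  have := h.time.isFiniteMeasure_timeMeasure t
  have hj : Measurable fun q : Ω' × (ℝ × ℝ) ↦ ℓ (B q.2.1.toNNReal q.1 - B q.2.2.toNNReal q.1) :=
    hℓ.comp hB.measurable_sub
  have hint : ∀ᵐ ω ∂Q, Integrable (fun p : ℝ × ℝ ↦
      ℓ (B p.1.toNNReal ω - B p.2.toNNReal ω)) (timeMeasure γ t) := by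
    have h1 : ∫⁻ ω, ∫⁻ p, ‖ℓ (B p.1.toNNReal ω - B p.2.toNNReal ω)‖ₑ ∂(timeMeasure γ t) ∂Q ≠ ∞ := by
      rw [lintegral_lintegral_swap (f := fun ω (p : ℝ × ℝ) ↦
        ‖ℓ (B p.1.toNNReal ω - B p.2.toNNReal ω)‖ₑ) hj.enorm.aemeasurable]
      refine ne_of_lt (lt_of_le_of_lt (le_of_eq (lintegral_congr_ae ?_))
        (integrable_peak_timeMeasure h t).lintegral_lt_top)
      filter_upwards [ae_timeMeasure_ne t, ae_timeMeasure_mem t] with p hp hpm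
      exact h.lintegral_density_sub hB hℓ hℓ0 hΛ hpm.1.1 hpm.2.1 hp
    filter_upwards [ae_lt_top hj.enorm.lintegral_prod_right' h1] with ω hω
    exact ⟨(hj.comp measurable_prodMk_left).aestronglyMeasurable, hω⟩
  set S : Ω' → ℝ := fun ω ↦ ∫ p, ℓ (B p.1.toNNReal ω - B p.2.toNNReal ω) ∂(timeMeasure γ t)
  have hSm : AEStronglyMeasurable S Q :=
    hj.stronglyMeasurable.integral_prod_right.aestronglyMeasurable
  have hS : Tendsto (fun ε ↦ eLpNorm (fun ω ↦
      mollifiedIntersection γ Λ t ε (fun s ↦ B s ω) - S ω) 1 Q) (𝓝[>] 0) (𝓝 0) := by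
    refine tendsto_of_tendsto_of_tendsto_of_le_of_le' tendsto_const_nhds
      (h.tendsto_lintegral_mollify_density hB hℓ hℓ0 hΛ t) (Eventually.of_forall fun _ ↦ zero_le) ?_
    filter_upwards [self_mem_nhdsWithin] with ε hε
    have hε : 0 < ε := hε
    have hm : Measurable fun q : Ω' × (ℝ × ℝ) ↦
        ‖mollify Λ ε (B q.2.1.toNNReal q.1 - B q.2.2.toNNReal q.1) -
          ℓ (B q.2.1.toNNReal q.1 - B q.2.2.toNNReal q.1)‖ₑ :=
      (((h.continuous_mollify hε).measurable.sub hℓ).enorm).comp hB.measurable_sub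
    rw [eLpNorm_one_eq_lintegral_enorm, lintegral_lintegral_swap (f := fun (p : ℝ × ℝ) ω ↦
      ‖mollify Λ ε (B p.1.toNNReal ω - B p.2.toNNReal ω) -
        ℓ (B p.1.toNNReal ω - B p.2.toNNReal ω)‖ₑ) (hm.comp measurable_swap).aemeasurable]
    refine lintegral_mono_ae ?_
    filter_upwards [hint] with ω hω
    have hb : Measurable fun s ↦ B s ω := (hB.continuous ω).measurable
    rw [mollifiedIntersection, ← integral_sub (h.integrable_mollify hε t hb hb) hω]
    exact enorm_integral_le_lintegral_enorm _
  have hS' : Tendsto (fun ε ↦ eLpNorm (fun ω ↦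
      mollifiedIntersection γ Λ t ε (fun s ↦ B s ω) - σ2 ω) 1 Q) (𝓝[>] 0) (𝓝 0) := by
    simpa only [selfIntersection_mollify h.time] using hσ.2
  have hzero : eLpNorm (fun ω ↦ σ2 ω - S ω) 1 Q = 0 := by
    refine le_antisymm (ge_of_tendsto (by simpa using hS'.add hS) ?_) zero_le
    filter_upwards [self_mem_nhdsWithin] with ε hε
    have hmI := (h.measurable_mollifiedIntersection hB (Set.mem_Ioi.1 hε) t).aestronglyMeasurable
      (μ := Q)
    have e : (fun ω ↦ σ2 ω - S ω) =
        (fun ω ↦ mollifiedIntersection γ Λ t ε (fun s ↦ B s ω) - S ω) -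
        fun ω ↦ mollifiedIntersection γ Λ t ε (fun s ↦ B s ω) - σ2 ω := by
      ext ω
      simp
    rw [e, add_comm]
    exact eLpNorm_sub_le (hmI.sub hSm) (hmI.sub hσ.1.aestronglyMeasurable) le_rfl
  replace hzero := (eLpNorm_eq_zero_iff (hσ.1.aestronglyMeasurable.sub hSm) one_ne_zero).1 hzero
  filter_upwards [hint, hzero] with ω h1 h2
  refine ⟨(integrable_timeMeasure_iff h.time.meas h.time.nonneg t _).1 h1, ?_⟩
  rw [sub_eq_zero.1 h2]
  exact integral_timeMeasure h.time.meas h.time.nonneg t _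

end IsNoiseCovariance

end Density

/-! ### Exponential moments and the Feynman–Kac weight -/

section ExponentialMoments

variable {d : ℕ} {γ : ℝ → ℝ} {Λ μ : Measure (Space d)} {β C : ℝ}
  {Ω Ω' : Type*} [MeasurableSpace Ω] [MeasurableSpace Ω'] {P : Measure Ω} {Q : Measure Ω'}
  [IsProbabilityMeasure P] [IsProbabilityMeasure Q] {B : ℝ≥0 → Ω' → Space d}

/-- Exponential moments pass to the limit by Fatou's lemma along an almost surely convergent
sequence. -/
lemma IsNoiseCovariance.lintegral_exp_selfIntersection_le (h : IsNoiseCovariance γ Λ μ β C)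
    (hB : IsRegularBrownian Q B) {t a K : ℝ} {σ2 : Ω' → ℝ}
    (hσ : IsSelfIntersection Q γ Λ B t σ2)
    (hK : ∀ ε, 0 < ε → ∫ ω, Real.exp (a * mollifiedIntersection γ Λ t ε fun s ↦ B s ω) ∂Q ≤ K) :
    ∫⁻ ω, ENNReal.ofReal (Real.exp (a * σ2 ω)) ∂Q ≤ ENNReal.ofReal K := by
  have hpos : ∀ n : ℕ, (0 : ℝ) < 1 / ((n : ℝ) + 1) := fun n ↦ by positivity
  have h0 : Tendsto (fun n : ℕ ↦ 1 / ((n : ℝ) + 1)) atTop (𝓝[>] 0) :=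
    tendsto_nhdsWithin_iff.2 ⟨tendsto_one_div_add_atTop_nhds_zero_nat, Eventually.of_forall hpos⟩
  have hm := fun n : ℕ ↦ h.measurable_mollifiedIntersection hB (hpos n) t
  have hσ2 := hσ.2
  simp only [selfIntersection_mollify h.time] at hσ2
  obtain ⟨ns, -, hns⟩ := (tendstoInMeasure_of_tendsto_eLpNorm one_ne_zero
    (fun n ↦ (hm n).aestronglyMeasurable) hσ.1.aestronglyMeasurable
    (hσ2.comp h0)).exists_seq_tendsto_ae
  have hexp : ∀ n, Measurable fun ω ↦ ENNReal.ofReal (Real.exp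
      (a * mollifiedIntersection γ Λ t (1 / ((n : ℕ) + 1 : ℝ)) fun s ↦ B s ω)) := fun n ↦
    ((hm n).const_mul a).exp.ennreal_ofReal
  calc ∫⁻ ω, ENNReal.ofReal (Real.exp (a * σ2 ω)) ∂Q
      = ∫⁻ ω, liminf (fun n ↦ ENNReal.ofReal (Real.exp
          (a * mollifiedIntersection γ Λ t (1 / ((ns n : ℕ) + 1 : ℝ)) fun s ↦ B s ω))) atTop ∂Q := by
        refine lintegral_congr_ae ?_
        filter_upwards [hns] with ω hω
        exact ((ENNReal.continuous_ofReal.tendsto _).comp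
          ((Real.continuous_exp.tendsto _).comp (hω.const_mul a))).liminf_eq.symm
    _ ≤ liminf (fun n ↦ ∫⁻ ω, ENNReal.ofReal (Real.exp
          (a * mollifiedIntersection γ Λ t (1 / ((ns n : ℕ) + 1 : ℝ)) fun s ↦ B s ω)) ∂Q) atTop :=
        lintegral_liminf_le fun n ↦ hexp (ns n)
    _ ≤ ENNReal.ofReal K := by
        refine liminf_le_of_frequently_le' (Frequently.of_forall fun n ↦ ?_)
        have hε := hpos (ns n)
        rw [← ofReal_integral_eq_lintegral_ofReal _ (ae_of_all _ fun ω ↦ (Real.exp_pos _).le)]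
        · exact ENNReal.ofReal_le_ofReal (hK _ hε)
        · refine Integrable.of_bound ((hm _).const_mul a).exp.aestronglyMeasurable
            (Real.exp (|a| * (peak μ (1 / ((ns n : ℕ) + 1 : ℝ)) *
              (timeMeasure γ t).real Set.univ))) (ae_of_all _ fun ω ↦ ?_)
          rw [Real.norm_eq_abs, Real.abs_exp]
          refine Real.exp_le_exp.2 ((le_abs_self _).trans ?_)
          rw [abs_mul]
          exact mul_le_mul_of_nonneg_left (h.mollifiedIntersection_le hε t _) (abs_nonneg a)

omit [IsProbabilityMeasure P] in
lemma lintegral_exp_of_map_eq_gaussianReal {X : Ω → ℝ} {v : ℝ≥0}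
    (hX : P.map X = gaussianReal 0 v) (lam : ℝ) :
    ∫⁻ ω, ENNReal.ofReal (Real.exp (lam * X ω)) ∂P =
      ENNReal.ofReal (Real.exp (lam ^ 2 / 2 * v)) := by
  have hXm : AEMeasurable X P := aemeasurable_of_map_neZero (by rw [hX]; infer_instance)
  have h1 := integrable_exp_mul_gaussianReal (μ := 0) (v := v) lam
  have h2 := mgf_gaussianReal hX lam
  rw [← hX, integrable_map_measure (by fun_prop) hXm] at h1
  rw [← ofReal_integral_eq_lintegral_ofReal (f := fun ω ↦ Real.exp (lam * X ω)) h1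
    (ae_of_all _ fun ω ↦ (Real.exp_pos _).le)]
  rw [mgf] at h2
  rw [h2]
  congr 2
  ring

/-- Exponential moments of mixtures of centred Gaussian laws, whose random variance is the
self-intersection of the Brownian path. -/
theorem IsNoiseCovariance.exists_integral_exp_le (h : IsNoiseCovariance γ Λ μ β C)
    (hB : IsRegularBrownian Q B) (lam : ℝ) {T : ℝ} (hT : 0 < T) :
    ∃ K : ℝ, ∀ t ∈ Set.Icc (0 : ℝ) T, ∀ (V : Ω × Ω' → ℝ) (σ2 : Ω' → ℝ),
      AEStronglyMeasurable V (P.prod Q) → IsSelfIntersection Q γ Λ B t σ2 →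
      (∀ᵐ ω' ∂Q, 0 ≤ σ2 ω' ∧
        P.map (fun ω ↦ V (ω, ω')) = gaussianReal 0 (σ2 ω').toNNReal) →
      Integrable (fun p ↦ Real.exp (lam * V p)) (P.prod Q) ∧
        ∫ p, Real.exp (lam * V p) ∂(P.prod Q) ≤ K := by
  obtain ⟨K, hK⟩ := h.exists_integral_exp_mollifiedIntersection_le hB
    (lam := lam ^ 2 / 2) (by positivity) hT
  refine ⟨max K 0, fun t ht V σ2 hV hσ hlaw ↦ ?_⟩
  have hVm : AEStronglyMeasurable (fun p ↦ Real.exp (lam * V p)) (P.prod Q) :=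
    Real.continuous_exp.comp_aestronglyMeasurable (hV.const_mul lam)
  have hle : ∫⁻ p, ENNReal.ofReal (Real.exp (lam * V p)) ∂(P.prod Q) ≤ ENNReal.ofReal K := by
    rw [lintegral_prod_symm _ hVm.aemeasurable.ennreal_ofReal]
    refine le_trans (le_of_eq (lintegral_congr_ae ?_))
      (h.lintegral_exp_selfIntersection_le hB hσ fun ε hε ↦ hK ε t hε ht.1 ht.2)
    filter_upwards [hlaw] with ω' hω'
    rw [lintegral_exp_of_map_eq_gaussianReal hω'.2, Real.coe_toNNReal _ hω'.1]
  refine ⟨⟨hVm, ?_⟩, ?_⟩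
  · simp only [HasFiniteIntegral, Real.enorm_eq_ofReal (Real.exp_pos _).le]
    exact hle.trans_lt ENNReal.ofReal_lt_top
  · rw [integral_eq_lintegral_of_nonneg_ae (ae_of_all _ fun p ↦ (Real.exp_pos _).le) hVm]
    refine (ENNReal.toReal_mono ENNReal.ofReal_ne_top hle).trans (le_of_eq ?_)
    rw [ENNReal.toReal_ofReal']

end ExponentialMoments

section Modification

variable {d : ℕ} {γ : ℝ → ℝ} {Λ : Measure (Space d)}
  {Ω Ω' : Type*} [MeasurableSpace Ω] [MeasurableSpace Ω'] {P : Measure Ω} {Q : Measure Ω'}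
  {W : SpaceTimeTest d → Ω → ℝ} {B B' : ℝ≥0 → Ω' → Space d}

lemma IsRegularized.congr_path (hBB' : ∀ᵐ ω' ∂Q, ∀ s, B s ω' = B' s ω') {ε t : ℝ} {x : Space d}
    {V : Ω × Ω' → ℝ} (hV : IsRegularized P Q γ Λ W B ε t x V) :
    IsRegularized P Q γ Λ W B' ε t x V := by
  refine ⟨hV.1, ?_⟩
  filter_upwards [hV.2, hBB'] with ω' h1 h2
  simpa only [h2] using h1

lemma IsSelfIntersection.congr_path (hBB' : ∀ᵐ ω' ∂Q, ∀ s, B s ω' = B' s ω') {t : ℝ} {Y : Ω' → ℝ}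
    (hY : IsSelfIntersection Q γ Λ B t Y) : IsSelfIntersection Q γ Λ B' t Y := by
  refine ⟨hY.1, hY.2.congr fun ε ↦ eLpNorm_congr_ae ?_⟩
  filter_upwards [hBB'] with ω' h2
  simp only [h2]

/-- The Feynman-Kac weight is integrable, jointly and for almost every noise. -/
lemma integrable_feynmanKac [IsProbabilityMeasure P] [IsProbabilityMeasure Q]
    (u₀ : Space d →ᵇ ℝ) {Z : Ω' → Space d} (hZ : AEMeasurable Z Q) {V : Ω × Ω' → ℝ}
    (hV : Integrable (fun p ↦ Real.exp (V p)) (P.prod Q)) :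
    Integrable (fun p : Ω × Ω' ↦ u₀ (Z p.2) * Real.exp (V p)) (P.prod Q) ∧
      ∀ᵐ ω ∂P, Integrable (fun ω' ↦ u₀ (Z ω') * Real.exp (V (ω, ω'))) Q := by
  have h1 : Integrable (fun p : Ω × Ω' ↦ u₀ (Z p.2) * Real.exp (V p)) (P.prod Q) :=
    hV.bdd_mul (u₀.continuous.measurable.comp_aemeasurable
      (hZ.comp_quasiMeasurePreserving Measure.quasiMeasurePreserving_snd)).aestronglyMeasurable
      (ae_of_all _ fun p ↦ u₀.norm_coe_le_norm _)
  exact ⟨h1, h1.prod_right_ae⟩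

end Modification

end FeynmanKac

theorem mainTheorem3 {d : ℕ} (hd : 0 < d)
    {Ω Ω' : Type*} [MeasurableSpace Ω] [MeasurableSpace Ω']
    (P : Measure Ω) [IsProbabilityMeasure P] (Q : Measure Ω') [IsProbabilityMeasure Q]
    (γ : ℝ → ℝ) (hγ_meas : Measurable γ) (hγ_def : IsNonnegDefinite γ)
    (Λ μ : Measure (Space d)) (hΛ : Λ.HasTemperateGrowth) (hΛμ : IsFourierTransform Λ μ)
    (β C : ℝ) (hβ0 : 0 < β) (hβ1 : β < 1) (hC : 0 < C)
    (hγ_nonneg : ∀ t, 0 ≤ γ t) (hγ_le : ∀ t, t ≠ 0 → γ t ≤ C * |t| ^ (-β))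
    (hμ : ∫⁻ ξ, ENNReal.ofReal (1 / (1 + ‖ξ‖ ^ (2 - 2 * β))) ∂μ < ∞)
    (W : SpaceTimeTest d → Ω → ℝ) (hW : IsGaussianNoise P γ Λ W)
    (B : ℝ≥0 → Ω' → Space d) (hB : IsBrownianMotion Q B) :
    -- the regularised functionals are well defined
    (∀ ε : ℝ, 0 < ε → ∀ t : ℝ, 0 ≤ t → ∀ x : Space d,
      ∃ Y : Ω × Ω' → ℝ, IsRegularized P Q γ Λ W B ε t x Y ∧ MemLp Y 2 (P.prod Q)) ∧
    ∃ V : ℝ → Space d → Ω × Ω' → ℝ,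
      (∀ t : ℝ, 0 ≤ t → ∀ x : Space d,
        -- `V t x` is their limit in `L²`
        MemLp (V t x) 2 (P.prod Q) ∧
        (∀ Vε : ℝ → Ω × Ω' → ℝ,
          (∀ ε : ℝ, 0 < ε → IsRegularized P Q γ Λ W B ε t x (Vε ε)) →
          Tendsto (fun ε : ℝ ↦ eLpNorm (fun p ↦ Vε ε p - V t x p) 2 (P.prod Q))
            (𝓝[>] 0) (𝓝 0)) ∧
        -- conditionally on `B`, it is centered Gaussian with variance `∫∫ γ(r-s) Λ(B_r-B_s) dr ds`
        ∃ σ2 : Ω' → ℝ,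
          IsSelfIntersection Q γ Λ B t σ2 ∧
          (∀ ℓ : Space d → ℝ, Measurable ℓ → (∀ y, 0 ≤ ℓ y) →
            Λ = volume.withDensity (fun y ↦ ENNReal.ofReal (ℓ y)) →
            ∀ᵐ ω' ∂Q,
              IntegrableOn (fun p : ℝ × ℝ ↦
                  γ (p.1 - p.2) * ℓ (B p.1.toNNReal ω' - B p.2.toNNReal ω'))
                (Set.Icc (0 : ℝ) t ×ˢ Set.Icc (0 : ℝ) t) ∧
              σ2 ω' = selfIntersection γ ℓ t (fun s ↦ B s ω')) ∧
          ∀ᵐ ω' ∂Q, 0 ≤ σ2 ω' ∧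
            P.map (fun ω ↦ V t x (ω, ω')) = gaussianReal 0 (σ2 ω').toNNReal) ∧
      -- exponential moments, uniformly in `t ∈ [0,T]` and `x`
      (∀ lam T : ℝ, 0 < T → ∃ K : ℝ, ∀ t ∈ Set.Icc (0 : ℝ) T, ∀ x : Space d,
        Integrable (fun p ↦ Real.exp (lam * V t x p)) (P.prod Q) ∧
        ∫ p, Real.exp (lam * V t x p) ∂(P.prod Q) ≤ K) ∧
      -- the Feynman-Kac functional `E_B[u₀(B_t^x) exp(V_{t,x})]` is well defined
      (∀ u₀ : Space d →ᵇ ℝ, ∀ t : ℝ, 0 ≤ t → ∀ x : Space d,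
        Integrable (fun p : Ω × Ω' ↦ u₀ (x + B t.toNNReal p.2) * Real.exp (V t x p))
          (P.prod Q) ∧
        ∀ᵐ ω ∂P, Integrable
          (fun ω' ↦ u₀ (x + B t.toNNReal ω') * Real.exp (V t x (ω, ω'))) Q) := by
  have h : IsNoiseCovariance γ Λ μ β C :=
    ⟨⟨hγ_meas, hγ_nonneg, hγ_le, hβ0, hβ1, hC⟩, hΛ, hΛμ, hμ⟩
  obtain ⟨B', hB', hBB'⟩ := hB.exists_regular
  have hB'B : ∀ᵐ ω ∂Q, ∀ s, B' s ω = B s ω := by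
    filter_upwards [hBB'] with ω hω s using (hω s).symm
  refine ⟨fun ε hε t _ x ↦ ?_, ?_⟩
  · obtain ⟨Y, hY, hY2⟩ := h.exists_isRegularized hW hB' hε t x
    exact ⟨Y, hY.congr_path hB'B, hY2⟩
  choose V hV2 hVlim σ2 hσ hlaw using fun t x ↦ h.exists_limit hW hB' t x
  have hexp := fun (lam : ℝ) {T : ℝ} (hT : 0 < T) ↦
    h.exists_integral_exp_le (P := P) hB' lam hT
  refine ⟨V, fun t _ x ↦ ⟨hV2 t x, fun Vε hVε ↦ hVlim t x Vε fun ε hε ↦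
    (hVε ε hε).congr_path hBB', σ2 t x, (hσ t x).congr_path hB'B, fun ℓ hℓ hℓ0 hΛℓ ↦ ?_,
    hlaw t x⟩, fun lam T hT ↦ ?_, fun u₀ t ht x ↦ ?_⟩
  · filter_upwards [h.ae_eq_selfIntersection_density hB' hℓ hℓ0 hΛℓ (hσ t x), hBB'] with ω h1 h2
    simpa only [h2] using h1
  · obtain ⟨K, hK⟩ := hexp lam hT
    exact ⟨K, fun t ht x ↦ hK t ht _ _ (hV2 t x).aestronglyMeasurable (hσ t x) (hlaw t x)⟩
  · obtain ⟨K, hK⟩ := hexp 1 (T := t + 1) (by linarith)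
    have hi := (hK t ⟨ht, by linarith⟩ _ _ (hV2 t x).aestronglyMeasurable (hσ t x) (hlaw t x)).1
    simp only [one_mul] at hi
    have hBm : AEMeasurable (B t.toNNReal) Q := (hB'.measurable t.toNNReal).aemeasurable.congr (by
      filter_upwards [hB'B] with ω hω using hω _)
    exact integrable_feynmanKac u₀ (Z := fun ω' ↦ x + B t.toNNReal ω') (hBm.const_add x) hi
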